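/- **Setting.** Let $h(x,y)=y$, $\Sigma=\{y=0\}$, $\Sigma^{\pm}=\{\pm y>0\}$, and let $2\le l\le\infty$. Let $\Omega^l$ be the set of nonsmooth vector fields $Z=(X,Y)$ on $\mathbb R^2$ with $X,Y$ of class $C^l$ ($X$ acts on $y\ge 0$ and $Y$ on $y\le 0$), with the $C^l$ topology (uniform convergence on compact sets of the derivatives of order $\le l$). Write $Xh(p)$ for the second component of $X(p)$. The crossing region is $\Sigma^c=\{p\in\Sigma: Xh(p)\,Yh(p)>0\}$ and the sliding region is $\Sigma^s=\{p\in\Sigma: Xh(p)<0<Yh(p)\}$. Let $Z_0=(X_0,Y_0)\in\Omega^l$ have a degenerate cycle through a saddle-regular point at the origin, that is: * $X_0$ has a hyperbolic saddle at $0\in\Sigma$ whose stable and unstable manifolds are transversal to $\Sigma$ at $0$; * $Y_0$ is transversal at $0$ to $\Sigma$ and to the stable and unstable manifolds of $X_0$; * the first component of the normalized sliding field $(Y_0h)X_0-(X_0h)Y_0$ at $(x,0)$ is $\mu x+O(x^2)$ with $\mu\ne 0$; * the branch in $\Sigma^+$ of the unstable manifold of $0$ meets $\Sigma$ transversally at a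 point $P\neq 0$, the backward $X_0$-trajectory of $P$ being contained in $\Sigma^+$; * $Y_0$ is transversal to $\Sigma$ at $P$, and its trajectory through $P$ arrives at $0$ after a positive time, being in $\Sigma^-$ in between. The coordinate $x$ on $\Sigma$ is oriented so that near $0$ the points with $x<0$ are in $\Sigma^s$ and those with $x>0$ are in $\Sigma^c$. **Statement.** There are a neighborhood $B$ of $0$ in $\mathbb R^2$ and a neighborhood $\mathcal V_{Z_0}$ of $Z_0$ in $\Omega^l$ such that, for every $Z=(X,Y)\in\mathcal V_{Z_0}$, the field $X$ has exactly one equilibrium $S_X$ in $B$, it is a hyperbolic saddle, and the following holds. Let $\beta=\beta(Z)$ be the second coordinate of $S_X$, so that the saddle is real, on $\Sigma$, or virtual according to whether $\beta>0$, $\beta=0$ or $\beta<0$. Suppose that, in a neighborhood of $S_X$, $X$ is $C^2$-conjugate to an affine field $$W(\mathbf x)=A\mathbf x+\mathbf c,\qquad A=\begin{pmatrix}0&a\\ b&0\end{pmatrix},\quad \mathbf c=\begin{pmatrix}-a w_2\\-b w_1\end{pmatrix},\qquad a,b>0,$$ with equilibrium $(w_1,w_2)$, by a $C^2$-diffeomorphism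 that takes $(w_1,w_2)$ to $S_X$ and preserves $\Sigma$ (so the hyperbolicity ratio of $S_X$ is $1$). Then there is exactly one point $(a_Z,0)\in B\cap\Sigma$ such that * if $\beta<0$, $X$ is tangent to $\Sigma$ at $(a_Z,0)$; * if $\beta=0$, $(a_Z,0)=S_X$; * if $\beta>0$, the $X$-trajectory of $(a_Z,0)$ is in $\Sigma^+$ for all $t>0$ and tends to $S_X$ as $t\to+\infty$. For some $\delta_Z>0$ the first return map $\pi_Z$ is defined on $[a_Z,a_Z+\delta_Z)$: for $x\in(a_Z,a_Z+\delta_Z)$, the $X$-trajectory of $(x,0)$ goes through $\Sigma^+$ to a point of $\Sigma^c$, and from there the $Y$-trajectory goes through $\Sigma^-$ to $(\pi_Z(x),0)\in\Sigma$; the value $\pi_Z(a_Z)$ is defined by continuity. With $\alpha=\pi_Z(a_Z)-a_Z$ and in the coordinate $x$ centered at $a_Z$ (that is, $a_Z$ translated to $0$), it expands as $$\pi_Z(a_Z+x)-a_Z=\alpha+k_1x+k_2x^2+o(x^2)\qquad(x\to0^+),$$ where the real numbers $k_1,k_2$ depend on $Z$ and satisfy * $0<|k_1|<1$ if $\beta>0$;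 * $k_1=0$ and $k_2>0$ if $\beta\le 0$. -/

import Mathlib

open Set Filter Topology Asymptotics

/-- The phase plane, with coordinates `(x, y)`. The switching line is `Σ = {y = 0}`, that is
`Σ = h⁻¹(0)` with `h (x, y) = y`, so that the Lie derivative `Xh (p)` is `(X p).2`. -/
abbrev Plane : Type := ℝ × ℝ

/-- The open half plane `Σ⁺ = {h > 0}`. -/
def upperSide : Set Plane := {p | 0 < p.2}

/-- The open half plane `Σ⁻ = {h < 0}`. -/
def lowerSide : Set Plane := {p | p.2 < 0}

/-- `χ^l`: the `C^l` vector fields on the plane (`l = ⊤` means smooth). -/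
def SmoothField (l : ℕ∞) : Type :=
  {X : Plane → Plane // ContDiff ℝ (l : WithTop ℕ∞) X}

/-- The derivatives of order `≤ l` of a `C^l` vector field, as continuous maps. -/
noncomputable def SmoothField.jet {l : ℕ∞} (X : SmoothField l) (i : {i : ℕ // (i : ℕ∞) ≤ l}) :
    C(Plane, ContinuousMultilinearMap ℝ (fun _ : Fin i.1 => Plane) Plane) :=
  ⟨iteratedFDeriv ℝ i.1 X.1, X.2.continuous_iteratedFDeriv (by exact_mod_cast i.2)⟩

/-- The `C^l` topology: uniform convergence on compact sets of all derivatives of order `≤ l`. -/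
noncomputable instance SmoothField.topology (l : ℕ∞) : TopologicalSpace (SmoothField l) :=
  TopologicalSpace.induced SmoothField.jet inferInstance

/-- `Ω^l`: nonsmooth vector fields `Z = (X, Y)`, with `X` acting on `y ≥ 0` and `Y` on `y ≤ 0`,
with the product topology. -/
abbrev NonsmoothField (l : ℕ∞) : Type := SmoothField l × SmoothField l

/-- The crossing region `Σᶜ`. -/
def crossingRegion (X Y : Plane → Plane) : Set Plane :=
  {p | p.2 = 0 ∧ 0 < (X p).2 * (Y p).2}

/-- The sliding region `Σˢ`. -/
def slidingRegion (X Y : Plane → Plane) : Set Plane :=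
  {p | p.2 = 0 ∧ (X p).2 < 0 ∧ 0 < (Y p).2}

/-- The trajectory of `F` through `p` arrives at `q` after some time `T > 0`, and it is in
the set `D` at all times strictly between `0` and `T`. -/
def HasArc (F : Plane → Plane) (D : Set Plane) (p q : Plane) : Prop :=
  ∃ (T : ℝ) (γ : ℝ → Plane), 0 < T ∧ IsIntegralCurveOn γ (fun _ => F) (Icc 0 T) ∧
    γ 0 = p ∧ γ T = q ∧ ∀ t ∈ Ioo 0 T, γ t ∈ D

/-- `S` is a hyperbolic saddle of `X`: an equilibrium at which the derivative of `X` has a negative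
and a positive eigenvalue. -/
def IsHyperbolicSaddle (X : Plane → Plane) (S : Plane) : Prop :=
  X S = 0 ∧ ∃ lam mu : ℝ, lam < 0 ∧ 0 < mu ∧
    Module.End.HasEigenvalue (fderiv ℝ X S : Plane →ₗ[ℝ] Plane) lam ∧
    Module.End.HasEigenvalue (fderiv ℝ X S : Plane →ₗ[ℝ] Plane) mu

/-- The normalized sliding vector field `(Yh) X - (Xh) Y` at `(x, 0)`, read in the chart `x`
of `Σ` (its second component vanishes on `Σ`). -/
def normalizedSliding (X Y : Plane → Plane) (x : ℝ) : ℝ :=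
  (Y (x, 0)).2 * (X (x, 0)).1 - (X (x, 0)).2 * (Y (x, 0)).1

/-- `Z₀ = (X, Y)` has a degenerate cycle through a saddle-regular point at the origin. The invariant
manifolds of a saddle are tangent, at the saddle, to the eigenlines of the derivative, so
transversality to them is expressed with eigenvectors. -/
structure HasDegenerateCycle (X Y : Plane → Plane) : Prop where
  /-- The origin, a point of `Σ`, is a hyperbolic saddle of `X`. -/
  saddle : IsHyperbolicSaddle X 0
  /-- The stable and unstable manifolds of the saddle are transversal to `Σ` there. -/
  manifolds_transversal : ∀ (lam : ℝ) (v : Plane),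
    Module.End.HasEigenvector (fderiv ℝ X 0 : Plane →ₗ[ℝ] Plane) lam v → v.2 ≠ 0
  /-- `Y` is transversal to `Σ` at the saddle. -/
  regular : (Y 0).2 ≠ 0
  /-- `Y` is transversal to the stable and unstable manifolds at the saddle. -/
  regular_transversal : ∀ (lam : ℝ) (v : Plane),
    Module.End.HasEigenvector (fderiv ℝ X 0 : Plane →ₗ[ℝ] Plane) lam v →
      LinearIndependent ℝ ![v, Y 0]
  /-- The saddle is a hyperbolic singularity of the normalized sliding vector field. -/
  sliding_hyperbolic : ∃ mu : ℝ, mu ≠ 0 ∧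
    (fun x : ℝ => normalizedSliding X Y x - mu * x) =O[𝓝 0] fun x : ℝ => x ^ 2
  /-- The branch in `Σ⁺` of the unstable manifold of the saddle reaches `Σ`, transversally, at a
  point `P = (p, 0)` other than the saddle, and is in `Σ⁺` before; the trajectory of `Y` through
  `P` is transversal to `Σ` at `P` and goes through `Σ⁻` to the saddle. -/
  connection : ∃ p : ℝ, p ≠ 0 ∧
    (∃ γ : ℝ → Plane, IsIntegralCurveOn γ (fun _ => X) (Iic 0) ∧ γ 0 = (p, 0) ∧
      Tendsto γ atBot (𝓝 0) ∧ ∀ t < 0, γ t ∈ upperSide) ∧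
    (X (p, 0)).2 ≠ 0 ∧ (Y (p, 0)).2 ≠ 0 ∧ HasArc Y lowerSide (p, 0) 0

/-- The chart `x` of `Σ` is oriented so that, near the saddle-regular point at the origin, `x < 0`
is the sliding region and `x > 0` is the crossing region. -/
def SlidingLeftCrossingRight (X Y : Plane → Plane) : Prop :=
  (∀ᶠ x : ℝ in 𝓝[<] 0, (x, 0) ∈ slidingRegion X Y) ∧
    ∀ᶠ x : ℝ in 𝓝[>] 0, (x, 0) ∈ crossingRegion X Y

/-- The affine field `W(x) = A x + c`, `A = (0 a; b 0)`, `c = (-a w₂, -b w₁)`, with equilibrium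
`w = (w₁, w₂)`. -/
def affineSaddle (a b : ℝ) (w : Plane) : Plane → Plane :=
  fun q => (a * (q.2 - w.2), b * (q.1 - w.1))

/-- Near its equilibrium `S`, the field `X` is `C²`-conjugate to some `affineSaddle a b w` with
`a, b > 0`, by a conjugacy `ψ` that preserves `Σ`. -/
def IsResonantLinearizableAt (X : Plane → Plane) (S : Plane) : Prop :=
  ∃ (a b : ℝ) (w : Plane) (ψ : OpenPartialHomeomorph Plane Plane), 0 < a ∧ 0 < b ∧
    w ∈ ψ.source ∧ ψ w = S ∧
    ContDiffOn ℝ 2 ψ ψ.source ∧ ContDiffOn ℝ 2 ψ.symm ψ.target ∧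
    (∀ q ∈ ψ.source, fderiv ℝ ψ q (affineSaddle a b w q) = X (ψ q)) ∧
    ∀ q ∈ ψ.source, (ψ q).2 = 0 ↔ q.2 = 0

/-- The point `(a, 0)` of `Σ` bounds the domain of the first return map, `S` being the saddle
of `X`: the tangency point of `X` with `Σ` if `S` is virtual, `S` itself if `S` is in `Σ`, and the
point where the stable manifold of `S` meets `Σ` if `S` is real. -/
def IsReturnEndpoint (X : Plane → Plane) (S : Plane) (a : ℝ) : Prop :=
  (S.2 < 0 → (X (a, 0)).2 = 0) ∧
  (S.2 = 0 → (a, 0) = S) ∧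
  (0 < S.2 → ∃ γ : ℝ → Plane, IsIntegralCurveOn γ (fun _ => X) (Ici 0) ∧ γ 0 = (a, 0) ∧
    (∀ t > 0, γ t ∈ upperSide) ∧ Tendsto γ atTop (𝓝 S))

/-- `(x', 0)` is the first return to `Σ` (after one turn around the cycle) of the trajectory
of `Z = (X, Y)` through `(x, 0)`: an arc of `X` in `Σ⁺` to a crossing point `(p, 0)`, followed by an
arc of `Y` in `Σ⁻`. -/
def IsFirstReturn (X Y : Plane → Plane) (x x' : ℝ) : Prop :=
  ∃ p : ℝ, HasArc X upperSide (x, 0) (p, 0) ∧ (p, 0) ∈ crossingRegion X Y ∧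
    HasArc Y lowerSide (p, 0) (x', 0)

/-- `π` is the first return map of `Z = (X, Y)` on `[a, a + δ)`. Its value at the end point `a` is
the one given by continuity (a trajectory that starts on the stable manifold of the saddle does not
itself return). -/
def IsFirstReturnMap (X Y : Plane → Plane) (a δ : ℝ) (π : ℝ → ℝ) : Prop :=
  0 < δ ∧ (∀ x ∈ Ioo a (a + δ), IsFirstReturn X Y x (π x)) ∧ ContinuousWithinAt π (Ici a) a

/-! The proof rests on one formula for the derivative of the return map. Along a planar flow, the
area spanned by a transported vector and the field is multiplied by the Jacobian J = exp ∫ div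
(`IsFlow.areaForm_fderiv`). Hence the derivative of a hitting map of Σ is J times the area of
(initial vector, initial velocity), divided by the normal speed at arrival
(`IsFlow.hasFDerivAt_hittingMap`). For a start on Σ in the direction (1, 0) this area is the normal
speed Xh(x, 0). So π'(x) is Xh(x, 0) times a positive factor, and two things remain: to bound that
factor above and below uniformly in x, and to show that π is C² up to the end point a.

The danger for the factor is the unbounded time spent near the saddle. A C² conjugacy to a saddle of
ratio one forces div X(S) = 0 (`IsResonantLinearizableAt.planeDiv_eq_zero`), so |div X| ≤ L |q - S|
near S. The integral of |q - S| along an orbit inside a small box is bounded independently of time: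
hyperbolicity provides a function of size at most |q - S| that increases along orbits at a rate
proportional to |q - S| (`IsConePair.exists_clock`, `IsSaddleField.flowJacobian_bounds`). The rest
of the turn consists of two regular arcs, which persist with uniform bounds
(`exists_return_family`).

For the regularity, π is written to the right of a as Q ∘ m, where Q is the C² return from a
neighborhood of a point of the unstable manifold and m is a C² curve of points on the orbits of (x,
0). If β < 0, a is a visible fold and m is a fixed-time map of the flow. If β ≥ 0, the eigenvalues
in the linearizing coordinates are opposite, so z₁z₂ is a first integral and orbits leave through z₂
= ζ₀ at (z₁z₂/ζ₀, ζ₀); this is a polynomial in the entry point although the passage time is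
logarithmic (`IsSaddleField.exists_exit_curve`).

The signs then follow from `exists_expansion`. If β > 0, Xh(a, 0) is positive and small, hence 0 <
k₁ < 1. If β ≤ 0, Xh(a, 0) = 0 and Xh(x, 0) grows at least linearly, hence k₁ = 0 and π''(a) > 0.

To make the local estimates global, X is replaced near 0 by a cutoff field that is Lipschitz close
to the linear part of X₀; cone inequalities then hold for the difference of any two orbits. If X₀
has nonzero trace at 0, no nearby saddle has ratio one and the last part of the statement is void.
-/

section Flow

/-! ### C² flows of Lipschitz fields, by the implicit function theorem in a space of curves. -/

variable {E F : Type} [NormedAddCommGroup E] [NormedSpace ℝ E] [NormedAddCommGroup F]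
  [NormedSpace ℝ F]

/-- Pointwise application of a continuous family of linear maps to a continuous curve. -/
noncomputable def ContinuousMap.applyCLM (K : Type) [TopologicalSpace K] [CompactSpace K] :
    C(K, E →L[ℝ] F) →L[ℝ] C(K, E) →L[ℝ] C(K, F) :=
  LinearMap.mkContinuous₂
    (LinearMap.mk₂ ℝ (fun (A : C(K, E →L[ℝ] F)) (h : C(K, E)) =>
        (⟨fun t => A t (h t), A.continuous.clm_apply h.continuous⟩ : C(K, F)))
      (fun _ _ _ => by ext; simp) (fun _ _ _ => by ext; simp)
      (fun _ _ _ => by ext; simp) (fun _ _ _ => by ext; simp)) 1 (by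
    intro A h
    rw [one_mul, ContinuousMap.norm_le _ (by positivity)]
    intro t
    exact ((A t).le_opNorm _).trans (mul_le_mul (A.norm_coe_le_norm t) (h.norm_coe_le_norm t)
      (by positivity) (by positivity)))

theorem ContinuousMap.applyCLM_apply {K : Type} [TopologicalSpace K] [CompactSpace K]
    (A : C(K, E →L[ℝ] F)) (h : C(K, E)) (t : K) :
    ContinuousMap.applyCLM K A h t = A t (h t) := rfl

/-- The mean value inequality is applied on each segment from γ(t) to γ(t) + h(t). Continuity of γ ↦
f' ∘ γ in the sup norm makes the variation of f' on these segments small uniformly in t. -/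
theorem hasFDerivAt_postcomp {K : Type} [TopologicalSpace K] [CompactSpace K] {f : E → F}
    (hf : ContDiff ℝ 1 f) (γ : C(K, E)) :
    HasFDerivAt (fun γ : C(K, E) => (⟨f, hf.continuous⟩ : C(E, F)).comp γ)
      (ContinuousMap.applyCLM K
        ((⟨fderiv ℝ f, hf.continuous_fderiv one_ne_zero⟩ : C(E, E →L[ℝ] F)).comp γ)) γ := by
  rw [hasFDerivAt_iff_isLittleO_nhds_zero, Asymptotics.isLittleO_iff]
  intro c hc
  have hcont : Continuous (fun γ : C(K, E) =>
      (⟨fderiv ℝ f, hf.continuous_fderiv one_ne_zero⟩ : C(E, E →L[ℝ] F)).comp γ) :=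
    ContinuousMap.continuous_postcomp _
  obtain ⟨δ, hδ, H⟩ := (Metric.continuousAt_iff (α := C(K, E))
    (β := C(K, E →L[ℝ] F))).1 (hcont.continuousAt (x := γ)) c hc
  filter_upwards [Metric.ball_mem_nhds (0 : C(K, E)) hδ] with h hh
  rw [ContinuousMap.norm_le _ (by positivity)]
  intro t
  have hseg : ∀ x ∈ segment ℝ (γ t) (γ t + h t), ‖fderiv ℝ f x - fderiv ℝ f (γ t)‖ ≤ c := by
    intro x hx
    rw [segment_eq_image'] at hx
    obtain ⟨s, hs, rfl⟩ := hx
    have h1 : dist (γ + s • h) γ < δ := by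
      rw [dist_eq_norm, add_sub_cancel_left, norm_smul, Real.norm_of_nonneg hs.1]
      refine lt_of_le_of_lt ?_ (mem_ball_zero_iff.1 hh)
      exact mul_le_of_le_one_left (norm_nonneg _) hs.2
    have h2 := ((ContinuousMap.dist_apply_le_dist t).trans (H h1).le)
    simpa [dist_eq_norm] using h2
  have := (convex_segment (γ t) (γ t + h t)).norm_image_sub_le_of_norm_hasFDerivWithin_le'
    (f := f) (fun x _ => ((hf.differentiable one_ne_zero) x).hasFDerivAt.hasFDerivWithinAt)
    hseg (left_mem_segment ℝ _ _) (right_mem_segment ℝ _ _)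
  rw [add_sub_cancel_left] at this
  refine le_trans ?_ (this.trans (mul_le_mul_of_nonneg_left (h.norm_coe_le_norm t) hc.le))
  simp [ContinuousMap.applyCLM_apply]

/-- The derivative at γ is pointwise application of f' ∘ γ, again a superposition operator, so
smoothness is gained one order at a time. -/
theorem contDiff_postcomp_succ {K : Type} [TopologicalSpace K] [CompactSpace K] {f : E → F}
    {n : ℕ} (hf : ContDiff ℝ 1 f)
    (h : ContDiff ℝ n (fun γ : C(K, E) =>
      (⟨fderiv ℝ f, hf.continuous_fderiv one_ne_zero⟩ : C(E, E →L[ℝ] F)).comp γ)) :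
    ContDiff ℝ (n + 1) (fun γ : C(K, E) => (⟨f, hf.continuous⟩ : C(E, F)).comp γ) := by
  rw [contDiff_succ_iff_hasFDerivAt]
  exact ⟨fun γ => ContinuousMap.applyCLM K _, (ContinuousMap.applyCLM K).contDiff.comp h,
    fun γ => hasFDerivAt_postcomp hf γ⟩

theorem contDiff_two_postcomp {K : Type} [TopologicalSpace K] [CompactSpace K] {f : E → F}
    (hf : ContDiff ℝ 2 f) :
    ContDiff ℝ 2 (fun γ : C(K, E) => (⟨f, hf.continuous⟩ : C(E, F)).comp γ) := by
  have h1 : ContDiff ℝ 1 f := hf.of_le (by norm_num)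
  have h2 : ContDiff ℝ 1 (fderiv ℝ f) := hf.fderiv_right (by norm_num)
  have := contDiff_postcomp_succ (K := K) (n := 1) h1 (by
    have := contDiff_postcomp_succ (K := K) (n := 0) h2 (by
      rw [Nat.cast_zero, contDiff_zero]; exact ContinuousMap.continuous_postcomp _)
    simpa using this)
  norm_num at this
  exact this

open unitInterval in
/-- The primitive vanishing at `0` of a continuous curve on the unit interval. -/
noncomputable def primitiveCLM (E : Type) [NormedAddCommGroup E] [NormedSpace ℝ E] :
    C(I, E) →L[ℝ] C(I, E) :=
  LinearMap.mkContinuous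
    { toFun := fun γ => ⟨fun t => ∫ s in (0 : ℝ)..t, γ (projIcc 0 1 zero_le_one s), by
        have : Continuous fun s : ℝ => γ (projIcc 0 1 zero_le_one s) :=
          γ.continuous.comp continuous_projIcc
        exact (intervalIntegral.continuous_primitive (fun a b => this.intervalIntegrable a b) 0).comp
          continuous_subtype_val⟩
      map_add' := fun γ η => by
        ext t
        have h1 : Continuous fun s : ℝ => γ (projIcc 0 1 zero_le_one s) :=
          γ.continuous.comp continuous_projIcc
        have h2 : Continuous fun s : ℝ => η (projIcc 0 1 zero_le_one s) :=
          η.continuous.comp continuous_projIcc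
        simp [intervalIntegral.integral_add (h1.intervalIntegrable _ _)
          (h2.intervalIntegrable _ _)]
      map_smul' := fun c γ => by ext t; simp } 1 (by
    intro γ
    rw [one_mul, ContinuousMap.norm_le _ (norm_nonneg _)]
    intro t
    have := intervalIntegral.norm_integral_le_of_norm_le_const (a := (0 : ℝ)) (b := t)
      (f := fun s : ℝ => γ (projIcc 0 1 zero_le_one s)) (C := ‖γ‖)
      (fun s _ => γ.norm_coe_le_norm _)
    refine this.trans (mul_le_of_le_one_right (norm_nonneg _) ?_)
    rw [sub_zero, abs_of_nonneg t.2.1]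
    exact t.2.2)

theorem primitiveCLM_apply (γ : C(unitInterval, E)) (t : unitInterval) :
    primitiveCLM E γ t = ∫ s in (0 : ℝ)..t, γ (projIcc 0 1 zero_le_one s) := rfl

end Flow

section Flow

variable {E : Type} [NormedAddCommGroup E] [NormedSpace ℝ E]

theorem norm_integral_projIcc_le {δ : C(unitInterval, E)} {C : ℝ} {n : ℕ} {t : unitInterval}
    (h : ∀ s : unitInterval, ‖δ s‖ ≤ C * (s : ℝ) ^ n) :
    ‖∫ s in (0 : ℝ)..t, δ (projIcc 0 1 zero_le_one s)‖ ≤ C * ((t : ℝ) ^ (n + 1) / (n + 1)) := by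
  have h1 := intervalIntegral.norm_integral_le_of_norm_le (a := (0 : ℝ)) (b := t)
    (f := fun s : ℝ => δ (projIcc 0 1 zero_le_one s)) (g := fun s => C * s ^ n)
    (μ := MeasureTheory.volume) t.2.1
    (by
      refine Filter.Eventually.of_forall fun s hs => ?_
      have hs' : s ∈ Icc (0 : ℝ) 1 := ⟨hs.1.le, hs.2.trans t.2.2⟩
      have := h (projIcc 0 1 zero_le_one s)
      rwa [projIcc_of_mem zero_le_one hs'] at this ⊢)
    ((continuous_const.mul (continuous_pow n)).intervalIntegrable _ _)
  refine h1.trans (le_of_eq ?_)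
  rw [intervalIntegral.integral_const_mul, integral_pow]
  simp

/-- Each iteration integrates the previous pointwise bound in t, and the successive primitives of tⁿ
produce the factorial. -/
theorem volterra_iterate_le {P : C(unitInterval, E) → C(unitInterval, E)} {M : ℝ} (hM : 0 ≤ M)
    (hP : ∀ γ η t, ‖P γ t - P η t‖ ≤ M * ‖γ t - η t‖) (c : C(unitInterval, E))
    (γ η : C(unitInterval, E)) (n : ℕ) (t : unitInterval) :
    ‖((fun γ => c + primitiveCLM E (P γ))^[n] γ) t - ((fun γ => c + primitiveCLM E (P γ))^[n] η) t‖
      ≤ ‖γ - η‖ * (M ^ n / n.factorial) * (t : ℝ) ^ n := by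
  induction n generalizing t with
  | zero => simpa using (γ - η).norm_coe_le_norm t
  | succ n ih =>
    rw [Function.iterate_succ_apply', Function.iterate_succ_apply']
    set γ' := (fun γ => c + primitiveCLM E (P γ))^[n] γ
    set η' := (fun γ => c + primitiveCLM E (P γ))^[n] η
    have h0 : (c + primitiveCLM E (P γ')) t - (c + primitiveCLM E (P η')) t
        = ∫ s in (0 : ℝ)..t, (P γ' - P η') (projIcc 0 1 zero_le_one s) := by
      rw [← primitiveCLM_apply, map_sub]; simp
    rw [h0]
    refine (norm_integral_projIcc_le (C := ‖γ - η‖ * (M ^ (n + 1) / n.factorial)) (n := n)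
      fun s => ?_).trans (le_of_eq ?_)
    · refine (hP γ' η' s).trans ((mul_le_mul_of_nonneg_left (ih s) hM).trans (le_of_eq ?_))
      rw [pow_succ]; ring
    · rw [Nat.factorial_succ]; push_cast
      have : (n.factorial : ℝ) ≠ 0 := by positivity
      field_simp

/-- Mⁿ/n! tends to 0, so some iterate is a contraction whatever the size of M. This serves twice:
for the nonlinear integral equation and for its linearization. -/
theorem volterra_existsUnique [CompleteSpace E] {P : C(unitInterval, E) → C(unitInterval, E)}
    {M : ℝ} (hM : 0 ≤ M) (hP : ∀ γ η t, ‖P γ t - P η t‖ ≤ M * ‖γ t - η t‖)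
    (c : C(unitInterval, E)) : ∃! γ, γ = c + primitiveCLM E (P γ) := by
  set V : C(unitInterval, E) → C(unitInterval, E) := fun γ => c + primitiveCLM E (P γ) with hV
  obtain ⟨n, hn⟩ : ∃ n : ℕ, M ^ n / n.factorial < 1 / 2 :=
    ((FloorSemiring.tendsto_pow_div_factorial_atTop M).eventually
      (gt_mem_nhds (by norm_num : (0 : ℝ) < 1 / 2))).exists
  have hlip : LipschitzWith (1 / 2) V^[n] := by
    refine LipschitzWith.of_dist_le_mul fun γ η => ?_
    rw [dist_eq_norm, dist_eq_norm, ContinuousMap.norm_le _ (by positivity)]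
    intro t
    refine (volterra_iterate_le hM hP c γ η n t).trans ?_
    have h1 : (t : ℝ) ^ n ≤ 1 := pow_le_one₀ t.2.1 t.2.2
    have h2 : 0 ≤ M ^ n / n.factorial := by positivity
    have h3 : 0 ≤ (t : ℝ) ^ n := pow_nonneg t.2.1 n
    calc ‖γ - η‖ * (M ^ n / n.factorial) * (t : ℝ) ^ n
        ≤ ‖γ - η‖ * (1 / 2) * 1 := by gcongr
      _ = _ := by push_cast; ring
  have hc : ContractingWith (1 / 2) V^[n] := ⟨by
    rw [← NNReal.coe_lt_coe]; push_cast; norm_num, hlip⟩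
  refine ⟨_, (hc.isFixedPt_fixedPoint_iterate).symm, fun η hη => ?_⟩
  exact hc.fixedPoint_unique (Function.IsFixedPt.iterate (show V η = η from hη.symm) n)

/-- The constant curves, as a continuous linear map. -/
noncomputable def constCurveCLM (E : Type) [NormedAddCommGroup E] [NormedSpace ℝ E] :
    E →L[ℝ] C(unitInterval, E) :=
  LinearMap.mkContinuous
    { toFun := fun x => ContinuousMap.const _ x
      map_add' := fun _ _ => rfl
      map_smul' := fun _ _ => rfl } 1 (fun x => by
    rw [one_mul, ContinuousMap.norm_le _ (norm_nonneg _)]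
    exact fun _ => le_rfl)

/-- The parameter p is (time, initial point), with time rescaled so that all curves live on the unit
interval. The linearized equation is the identity minus a Volterra operator, hence invertible, and
the implicit function theorem makes the solution C² in p. -/
theorem exists_contDiff_curve [CompleteSpace E] {f : E → E} (hf : ContDiff ℝ 2 f) {M : NNReal}
    (hM : LipschitzWith M f) :
    ∃ S : ℝ × E → C(unitInterval, E), ContDiff ℝ 2 S ∧ ∀ p γ,
      γ = ContinuousMap.const _ p.2 +
        p.1 • primitiveCLM E ((⟨f, hf.continuous⟩ : C(E, E)).comp γ) ↔ γ = S p := by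
  set N : C(unitInterval, E) → C(unitInterval, E) :=
    fun γ => (⟨f, hf.continuous⟩ : C(E, E)).comp γ with hN
  have hf1 : ContDiff ℝ 1 f := hf.of_le (by norm_num)
  have hNc : ContDiff ℝ 2 N := contDiff_two_postcomp hf
  have key : ∀ p : ℝ × E, ∃! γ, γ = ContinuousMap.const _ p.2 + p.1 • primitiveCLM E (N γ) := by
    intro p
    have := volterra_existsUnique (P := fun γ => p.1 • N γ) (M := |p.1| * M) (by positivity)
      (fun γ η t => by
        have h := hM.dist_le_mul (γ t) (η t)
        rw [dist_eq_norm, dist_eq_norm] at h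
        have h2 : (p.1 • N γ) t - (p.1 • N η) t = p.1 • (f (γ t) - f (η t)) := by
          simp [hN, smul_sub]
        rw [h2, norm_smul, Real.norm_eq_abs, mul_assoc]
        exact mul_le_mul_of_nonneg_left h (abs_nonneg _)) (ContinuousMap.const _ p.2)
    simpa only [map_smul] using this
  choose S hS hSu using key
  have hiff : ∀ p γ, γ = ContinuousMap.const _ p.2 + p.1 • primitiveCLM E (N γ) ↔ γ = S p :=
    fun p γ => ⟨fun h => hSu p γ h, fun h => h ▸ hS p⟩
  refine ⟨S, contDiff_iff_contDiffAt.2 fun p => ?_, hiff⟩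
  set G : (ℝ × E) × C(unitInterval, E) → C(unitInterval, E) := fun z =>
    z.2 - (constCurveCLM E z.1.2 + z.1.1 • primitiveCLM E (N z.2)) with hG
  have hGc : ContDiff ℝ 2 G := by
    have h1 : ContDiff ℝ 2 fun z : (ℝ × E) × C(unitInterval, E) => N z.2 :=
      hNc.comp contDiff_snd
    have h2 : ContDiff ℝ 2 fun z : (ℝ × E) × C(unitInterval, E) => primitiveCLM E (N z.2) :=
      (primitiveCLM E).contDiff.comp h1
    have h3 : ContDiff ℝ 2 fun z : (ℝ × E) × C(unitInterval, E) =>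
        constCurveCLM E z.1.2 :=
      (constCurveCLM E).contDiff.comp (contDiff_snd.comp contDiff_fst)
    exact contDiff_snd.sub (h3.add ((contDiff_fst.comp contDiff_fst).smul h2))
  have hG0 : ∀ z, G z = 0 ↔ z.2 = S z.1 := by
    intro z; rw [hG, sub_eq_zero]; exact hiff z.1 z.2
  set A : C(unitInterval, E →L[ℝ] E) :=
    (⟨fderiv ℝ f, hf1.continuous_fderiv one_ne_zero⟩ : C(E, E →L[ℝ] E)).comp (S p) with hA
  have hder : fderiv ℝ G (p, S p) ∘L .inr ℝ (ℝ × E) C(unitInterval, E) =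
      .id ℝ _ - p.1 • (primitiveCLM E ∘L ContinuousMap.applyCLM unitInterval A) := by
    have h1 : HasFDerivAt (fun γ => G (p, γ))
        (fderiv ℝ G (p, S p) ∘L .inr ℝ (ℝ × E) C(unitInterval, E)) (S p) :=
      HasFDerivAt.comp (S p) (hGc.differentiable two_ne_zero (p, S p)).hasFDerivAt
        (hasFDerivAt_prodMk_right p (S p))
    have h4 : HasFDerivAt (fun γ => primitiveCLM E (N γ))
        (primitiveCLM E ∘L ContinuousMap.applyCLM unitInterval A) (S p) :=
      (primitiveCLM E).hasFDerivAt.comp (S p) (hasFDerivAt_postcomp hf1 (S p))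
    have h3 : HasFDerivAt (fun γ => constCurveCLM E p.2 + p.1 • primitiveCLM E (N γ))
        (p.1 • (primitiveCLM E ∘L ContinuousMap.applyCLM unitInterval A)) (S p) :=
      (h4.const_smul p.1).const_add _
    have h2 : HasFDerivAt (fun γ => G (p, γ))
        (.id ℝ _ - p.1 • (primitiveCLM E ∘L ContinuousMap.applyCLM unitInterval A)) (S p) :=
      (hasFDerivAt_id (S p)).sub h3
    exact h1.unique h2
  have hinv : (fderiv ℝ G (p, S p) ∘L .inr ℝ (ℝ × E) C(unitInterval, E)).IsInvertible := by
    rw [hder]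
    have hbij : ∀ c : C(unitInterval, E), ∃! h : C(unitInterval, E),
        (ContinuousLinearMap.id ℝ C(unitInterval, E) -
          p.1 • (primitiveCLM E ∘L ContinuousMap.applyCLM unitInterval A)) h = c := by
      intro c
      have := volterra_existsUnique (P := fun h => p.1 • ContinuousMap.applyCLM _ A h)
        (M := |p.1| * ‖A‖) (by positivity) (fun γ η t => by
          have h2 : (p.1 • ContinuousMap.applyCLM _ A γ) t - (p.1 • ContinuousMap.applyCLM _ A η) t
              = p.1 • A t (γ t - η t) := by
            simp [smul_sub, ContinuousMap.applyCLM_apply]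
          rw [h2, norm_smul, Real.norm_eq_abs, mul_assoc]
          refine mul_le_mul_of_nonneg_left (((A t).le_opNorm _).trans ?_) (abs_nonneg _)
          exact mul_le_mul_of_nonneg_right (A.norm_coe_le_norm t) (norm_nonneg _)) c
      refine (existsUnique_congr fun h => ?_).1 this
      rw [map_smul]
      exact (sub_eq_iff_eq_add (a := h) (b := p.1 • primitiveCLM E (ContinuousMap.applyCLM _ A h))
        (c := c)).symm
    have hb : Function.Bijective
        (ContinuousLinearMap.id ℝ C(unitInterval, E) -
          p.1 • (primitiveCLM E ∘L ContinuousMap.applyCLM unitInterval A)) :=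
      Function.bijective_iff_existsUnique _ |>.2 hbij
    exact ⟨ContinuousLinearEquiv.ofBijective _ (LinearMap.ker_eq_bot.2 hb.1)
      (LinearMap.range_eq_top.2 hb.2), ContinuousLinearEquiv.coe_ofBijective _ _ _⟩
  have hGa : ContDiffAt ℝ 2 G (p, S p) := hGc.contDiffAt
  have hev := hGa.eventually_apply_implicitFunction two_ne_zero hinv
  refine (hGa.contDiffAt_implicitFunction two_ne_zero hinv).congr_of_eventuallyEq ?_
  filter_upwards [hev] with x hx
  rw [(hG0 (p, S p)).2 rfl, hG0] at hx
  exact hx.symm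

/-- A complete `C²` flow of the vector field `f`. -/
structure IsFlow (f : E → E) (φ : ℝ → E → E) : Prop where
  field_contDiff : ContDiff ℝ 2 f
  lipschitz : ∃ M : NNReal, LipschitzWith M f
  contDiff : ContDiff ℝ 2 (Function.uncurry φ)
  zero : ∀ x, φ 0 x = x
  hasDerivAt : ∀ x t, HasDerivAt (fun t => φ t x) (f (φ t x)) t

theorem exists_isFlow [CompleteSpace E] {f : E → E} (hf : ContDiff ℝ 2 f) {M : NNReal}
    (hM : LipschitzWith M f) : ∃ φ, IsFlow f φ := by
  obtain ⟨S, hS, hSiff⟩ := exists_contDiff_curve hf hM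
  have hφc : ContDiff ℝ 2 fun p : ℝ × E => S p 1 :=
    (ContinuousMap.evalCLM (M := E) ℝ (1 : unitInterval)).contDiff.comp hS
  have heq : ∀ p (t : unitInterval), S p t =
      p.2 + p.1 • ∫ s in (0 : ℝ)..t, f (S p (projIcc 0 1 zero_le_one s)) := by
    intro p t
    have := congrArg (fun γ : C(unitInterval, E) => γ t) ((hSiff p (S p)).2 rfl)
    simpa [primitiveCLM_apply] using this
  -- Both sides, run along the unit interval, solve the integral equation for the shorter total
  -- time. This converts the rescaled parameter back into genuine time.
  have hscale : ∀ p (t : unitInterval), S p t = S ((t : ℝ) * p.1, p.2) 1 := by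
    intro p t
    set γ : C(unitInterval, E) := ⟨fun s => S p (t * s), by fun_prop⟩ with hγ
    have : γ = S ((t : ℝ) * p.1, p.2) := by
      rw [← hSiff]
      ext s
      have h1 : γ s = S p (t * s) := rfl
      rw [h1, heq]
      simp only [ContinuousMap.add_apply, ContinuousMap.const_apply, ContinuousMap.smul_apply,
        primitiveCLM_apply]
      rw [mul_comm (t : ℝ), mul_smul]
      congr 2
      have h2 := intervalIntegral.smul_integral_comp_mul_left (a := (0 : ℝ)) (b := s)
        (fun r => f (S p (projIcc 0 1 zero_le_one r))) (t : ℝ)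
      rw [mul_zero] at h2
      have h3 : ((t * s : unitInterval) : ℝ) = (t : ℝ) * s := rfl
      rw [h3, ← h2]
      congr 1
      refine intervalIntegral.integral_congr fun r hr => ?_
      rw [uIcc_of_le s.2.1] at hr
      have hr' : r ∈ Icc (0 : ℝ) 1 := ⟨hr.1, hr.2.trans s.2.2⟩
      have hr2 : (t : ℝ) * r ∈ Icc (0 : ℝ) 1 :=
        ⟨mul_nonneg t.2.1 hr'.1, mul_le_one₀ t.2.2 hr'.1 hr'.2⟩
      simp only [hγ, ContinuousMap.comp_apply, ContinuousMap.coe_mk]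
      rw [projIcc_of_mem zero_le_one hr', projIcc_of_mem zero_le_one hr2]
      rfl
    have h1 : S p t = γ 1 := by simp [hγ]
    rw [h1, this]
  refine ⟨fun t x => S (t, x) 1, hf, ⟨M, hM⟩, hφc, fun x => ?_, fun x t => ?_⟩
  · simpa using heq (0, x) 1
  · have hint : ∀ t : ℝ, S (t, x) 1 = x + ∫ s in (0 : ℝ)..t, f (S (s, x) 1) := by
      intro t
      rw [heq]
      congr 1
      have h2 := intervalIntegral.smul_integral_comp_mul_left (a := (0 : ℝ)) (b := 1)
        (fun r => f (S (r, x) 1)) t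
      rw [mul_zero, mul_one] at h2
      rw [← h2]
      simp only [Icc.coe_one]
      congr 1
      refine intervalIntegral.integral_congr fun r hr => ?_
      rw [uIcc_of_le zero_le_one] at hr
      rw [projIcc_of_mem zero_le_one hr, hscale]
      simp [mul_comm]
    have hcont : Continuous fun s : ℝ => f (S (s, x) 1) :=
      hf.continuous.comp (hφc.continuous.comp (by fun_prop : Continuous fun s : ℝ => (s, x)))
    have := (intervalIntegral.integral_hasDerivAt_right (hcont.intervalIntegrable 0 t)
      (hcont.stronglyMeasurableAtFilter _ _) hcont.continuousAt).const_add x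
    refine this.congr_of_eventuallyEq (Filter.Eventually.of_forall fun s => ?_)
    exact hint s

end Flow

/-! ### Uniqueness of integral curves and general properties of flows. -/

section Uniqueness

variable {E : Type} [NormedAddCommGroup E] [NormedSpace ℝ E]

/-- Integral curves of a `C¹` field on a compact interval are determined by their initial point. -/
theorem integralCurveOn_eqOn [ProperSpace E] {f : E → E} (hf : ContDiff ℝ 1 f) {γ η : ℝ → E}
    {a b : ℝ} (hγ : IsIntegralCurveOn γ (fun _ => f) (Icc a b))
    (hη : IsIntegralCurveOn η (fun _ => f) (Icc a b)) (h : γ a = η a) : EqOn γ η (Icc a b) := by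
  obtain ⟨R, hR⟩ := ((isCompact_Icc.image_of_continuousOn hγ.continuousOn).union
    (isCompact_Icc.image_of_continuousOn hη.continuousOn)).isBounded.subset_closedBall 0
  obtain ⟨K, hK⟩ := (hf.contDiffOn (s := Metric.closedBall 0 R)).exists_lipschitzOnWith one_ne_zero
    (convex_closedBall _ _) (isCompact_closedBall _ _)
  have hd : ∀ {γ : ℝ → E}, IsIntegralCurveOn γ (fun _ => f) (Icc a b) →
      ∀ t ∈ Ico a b, HasDerivWithinAt γ (f (γ t)) (Ici t) t := fun hγ t ht =>
    (hγ t (Ico_subset_Icc_self ht)).mono_of_mem_nhdsWithin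
      (mem_of_superset (Icc_mem_nhdsGE ht.2) (Icc_subset_Icc_left ht.1))
  exact ODE_solution_unique_of_mem_Icc_right (v := fun _ => f) (s := fun _ => Metric.closedBall 0 R)
    (fun _ _ => hK) hγ.continuousOn (hd hγ)
    (fun t ht => hR (Or.inl (mem_image_of_mem _ (Ico_subset_Icc_self ht)))) hη.continuousOn (hd hη)
    (fun t ht => hR (Or.inr (mem_image_of_mem _ (Ico_subset_Icc_self ht)))) h

end Uniqueness

namespace IsFlow

section General

variable {E : Type} [NormedAddCommGroup E] [NormedSpace ℝ E] {f : E → E} {φ : ℝ → E → E}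

theorem contDiff_map (h : IsFlow f φ) (t : ℝ) : ContDiff ℝ 2 (φ t) :=
  h.contDiff.comp (contDiff_prodMk_right t)

theorem continuous_map (h : IsFlow f φ) (t : ℝ) : Continuous (φ t) := (h.contDiff_map t).continuous

theorem continuous_orbit (h : IsFlow f φ) (x : E) : Continuous fun t => φ t x :=
  h.contDiff.continuous.comp (by fun_prop : Continuous fun t : ℝ => (t, x))

theorem field_contDiff_one (h : IsFlow f φ) : ContDiff ℝ 1 f := h.field_contDiff.of_le (by norm_num)

theorem isIntegralCurveOn (h : IsFlow f φ) (x : E) (s : Set ℝ) :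
    IsIntegralCurveOn (fun t => φ t x) (fun _ => f) s := fun t _ =>
  (h.hasDerivAt x t).hasDerivWithinAt

theorem eq_orbit (h : IsFlow f φ) {γ : ℝ → E} (hγ : ∀ t, HasDerivAt γ (f (γ t)) t) (t : ℝ) :
    γ t = φ t (γ 0) := by
  obtain ⟨M, hM⟩ := h.lipschitz
  have := ODE_solution_unique_univ (v := fun _ => f) (s := fun _ => univ) (t₀ := 0)
    (fun _ => hM.lipschitzOnWith) (fun t => ⟨hγ t, trivial⟩)
    (fun t => ⟨h.hasDerivAt (γ 0) t, trivial⟩) (h.zero _).symm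
  exact congrFun this t

theorem add (h : IsFlow f φ) (s t : ℝ) (x : E) : φ (s + t) x = φ s (φ t x) := by
  have := h.eq_orbit (γ := fun s => φ (s + t) x)
    (fun s => (h.hasDerivAt x (s + t)).comp_add_const s t) s
  simpa using this

theorem eq_of_isIntegralCurveOn [ProperSpace E] (h : IsFlow f φ) {γ : ℝ → E} {a b : ℝ}
    (hγ : IsIntegralCurveOn γ (fun _ => f) (Icc a b)) {t : ℝ} (ht : t ∈ Icc a b) :
    γ t = φ (t - a) (γ a) := by
  have h1 : IsIntegralCurveOn (fun t => φ (t - a) (γ a)) (fun _ => f) (Icc a b) := fun t _ =>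
    ((h.hasDerivAt (γ a) (t - a)).comp_sub_const t a).hasDerivWithinAt
  exact integralCurveOn_eqOn h.field_contDiff_one hγ h1 (by simp [h.zero]) ht

/-- The variational equation along an orbit. -/
theorem hasDerivAt_fderiv (h : IsFlow f φ) (x v : E) (t : ℝ) :
    HasDerivAt (fun t => fderiv ℝ (φ t) x v) (fderiv ℝ f (φ t x) (fderiv ℝ (φ t) x v)) t := by
  set Φ := Function.uncurry φ with hΦ
  have hΦd : Differentiable ℝ Φ := h.contDiff.differentiable two_ne_zero
  have hΦ' : ContDiff ℝ 1 (fderiv ℝ Φ) := h.contDiff.fderiv_right (by norm_num)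
  have hx : ∀ t x v, fderiv ℝ Φ (t, x) (0, v) = fderiv ℝ (φ t) x v := by
    intro t x v
    have h1 : HasFDerivAt (φ t) (fderiv ℝ Φ (t, x) ∘L .inr ℝ ℝ E) x :=
      HasFDerivAt.comp x (hΦd (t, x)).hasFDerivAt (hasFDerivAt_prodMk_right t x)
    rw [h1.fderiv]; rfl
  have hl : ∀ (t : ℝ) (x : E), HasDerivAt (fun t : ℝ => (t, x)) ((1 : ℝ), (0 : E)) t := fun t x =>
    (hasDerivAt_id t).prodMk (hasDerivAt_const t x)
  have ht : ∀ p : ℝ × E, fderiv ℝ Φ p (1, 0) = f (Φ p) := by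
    rintro ⟨t, x⟩
    have h1 : HasDerivAt (fun t => Φ (t, x)) (fderiv ℝ Φ (t, x) (1, 0)) t := by
      have h2 : HasFDerivAt Φ (fderiv ℝ Φ (t, x)) (t, x) := (hΦd (t, x)).hasFDerivAt
      exact h2.comp_hasDerivAt t (hl t x)
    exact h1.unique (h.hasDerivAt x t)
  have h2 := (hΦ'.differentiable one_ne_zero (t, x)).hasFDerivAt
  have h3 : HasDerivAt (fun t => fderiv ℝ Φ (t, x) (0, v))
      (fderiv ℝ (fderiv ℝ Φ) (t, x) (1, 0) (0, v)) t :=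
    (ContinuousLinearMap.apply ℝ E ((0 : ℝ), v)).hasFDerivAt.comp_hasDerivAt t
      (HasFDerivAt.comp_hasDerivAt t h2 (hl t x))
  have h4 : HasFDerivAt (fun p => fderiv ℝ Φ p (1, 0))
      ((ContinuousLinearMap.apply ℝ E ((1 : ℝ), (0 : E))) ∘L (fderiv ℝ (fderiv ℝ Φ) (t, x)))
      (t, x) :=
    (ContinuousLinearMap.apply ℝ E ((1 : ℝ), (0 : E))).hasFDerivAt.comp (t, x) h2
  have h5 : HasFDerivAt (fun p => f (Φ p)) (fderiv ℝ f (Φ (t, x)) ∘L fderiv ℝ Φ (t, x)) (t, x) :=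
    ((h.field_contDiff_one.differentiable one_ne_zero) _).hasFDerivAt.comp (t, x)
      (hΦd (t, x)).hasFDerivAt
  have h6 := congrArg (fun L => L ((0 : ℝ), v)) (h4.unique (h5.congr_of_eventuallyEq
    (Filter.Eventually.of_forall ht)))
  -- Symmetry of the second derivative exchanges the time derivative and the derivative in the
  -- initial point.
  have h7 : IsSymmSndFDerivAt ℝ Φ (t, x) :=
    h.contDiff.contDiffAt.isSymmSndFDerivAt (by simp)
  rw [h7 (1, 0) (0, v)] at h3
  simp only [ContinuousLinearMap.comp_apply, ContinuousLinearMap.apply_apply] at h6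
  rw [h6, hx] at h3
  simp only [hx] at h3
  exact h3

/-- The time maps commute: differentiate φ_t(φ_s x) = φ_{t+s} x in s at 0 in two ways. -/
theorem fderiv_apply_field (h : IsFlow f φ) (x : E) (t : ℝ) :
    fderiv ℝ (φ t) x (f x) = f (φ t x) := by
  have h1 : HasDerivAt (fun s => φ t (φ s x)) (fderiv ℝ (φ t) x (f x)) 0 := by
    have h2 := ((h.contDiff_map t).differentiable two_ne_zero (φ 0 x)).hasFDerivAt.comp_hasDerivAt
      0 (h.hasDerivAt x 0)
    rwa [h.zero] at h2
  have h3 : HasDerivAt (fun s => φ t (φ s x)) (f (φ t x)) 0 := by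
    have h4 := (h.hasDerivAt x (t + 0)).comp_const_add t 0
    rw [add_zero] at h4
    simpa only [h.add] using h4
  exact h1.unique h3

theorem fderiv_zero (h : IsFlow f φ) (x : E) : fderiv ℝ (φ 0) x = .id ℝ E := by
  have : φ 0 = id := funext h.zero
  rw [this, fderiv_id]

/-- A Grönwall estimate in which only the reference field g contributes a Lipschitz constant, so
that the bound is uniform over all fields f that are ε-close to g. -/
theorem dist_le (h : IsFlow f φ) {g : E → E} {M : NNReal} (hg : LipschitzWith M g) {ε δ T : ℝ}
    (hε : ∀ x, dist (f x) (g x) ≤ ε) {γ : ℝ → E} (hγ : ∀ t, HasDerivAt γ (g (γ t)) t) {x : E}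
    (hx : dist x (γ 0) ≤ δ) {t : ℝ} (ht : t ∈ Icc 0 T) :
    dist (φ t x) (γ t) ≤ gronwallBound δ M ε T := by
  have hε0 : 0 ≤ ε := dist_nonneg.trans (hε x)
  have := dist_le_of_approx_trajectories_ODE (v := fun _ => g) (a := 0) (b := t) (K := M)
    (f := fun t => φ t x) (g := γ) (f' := fun t => f (φ t x)) (g' := fun t => g (γ t)) (εf := ε)
    (εg := 0) (δ := δ) (fun _ => hg) (h.continuous_orbit x).continuousOn
    (fun s _ => (h.hasDerivAt x s).hasDerivWithinAt) (fun s _ => hε _)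
    (fun s _ => (hγ s).continuousAt.continuousWithinAt) (fun s _ => (hγ s).hasDerivWithinAt)
    (fun s _ => (dist_self _).le) (by rwa [h.zero]) t (right_mem_Icc.2 ht.1)
  refine this.trans ?_
  rw [add_zero, sub_zero]
  exact gronwallBound_mono (dist_nonneg.trans hx) hε0 M.2 ht.2

end General

end IsFlow

/-! ### The area form, the Jacobian of the flow and its exponential bounds. -/

theorem hasDerivAt_clm_comp (L : Plane →L[ℝ] ℝ) {γ : ℝ → Plane} {v : Plane} {t : ℝ}
    (h : HasDerivAt γ v t) : HasDerivAt (fun t => L (γ t)) (L v) t :=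
  L.hasFDerivAt.comp_hasDerivAt t h

/-- The standard area form of the plane. -/
def areaForm (v w : Plane) : ℝ := v.1 * w.2 - v.2 * w.1

/-- The divergence of a plane vector field. -/
noncomputable def planeDiv (F : Plane → Plane) (q : Plane) : ℝ :=
  (fderiv ℝ F q (1, 0)).1 + (fderiv ℝ F q (0, 1)).2

theorem plane_clm_apply (L : Plane →L[ℝ] Plane) (v : Plane) :
    L v = (v.1 * (L (1, 0)).1 + v.2 * (L (0, 1)).1, v.1 * (L (1, 0)).2 + v.2 * (L (0, 1)).2) := by
  have h : v = v.1 • ((1, 0) : Plane) + v.2 • ((0, 1) : Plane) := by ext <;> simp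
  conv_lhs => rw [h, map_add, map_smul, map_smul]
  ext <;> simp

theorem areaForm_add_areaForm (L : Plane →L[ℝ] Plane) (v w : Plane) :
    areaForm (L v) w + areaForm v (L w) = ((L (1, 0)).1 + (L (0, 1)).2) * areaForm v w := by
  rw [plane_clm_apply L v, plane_clm_apply L w]
  simp only [areaForm]
  ring

theorem areaForm_map (L : Plane →L[ℝ] Plane) (v w : Plane) :
    areaForm (L v) (L w) = areaForm (L (1, 0)) (L (0, 1)) * areaForm v w := by
  rw [plane_clm_apply L v, plane_clm_apply L w]
  simp only [areaForm]
  ring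

namespace IsFlow

variable {f : Plane → Plane} {φ : ℝ → Plane → Plane}

/-- The Jacobian determinant of the time-`t` map of a flow. -/
noncomputable def _root_.flowJacobian (φ : ℝ → Plane → Plane) (q : Plane) (t : ℝ) : ℝ :=
  areaForm (fderiv ℝ (φ t) q (1, 0)) (fderiv ℝ (φ t) q (0, 1))

theorem flowJacobian_zero (h : IsFlow f φ) (q : Plane) : flowJacobian φ q 0 = 1 := by
  simp [flowJacobian, h.fderiv_zero, areaForm]

/-- Liouville's formula, from the variational equation on the two basis vectors. -/
theorem hasDerivAt_flowJacobian (h : IsFlow f φ) (q : Plane) (t : ℝ) :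
    HasDerivAt (flowJacobian φ q) (planeDiv f (φ t q) * flowJacobian φ q t) t := by
  have h1 := h.hasDerivAt_fderiv q (1, 0) t
  have h2 := h.hasDerivAt_fderiv q (0, 1) t
  have h3 := ((hasDerivAt_clm_comp (.fst ℝ ℝ ℝ) h1).mul (hasDerivAt_clm_comp (.snd ℝ ℝ ℝ) h2)).sub
    ((hasDerivAt_clm_comp (.snd ℝ ℝ ℝ) h1).mul (hasDerivAt_clm_comp (.fst ℝ ℝ ℝ) h2))
  refine h3.congr_deriv ?_
  rw [planeDiv, flowJacobian, ← areaForm_add_areaForm]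
  simp only [areaForm, ContinuousLinearMap.coe_fst', ContinuousLinearMap.coe_snd']
  ring

/-- The flow carries the field to itself, so only the Jacobian appears; the time derivative of a
hitting time drops out of this area, which is why derivatives of return maps can be read from it. -/
theorem areaForm_fderiv (h : IsFlow f φ) (q v : Plane) (t : ℝ) :
    areaForm (fderiv ℝ (φ t) q v) (f (φ t q)) = flowJacobian φ q t * areaForm v (f q) := by
  rw [← h.fderiv_apply_field, areaForm_map]; rfl

end IsFlow

/-- A solution of `J' = d J` with `|d| ≤ Ψ'` and `J > 0` initially changes by a factor at most
`exp (Ψ b - Ψ a)`. -/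
theorem linear_ode_bounds {J d Ψ Ψ' : ℝ → ℝ} {a b : ℝ} (hab : a ≤ b)
    (hJ : ∀ t ∈ Icc a b, HasDerivAt J (d t * J t) t)
    (hΨ : ∀ t ∈ Icc a b, HasDerivAt Ψ (Ψ' t) t) (hd : ∀ t ∈ Icc a b, |d t| ≤ Ψ' t)
    (ha : 0 < J a) :
    J a * Real.exp (-(Ψ b - Ψ a)) ≤ J b ∧ J b ≤ J a * Real.exp (Ψ b - Ψ a) := by
  have hJc : ContinuousOn J (Icc a b) := fun t ht => (hJ t ht).continuousAt.continuousWithinAt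
  have hΨc : ContinuousOn Ψ (Icc a b) := fun t ht => (hΨ t ht).continuousAt.continuousWithinAt
  -- The sign of J is not yet known, so the square is used first: J² exp(2Ψ) is nondecreasing, hence
  -- J does not vanish and keeps its initial sign.
  have hsq : ∀ t ∈ Icc a b, 0 < J t := by
    have hmono : MonotoneOn (fun t => J t ^ 2 * Real.exp (2 * Ψ t)) (Icc a b) := by
      refine monotoneOn_of_hasDerivWithinAt_nonneg (convex_Icc a b)
        (f' := fun t => 2 * (d t + Ψ' t) * J t ^ 2 * Real.exp (2 * Ψ t))
        ((hJc.pow 2).mul (Real.continuous_exp.comp_continuousOn (continuousOn_const.mul hΨc)))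
        (fun t ht => ?_) (fun t ht => ?_)
      · have ht' := interior_subset ht
        refine (((hJ t ht').pow 2).mul ((hΨ t ht').const_mul 2).exp).hasDerivWithinAt.congr_deriv ?_
        simp; ring
      · have := (abs_le.1 (hd t (interior_subset ht))).1
        have : 0 ≤ d t + Ψ' t := by linarith
        positivity
    have hne : ∀ t ∈ Icc a b, J t ≠ 0 := by
      intro t ht h0
      have h1 := hmono (left_mem_Icc.2 hab) ht ht.1
      simp only [h0] at h1
      have : 0 < J a ^ 2 * Real.exp (2 * Ψ a) := by positivity
      norm_num at h1
      linarith
    intro t ht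
    by_contra hneg
    have hcont : ContinuousOn J (Icc a t) := hJc.mono (Icc_subset_Icc_right ht.2)
    obtain ⟨s, hs, hs0⟩ := intermediate_value_Icc' ht.1 hcont ⟨not_lt.1 hneg, ha.le⟩
    exact hne s (Icc_subset_Icc_right ht.2 hs) hs0
  have h1 : MonotoneOn (fun t => J t * Real.exp (Ψ t)) (Icc a b) := by
    refine monotoneOn_of_hasDerivWithinAt_nonneg (convex_Icc a b)
      (f' := fun t => (d t + Ψ' t) * J t * Real.exp (Ψ t))
      (hJc.mul (Real.continuous_exp.comp_continuousOn hΨc)) (fun t ht => ?_) (fun t ht => ?_)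
    · have ht' := interior_subset ht
      refine ((hJ t ht').mul (hΨ t ht').exp).hasDerivWithinAt.congr_deriv ?_
      ring
    · have := (abs_le.1 (hd t (interior_subset ht))).1
      have h2 : 0 ≤ d t + Ψ' t := by linarith
      have h3 := hsq t (interior_subset ht)
      positivity
  have h2 : AntitoneOn (fun t => J t * Real.exp (-Ψ t)) (Icc a b) := by
    refine antitoneOn_of_hasDerivWithinAt_nonpos (convex_Icc a b)
      (f' := fun t => -((Ψ' t - d t) * J t * Real.exp (-Ψ t)))
      (hJc.mul (Real.continuous_exp.comp_continuousOn hΨc.neg)) (fun t ht => ?_) (fun t ht => ?_)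
    · have ht' := interior_subset ht
      refine ((hJ t ht').mul (hΨ t ht').neg.exp).hasDerivWithinAt.congr_deriv ?_
      simp only [Pi.neg_apply]
      ring
    · have := (abs_le.1 (hd t (interior_subset ht))).2
      have h2 : 0 ≤ Ψ' t - d t := by linarith
      have h3 := hsq t (interior_subset ht)
      have : 0 ≤ (Ψ' t - d t) * J t * Real.exp (-Ψ t) := by positivity
      linarith
  have e1 := h1 (left_mem_Icc.2 hab) (right_mem_Icc.2 hab) hab
  have e2 := h2 (left_mem_Icc.2 hab) (right_mem_Icc.2 hab) hab
  simp only at e1 e2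
  constructor
  · have : J b = J b * Real.exp (Ψ b) * Real.exp (-Ψ b) := by
      rw [mul_assoc, ← Real.exp_add]; simp
    rw [this, neg_sub, sub_eq_add_neg, Real.exp_add, ← mul_assoc]
    gcongr
  · have : J b = J b * Real.exp (-Ψ b) * Real.exp (Ψ b) := by
      rw [mul_assoc, ← Real.exp_add]; simp
    rw [this, sub_eq_neg_add, Real.exp_add, ← mul_assoc]
    gcongr

/-! ### Hitting times of Σ and the persistence of transversal arcs. -/

theorem exists_gronwallBound_lt (M L : ℝ) {η : ℝ} (hη : 0 < η) :
    ∃ s > 0, s ≤ η ∧ gronwallBound s M s L < η := by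
  have hc : Continuous fun s : ℝ => gronwallBound s M s L := by
    unfold gronwallBound
    split_ifs <;> fun_prop
  have h0 : gronwallBound 0 M 0 L = 0 := gronwallBound_ε0_δ0 _ _
  have hev : ∀ᶠ s in 𝓝[>] (0 : ℝ), gronwallBound s M s L < η :=
    ((hc.tendsto' 0 0 h0).eventually (gt_mem_nhds hη)).filter_mono nhdsWithin_le_nhds
  obtain ⟨s, h1, h2, h3⟩ := (hev.and ((eventually_mem_nhdsWithin).and
    ((gt_mem_nhds hη).filter_mono nhdsWithin_le_nhds))).exists
  exact ⟨s, h2, h3.le, h1⟩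

theorem isInvertible_real {L : ℝ →L[ℝ] ℝ} (h : L 1 ≠ 0) : L.IsInvertible :=
  ⟨ContinuousLinearEquiv.unitsEquivAut ℝ (Units.mk0 (L 1) h), by ext; simp⟩

namespace IsFlow

variable {F : Plane → Plane} {φ : ℝ → Plane → Plane}

/-- Transversality lets the implicit function theorem solve for a zero of the height near τ q.
Uniqueness of the zero in the window identifies that solution with τ, whose continuity need not be
assumed. -/
theorem contDiffAt_hittingTime (h : IsFlow F φ) {τ : Plane → ℝ} {q : Plane} {a b : ℝ}
    (hτ : τ q ∈ Ioo a b) (h0 : (φ (τ q) q).2 = 0) (hF : (F (φ (τ q) q)).2 ≠ 0)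
    (hu : ∀ᶠ q' in 𝓝 q, ∀ t ∈ Ioo a b, (φ t q').2 = 0 → t = τ q') : ContDiffAt ℝ 2 τ q := by
  set f : Plane × ℝ → ℝ := fun p => (φ p.2 p.1).2 with hf
  have hfc : ContDiff ℝ 2 f :=
    contDiff_snd.comp (h.contDiff.comp (contDiff_snd.prodMk contDiff_fst))
  have hder : (fderiv ℝ f (q, τ q) ∘L .inr ℝ Plane ℝ) 1 = (F (φ (τ q) q)).2 := by
    have h1 : HasFDerivAt (fun t => f (q, t)) (fderiv ℝ f (q, τ q) ∘L .inr ℝ Plane ℝ) (τ q) :=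
      HasFDerivAt.comp (τ q) (hfc.differentiable two_ne_zero (q, τ q)).hasFDerivAt
        (hasFDerivAt_prodMk_right q (τ q))
    exact h1.hasDerivAt.unique (hasDerivAt_clm_comp (.snd ℝ ℝ ℝ) (h.hasDerivAt q (τ q)))
  have hinv : (fderiv ℝ f (q, τ q) ∘L .inr ℝ Plane ℝ).IsInvertible :=
    isInvertible_real (by rw [hder]; exact hF)
  have hfa : ContDiffAt ℝ 2 f (q, τ q) := hfc.contDiffAt
  have hc := hfa.contDiffAt_implicitFunction two_ne_zero hinv
  refine hc.congr_of_eventuallyEq ?_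
  have hm : ∀ᶠ q' in 𝓝 q, hfa.implicitFunction two_ne_zero hinv q' ∈ Ioo a b := by
    refine hc.continuousAt.eventually (Ioo_mem_nhds ?_ ?_) <;>
    · rw [show hfa.implicitFunction two_ne_zero hinv q = τ q from
        hfa.implicitFunction_apply_self two_ne_zero hinv]
      first | exact hτ.1 | exact hτ.2
  filter_upwards [hu, hm, hfa.eventually_apply_implicitFunction two_ne_zero hinv] with q' h1 h2 h3
  exact (h1 _ h2 (h3.trans h0)).symm

/-- The derivative of a hitting map of the section `{y = 0}`, through the Jacobian of the flow. -/
theorem hasFDerivAt_hittingMap (h : IsFlow F φ) {τ : Plane → ℝ} {q : Plane}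
    (hτ : ContDiffAt ℝ 2 τ q) (h0 : ∀ᶠ q' in 𝓝 q, (φ (τ q') q').2 = 0) :
    ContDiffAt ℝ 2 (fun q => (φ (τ q) q).1) q ∧ ∀ v,
      fderiv ℝ (fun q => (φ (τ q) q).1) q v * (F (φ (τ q) q)).2 =
        flowJacobian φ q (τ q) * areaForm v (F q) := by
  have hc : ContDiffAt ℝ 2 (fun q => φ (τ q) q) q :=
    h.contDiff.contDiffAt.comp q (hτ.prodMk contDiffAt_id)
  refine ⟨contDiffAt_fst.comp q hc, fun v => ?_⟩
  have hΦ : HasFDerivAt (Function.uncurry φ) (fderiv ℝ (Function.uncurry φ) (τ q, q)) (τ q, q) :=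
    (h.contDiff.differentiable two_ne_zero _).hasFDerivAt
  have h1 : fderiv ℝ (Function.uncurry φ) (τ q, q) (1, 0) = F (φ (τ q) q) := by
    have hl : HasDerivAt (fun t : ℝ => (t, q)) ((1 : ℝ), (0 : Plane)) (τ q) :=
      (hasDerivAt_id _).prodMk (hasDerivAt_const _ q)
    have h4 := hΦ.comp_hasDerivAt (τ q) hl
    exact h4.unique (h.hasDerivAt q (τ q))
  have h2 : fderiv ℝ (Function.uncurry φ) (τ q, q) (0, v) = fderiv ℝ (φ (τ q)) q v := by
    have h3 : HasFDerivAt (φ (τ q))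
        (fderiv ℝ (Function.uncurry φ) (τ q, q) ∘L .inr ℝ ℝ Plane) q :=
      HasFDerivAt.comp q hΦ (hasFDerivAt_prodMk_right (τ q) q)
    rw [h3.fderiv]; rfl
  have hd : HasFDerivAt (fun q => φ (τ q) q)
      (fderiv ℝ (Function.uncurry φ) (τ q, q) ∘L ((fderiv ℝ τ q).prod (.id ℝ Plane))) q := by
    have hp : HasFDerivAt (fun q => (τ q, q)) ((fderiv ℝ τ q).prod (.id ℝ Plane)) q :=
      (hτ.differentiableAt two_ne_zero).hasFDerivAt.prodMk (hasFDerivAt_id q)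
    exact HasFDerivAt.comp q (f := fun q => (τ q, q)) hΦ hp
  have hv : (fderiv ℝ (Function.uncurry φ) (τ q, q) ∘L ((fderiv ℝ τ q).prod (.id ℝ Plane))) v
      = fderiv ℝ τ q v • F (φ (τ q) q) + fderiv ℝ (φ (τ q)) q v := by
    rw [← h1, ← h2, ← map_smul, ← map_add]
    simp
  have hfst : fderiv ℝ (fun q => (φ (τ q) q).1) q v =
      fderiv ℝ τ q v * (F (φ (τ q) q)).1 + (fderiv ℝ (φ (τ q)) q v).1 := by
    have h4 : HasFDerivAt (fun q => (φ (τ q) q).1) (ContinuousLinearMap.fst ℝ ℝ ℝ ∘L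
        (fderiv ℝ (Function.uncurry φ) (τ q, q) ∘L ((fderiv ℝ τ q).prod (.id ℝ Plane)))) q :=
      (ContinuousLinearMap.fst ℝ ℝ ℝ).hasFDerivAt.comp q hd
    rw [h4.fderiv, ContinuousLinearMap.comp_apply, hv]
    simp
  -- The height of the hit point vanishes identically, which determines the derivative of τ; the
  -- area form then eliminates it.
  have hsnd : (0 : ℝ) = fderiv ℝ τ q v * (F (φ (τ q) q)).2 + (fderiv ℝ (φ (τ q)) q v).2 := by
    have h4 : HasFDerivAt (fun q => (φ (τ q) q).2) (ContinuousLinearMap.snd ℝ ℝ ℝ ∘L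
        (fderiv ℝ (Function.uncurry φ) (τ q, q) ∘L ((fderiv ℝ τ q).prod (.id ℝ Plane)))) q :=
      (ContinuousLinearMap.snd ℝ ℝ ℝ).hasFDerivAt.comp q hd
    have h5 : HasFDerivAt (fun q => (φ (τ q) q).2) (0 : Plane →L[ℝ] ℝ) q :=
      (hasFDerivAt_const (0 : ℝ) q).congr_of_eventuallyEq h0
    have h6 : ContinuousLinearMap.snd ℝ ℝ ℝ ((fderiv ℝ (Function.uncurry φ) (τ q, q) ∘L
        ((fderiv ℝ τ q).prod (.id ℝ Plane))) v) = 0 := DFunLike.congr_fun (h4.unique h5) v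
    rw [hv] at h6
    simpa using h6.symm
  rw [← h.areaForm_fderiv, hfst]
  simp only [areaForm]
  linear_combination -(F (φ (τ q) q)).1 * hsnd

end IsFlow

/-- Integral curves that leave a point of the closed side `σ y ≥ 0` (from inside, or transversally)
and arrive transversally at `{y = 0}` persist under small perturbations of the field and of the
initial point, with a `C²` arrival time. -/
theorem exists_transit {F₀ : Plane → Plane} {M : NNReal} (hM : LipschitzWith M F₀) {γ : ℝ → Plane}
    (hγ : ∀ t, HasDerivAt γ (F₀ (γ t)) t) {T σ : ℝ} (hT : 0 < T) (hσ : |σ| = 1)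
    (hD : ∀ t ∈ Ioo 0 T, 0 < σ * (γ t).2) (hend : (γ T).2 = 0) (hcross : σ * (F₀ (γ T)).2 < 0)
    (hstart : 0 < σ * (γ 0).2 ∨ 0 < σ * (F₀ (γ 0)).2) {r : ℝ} (hr : 0 < r) :
    ∃ ε > 0, ∃ ρ > 0, ∀ F φ, IsFlow F φ → (∀ x, dist (F x) (F₀ x) ≤ ε) →
      ∃ τ : Plane → ℝ, ∀ q ∈ Metric.ball (γ 0) ρ,
        (0 < τ q ∧ τ q ≤ T + 1 ∧ τ q ≤ T + r) ∧ (φ (τ q) q).2 = 0 ∧ dist (φ (τ q) q) (γ T) < r ∧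
        σ * (F (φ (τ q) q)).2 < σ * (F₀ (γ T)).2 / 2 ∧
        (∀ t ∈ Icc 0 (τ q), dist (φ t q) (γ t) < r) ∧
        (0 ≤ σ * q.2 → ∀ t ∈ Ioo 0 (τ q), 0 < σ * (φ t q).2) ∧ ContDiffAt ℝ 2 τ q := by
  have hγc : Continuous γ := continuous_iff_continuousAt.2 fun t => (hγ t).continuousAt
  have hF₀c : Continuous F₀ := hM.continuous
  set g : ℝ → ℝ := fun t => σ * (F₀ (γ t)).2 with hg
  have hgc : Continuous g := by fun_prop
  have hyc : Continuous fun t => σ * (γ t).2 := by fun_prop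
  set m := -g T with hm
  have hm0 : 0 < m := by simpa [hm, hg] using hcross
  -- On the window of half width t₁ around T the inward normal speed keeps at least 3/4 of its value
  -- m at T, so nearby orbits cross Σ exactly once there.
  obtain ⟨t₁, ht₁, ht₁'⟩ : ∃ t₁ > 0, ∀ t, |t - T| ≤ t₁ → g t < -(3 / 4 * m) ∧
      dist (γ t) (γ T) < r / 2 := by
    have h1 : ∀ᶠ t in 𝓝 T, g t < -(3 / 4 * m) ∧ dist (γ t) (γ T) < r / 2 :=
      (hgc.continuousAt.eventually (gt_mem_nhds (by rw [hm]; linarith))).and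
        (hγc.continuousAt.eventually (Metric.ball_mem_nhds _ (half_pos hr)))
    obtain ⟨δ, hδ, h2⟩ := Metric.eventually_nhds_iff.1 h1
    exact ⟨δ / 2, half_pos hδ, fun t ht => h2 (by rw [Real.dist_eq]; linarith)⟩
  wlog hsmall : t₁ ≤ 1 ∧ t₁ < T / 2 ∧ t₁ ≤ r generalizing t₁
  · refine this (min t₁ (min 1 (min (T / 4) r))) (by positivity)
      (fun t ht => ht₁' t (ht.trans (min_le_left _ _))) ⟨?_, ?_, ?_⟩
    · exact (min_le_right _ _).trans (min_le_left _ _)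
    · exact ((min_le_right _ _).trans ((min_le_right _ _).trans (min_le_left _ _))).trans_lt
        (by linarith)
    · exact (min_le_right _ _).trans ((min_le_right _ _).trans (min_le_right _ _))
  obtain ⟨ht₁1, ht₁T, ht₁r⟩ := hsmall
  obtain ⟨t₂, ht₂, ht₂T, m₂, hm₂, hs⟩ : ∃ t₂ > 0, t₂ ≤ T - t₁ ∧ ∃ m₂ > 0,
      (∀ t ∈ Icc 0 t₂, m₂ < σ * (γ t).2) ∨ ∀ t ∈ Icc 0 t₂, m₂ < g t := by
    have aux : ∀ k : ℝ → ℝ, Continuous k → 0 < k 0 → ∃ t₂ > 0, t₂ ≤ T - t₁ ∧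
        ∀ t ∈ Icc 0 t₂, k 0 / 2 < k t := by
      intro k hk hk0
      obtain ⟨δ, hδ, h2⟩ := Metric.eventually_nhds_iff.1
        (hk.continuousAt.eventually (lt_mem_nhds (half_lt_self hk0)))
      refine ⟨min (δ / 2) (T - t₁), lt_min (half_pos hδ) (by linarith), min_le_right _ _,
        fun t ht => h2 ?_⟩
      rw [Real.dist_eq, sub_zero, abs_of_nonneg ht.1]
      have := ht.2.trans (min_le_left _ _)
      linarith
    rcases hstart with h | h
    · obtain ⟨t₂, h1, h2, h3⟩ := aux _ hyc h
      exact ⟨t₂, h1, h2, _, half_pos h, Or.inl h3⟩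
    · obtain ⟨t₂, h1, h2, h3⟩ := aux _ hgc h
      exact ⟨t₂, h1, h2, _, half_pos h, Or.inr h3⟩
  obtain ⟨m₃, hm₃, hmid⟩ : ∃ m₃ > 0, ∀ t ∈ Icc t₂ (T - t₁), m₃ ≤ σ * (γ t).2 := by
    obtain ⟨s, hs, hs'⟩ := isCompact_Icc.exists_isMinOn (nonempty_Icc.2 ht₂T) hyc.continuousOn
    exact ⟨_, hD s ⟨ht₂.trans_le hs.1, by linarith [hs.2]⟩, fun t ht => hs' ht⟩
  have hder : ∀ {f : ℝ → Plane} {v : Plane} {t : ℝ}, HasDerivAt f v t →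
      HasDerivAt (fun t => σ * (f t).2) (σ * v.2) t := fun h =>
    (hasDerivAt_clm_comp (.snd ℝ ℝ ℝ) h).const_mul σ
  have hlate : σ * (γ (T + t₁)).2 ≤ -(3 / 4 * m) * t₁ := by
    have := (convex_Icc T (T + t₁)).image_sub_le_mul_sub_of_deriv_le (f := fun t => σ * (γ t).2)
      hyc.continuousOn (fun t _ => (hder (hγ t)).differentiableAt.differentiableWithinAt)
      (C := -(3 / 4 * m)) (fun t ht => by
        rw [interior_Icc] at ht
        rw [(hder (hγ t)).deriv]
        exact (ht₁' t (by rw [abs_of_pos] <;> linarith [ht.1, ht.2])).1.le)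
      T (left_mem_Icc.2 (by linarith)) (T + t₁) (right_mem_Icc.2 (by linarith)) (by linarith)
    simp only [hend] at this
    linarith
  -- η is the allowed distance between the orbits. The velocities then differ by at most (M + 1) η,
  -- namely M η from the Lipschitz bound and η from the distance of the fields; m/4 leaves a
  -- crossing speed above m/2.
  obtain ⟨η, hη, hη1⟩ : ∃ η > 0, η ≤ r / 2 ∧ η ≤ m₂ / 2 ∧ η < m₃ ∧ η < 3 / 4 * m * t₁ ∧
      (M + 1) * η ≤ m / 4 ∧ (M + 1) * η ≤ m₂ := by
    refine ⟨min (r / 2) (min (m₂ / 2) (min (m₃ / 2) (min (3 / 8 * m * t₁)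
      (min (m / 4 / (M + 1)) (m₂ / (M + 1)))))), by positivity, min_le_left _ _,
      (min_le_right _ _).trans (min_le_left _ _),
      (((min_le_right _ _).trans (min_le_right _ _)).trans (min_le_left _ _)).trans_lt
        (half_lt_self hm₃), ?_, ?_, ?_⟩
    · refine ((((min_le_right _ _).trans (min_le_right _ _)).trans (min_le_right _ _)).trans
        (min_le_left _ _)).trans_lt ?_
      have : 0 < m * t₁ := by positivity
      linarith
    · rw [← le_div_iff₀' (by positivity)]
      exact ((((min_le_right _ _).trans (min_le_right _ _)).trans (min_le_right _ _)).trans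
        (min_le_right _ _)).trans (min_le_left _ _)
    · rw [← le_div_iff₀' (by positivity)]
      exact ((((min_le_right _ _).trans (min_le_right _ _)).trans (min_le_right _ _)).trans
        (min_le_right _ _)).trans (min_le_right _ _)
  obtain ⟨hηr, hηm₂, hηm₃, hηl, hηM, hηM₂⟩ := hη1
  obtain ⟨s, hs0, hsη, hsb⟩ := exists_gronwallBound_lt M (T + 1) hη
  refine ⟨s, hs0, s, hs0, fun F φ h hF => ?_⟩
  have hclose : ∀ q ∈ Metric.ball (γ 0) s, ∀ t ∈ Icc 0 (T + 1), dist (φ t q) (γ t) < η :=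
    fun q hq t ht => (h.dist_le hM hF hγ (Metric.mem_ball.1 hq).le ht).trans_lt hsb
  have habs : ∀ x y : Plane, |σ * x.2 - σ * y.2| ≤ dist x y := by
    intro x y
    rw [← mul_sub, abs_mul, hσ, one_mul, ← Real.dist_eq]
    exact le_max_right _ _
  have hclosey : ∀ q ∈ Metric.ball (γ 0) s, ∀ t ∈ Icc 0 (T + 1),
      |σ * (φ t q).2 - σ * (γ t).2| < η := fun q hq t ht =>
    (habs _ _).trans_lt (hclose q hq t ht)
  have hclosev : ∀ q ∈ Metric.ball (γ 0) s, ∀ t ∈ Icc 0 (T + 1),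
      |σ * (F (φ t q)).2 - g t| ≤ (M + 1) * η := by
    intro q hq t ht
    refine (habs _ _).trans ((dist_triangle _ (F₀ (φ t q)) _).trans ?_)
    have h1 := hM.dist_le_mul (φ t q) (γ t)
    have h2 := mul_le_mul_of_nonneg_left (hclose q hq t ht).le M.2
    have h3 := hF (φ t q)
    have h4 : (M : ℝ) * η + η = (M + 1) * η := by ring
    have h5 : ((M : NNReal) : ℝ) * dist (φ t q) (γ t) ≤ M * η := h2
    linarith
  have hyd : ∀ q t, HasDerivAt (fun t => σ * (φ t q).2) (σ * (F (φ t q)).2) t := fun q t =>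
    hder (h.hasDerivAt q t)
  have hyqc : ∀ q, Continuous fun t => σ * (φ t q).2 := fun q => by
    have := h.continuous_orbit q; fun_prop
  have hvel : ∀ q ∈ Metric.ball (γ 0) s, ∀ t ∈ Icc (T - t₁) (T + t₁),
      σ * (F (φ t q)).2 < -(m / 2) := by
    intro q hq t ht
    have h1 := (abs_le.1 (hclosev q hq t ⟨by linarith [ht.1], by linarith [ht.2]⟩)).2
    have h2 := (ht₁' t (abs_le.2 ⟨by linarith [ht.1], by linarith [ht.2]⟩)).1
    linarith
  have hanti : ∀ q ∈ Metric.ball (γ 0) s,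
      StrictAntiOn (fun t => σ * (φ t q).2) (Icc (T - t₁) (T + t₁)) := fun q hq =>
    strictAntiOn_of_deriv_neg (convex_Icc _ _) (hyqc q).continuousOn fun t ht => by
      rw [(hyd q t).deriv]
      have := hvel q hq t (interior_subset ht)
      linarith
  have hpos : ∀ q ∈ Metric.ball (γ 0) s, ∀ t ∈ Icc t₂ (T - t₁), 0 < σ * (φ t q).2 := by
    intro q hq t ht
    have h1 := (abs_lt.1 (hclosey q hq t ⟨ht₂.le.trans ht.1, by linarith [ht.2]⟩)).1
    linarith [hmid t ht]
  have hex : ∀ q ∈ Metric.ball (γ 0) s, ∃ τ ∈ Ioo (T - t₁) (T + t₁), σ * (φ τ q).2 = 0 := by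
    intro q hq
    have h1 := hpos q hq (T - t₁) ⟨ht₂T, le_rfl⟩
    have h2 : σ * (φ (T + t₁) q).2 < 0 := by
      have := (abs_lt.1 (hclosey q hq (T + t₁) ⟨by linarith, by linarith⟩)).2
      linarith
    exact intermediate_value_Ioo' (by linarith) (hyqc q).continuousOn ⟨h2, h1⟩
  have hσ0 : σ ≠ 0 := by rintro rfl; simp at hσ
  choose! τ hτ hτ0 using hex
  refine ⟨τ, fun q hq => ?_⟩
  have hτq := hτ q hq
  have hτI : τ q ∈ Icc (T - t₁) (T + t₁) := Ioo_subset_Icc_self hτq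
  have hτ1 : τ q ≤ T + 1 := by linarith [hτq.2]
  have hτp : 0 < τ q := by linarith [hτq.1]
  have hz : (φ (τ q) q).2 = 0 := (mul_eq_zero.1 (hτ0 q hq)).resolve_left hσ0
  have hd : ∀ t ∈ Icc 0 (τ q), dist (φ t q) (γ t) < r / 2 := fun t ht =>
    (hclose q hq t ⟨ht.1, ht.2.trans hτ1⟩).trans_le hηr
  refine ⟨⟨hτp, hτ1, by linarith [hτq.2]⟩, hz, ?_, ?_, fun t ht =>
    (hd t ht).trans (by linarith), ?_, ?_⟩
  · have h1 := hd (τ q) ⟨hτp.le, le_rfl⟩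
    have h2 := (ht₁' (τ q) (abs_le.2 ⟨by linarith [hτq.1], by linarith [hτq.2]⟩)).2
    linarith [dist_triangle (φ (τ q) q) (γ (τ q)) (γ T)]
  · have h1 := hvel q hq (τ q) hτI
    have h2 : σ * (F₀ (γ T)).2 = -m := by rw [hm, neg_neg]
    rw [h2]; linarith
  · intro hq0 t ht
    rcases le_or_gt t₂ t with h2 | h2
    · rcases le_or_gt t (T - t₁) with h3 | h3
      · exact hpos q hq t ⟨h2, h3⟩
      · have := hanti q hq ⟨h3.le, by linarith [ht.2, hτq.2]⟩ hτI ht.2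
        simp only [hτ0 q hq] at this
        exact this
    · rcases hs with hs | hs
      · have h3 := (abs_lt.1 (hclosey q hq t ⟨ht.1.le, by linarith⟩)).1
        have h4 := hs t ⟨ht.1.le, h2.le⟩
        linarith
      · have hmono : StrictMonoOn (fun t => σ * (φ t q).2) (Icc 0 t₂) :=
          strictMonoOn_of_deriv_pos (convex_Icc _ _) (hyqc q).continuousOn fun t ht => by
            rw [(hyd q t).deriv]
            have ht' := interior_subset ht
            have h3 := (abs_le.1 (hclosev q hq t ⟨ht'.1, by linarith [ht'.2]⟩)).1
            have h4 := hs t ht'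
            linarith
        have := hmono (left_mem_Icc.2 ht₂.le) ⟨ht.1.le, h2.le⟩ ht.1
        simp only [h.zero] at this
        linarith
  · refine h.contDiffAt_hittingTime hτq hz ?_ ?_
    · intro h0
      have := hvel q hq (τ q) hτI
      rw [h0] at this
      linarith
    · filter_upwards [Metric.isOpen_ball.mem_nhds hq] with q' hq' t ht h0
      exact (hanti q' hq').injOn (Ioo_subset_Icc_self ht) (Ioo_subset_Icc_self (hτ q' hq'))
        (by simp only [h0, hτ0 q' hq', mul_zero])

/-! ### First hitting times, and scalar pairs that are close to a linear saddle. -/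

theorem exists_first_hit {f : ℝ → ℝ} (hf : Continuous f) {r : ℝ} (h0 : f 0 < r)
    (h1 : ∃ t, 0 ≤ t ∧ r ≤ f t) : ∃ T > 0, f T = r ∧ ∀ t ∈ Icc 0 T, f t ≤ r := by
  obtain ⟨t₁, ht₁, hft₁⟩ := h1
  set A : Set ℝ := {t | 0 ≤ t ∧ r ≤ f t} with hA
  have hAc : IsClosed A := isClosed_Ici.inter (isClosed_le continuous_const hf)
  have hAb : BddBelow A := ⟨0, fun t ht => ht.1⟩
  have hmem : sInf A ∈ A := hAc.csInf_mem ⟨t₁, ht₁, hft₁⟩ hAb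
  have hlt : ∀ t, 0 ≤ t → t < sInf A → f t < r := fun t ht hts =>
    not_le.1 fun h => (csInf_le hAb ⟨ht, h⟩).not_gt hts
  have hpos : 0 < sInf A := by
    refine lt_of_le_of_ne hmem.1 fun h => ?_
    have := hmem.2
    rw [← h] at this
    exact this.not_gt h0
  have heq : f (sInf A) = r := by
    refine le_antisymm ?_ hmem.2
    have : ∀ᶠ t in 𝓝[<] (sInf A), f t ≤ r := by
      filter_upwards [Ioo_mem_nhdsLT hpos] with t ht using (hlt t ht.1.le ht.2).le
    exact le_of_tendsto (hf.continuousAt.continuousWithinAt (s := Iio (sInf A))) this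
  refine ⟨_, hpos, heq, fun t ht => ?_⟩
  rcases ht.2.eq_or_lt with h | h
  · rw [h, heq]
  · exact (hlt t ht.1 h).le

/-- Two functions that solve, up to a small relative error, the linear saddle `f' = -lam f`,
`g' = lam g`. -/
structure IsConePair (lam : ℝ) (f g f' g' : ℝ → ℝ) : Prop where
  pos : 0 < lam
  hasDerivAt_fst : ∀ t, HasDerivAt f (f' t) t
  hasDerivAt_snd : ∀ t, HasDerivAt g (g' t) t
  fst_le : ∀ t, |f' t + lam * f t| ≤ lam / 16 * (|f t| + |g t|)
  snd_le : ∀ t, |g' t - lam * g t| ≤ lam / 16 * (|f t| + |g t|)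

namespace IsConePair

variable {lam : ℝ} {f g f' g' : ℝ → ℝ}

theorem neg (h : IsConePair lam f g f' g') :
    IsConePair lam (fun t => -f t) (fun t => -g t) (fun t => -f' t) (fun t => -g' t) where
  pos := h.pos
  hasDerivAt_fst t := (h.hasDerivAt_fst t).neg
  hasDerivAt_snd t := (h.hasDerivAt_snd t).neg
  fst_le t := by
    have := h.fst_le t
    rwa [abs_neg, abs_neg, show -f' t + lam * -f t = -(f' t + lam * f t) by ring, abs_neg]
  snd_le t := by
    have := h.snd_le t
    rwa [abs_neg, abs_neg, show -g' t - lam * -g t = -(g' t - lam * g t) by ring, abs_neg]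

/-- Reversing time exchanges the contracting and the expanding coordinate, so every forward
statement has a backward version. -/
theorem reverse (h : IsConePair lam f g f' g') :
    IsConePair lam (fun t => g (-t)) (fun t => f (-t)) (fun t => -g' (-t)) (fun t => -f' (-t)) where
  pos := h.pos
  hasDerivAt_fst t := by
    exact ((h.hasDerivAt_snd (-t)).comp t (hasDerivAt_neg t)).congr_deriv (by ring)
  hasDerivAt_snd t := by
    exact ((h.hasDerivAt_fst (-t)).comp t (hasDerivAt_neg t)).congr_deriv (by ring)
  fst_le t := by
    have := h.snd_le (-t)
    rw [add_comm |f (-t)|] at this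
    rwa [show -g' (-t) + lam * g (-t) = -(g' (-t) - lam * g (-t)) by ring, abs_neg]
  snd_le t := by
    have := h.fst_le (-t)
    rw [add_comm |f (-t)|] at this
    rwa [show -f' (-t) - lam * f (-t) = -(f' (-t) + lam * f (-t)) by ring, abs_neg]

theorem continuous_fst (h : IsConePair lam f g f' g') : Continuous f :=
  continuous_iff_continuousAt.2 fun t => (h.hasDerivAt_fst t).continuousAt

theorem continuous_snd (h : IsConePair lam f g f' g') : Continuous g :=
  continuous_iff_continuousAt.2 fun t => (h.hasDerivAt_snd t).continuousAt

theorem hasDerivAt_form (h : IsConePair lam f g f' g') (k t : ℝ) :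
    HasDerivAt (fun t => g t ^ 2 - k * f t ^ 2) (2 * g t * g' t - k * (2 * f t * f' t)) t := by
  have h1 := ((h.hasDerivAt_snd t).pow 2).sub (((h.hasDerivAt_fst t).pow 2).const_mul k)
  refine h1.congr_deriv ?_
  norm_num

/-- For the exact saddle the derivative of g² - k f² is 2 lam (g² + k f²), and the relative error
1/16 cannot consume all of it. With k = 1 the form controls the cones |f| ≤ |g|; k = 1/4 gives the
narrower cones that contain the invariant manifolds. -/
theorem le_deriv_form (h : IsConePair lam f g f' g') {k : ℝ} (hk : 1 / 4 ≤ k) (hk' : k ≤ 4)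
    (t : ℝ) : lam / 4 * (f t ^ 2 + g t ^ 2) ≤ 2 * g t * g' t - k * (2 * f t * f' t) := by
  have hl := h.pos
  have h1 := h.fst_le t
  have h2 := h.snd_le t
  set x := f t
  set y := g t
  set e := f' t + lam * x with he
  set d := g' t - lam * y with hd
  have e1 : f' t = e - lam * x := by rw [he]; ring
  have e2 : g' t = d + lam * y := by rw [hd]; ring
  rw [e1, e2]
  have h3 : |y * d| ≤ |y| * (lam / 16 * (|x| + |y|)) := by
    rw [abs_mul]; exact mul_le_mul_of_nonneg_left h2 (abs_nonneg _)
  have h4 : |x * e| ≤ |x| * (lam / 16 * (|x| + |y|)) := by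
    rw [abs_mul]; exact mul_le_mul_of_nonneg_left h1 (abs_nonneg _)
  have h5 := (abs_le.1 h3).1
  have h6 := (abs_le.1 h4).2
  have h7 : k * (x * e) ≤ k * (|x| * (lam / 16 * (|x| + |y|))) :=
    mul_le_mul_of_nonneg_left h6 (by linarith)
  have hx : x ^ 2 = |x| ^ 2 := (sq_abs x).symm
  have hy : y ^ 2 = |y| ^ 2 := (sq_abs y).symm
  have key : lam / 4 * (|x| ^ 2 + |y| ^ 2) ≤ 2 * lam * (|y| ^ 2 + k * |x| ^ 2)
      - lam / 8 * (|x| + |y|) * (|y| + k * |x|) := by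
    have : 0 ≤ 2 * (|y| ^ 2 + k * |x| ^ 2) - 1 / 8 * (|x| + |y|) * (|y| + k * |x|)
        - 1 / 4 * (|x| ^ 2 + |y| ^ 2) := by
      nlinarith [sq_nonneg (|x| - |y|), mul_nonneg (sub_nonneg.2 hk) (sq_nonneg (|x| - |y|)),
        mul_nonneg (sub_nonneg.2 hk) (sq_nonneg |x|), mul_nonneg (sub_nonneg.2 hk') (sq_nonneg |y|),
        sq_nonneg |x|, sq_nonneg |y|]
    nlinarith [mul_nonneg hl.le this]
  have h8 : 2 * y * (d + lam * y) - k * (2 * x * (e - lam * x)) =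
      2 * lam * (y ^ 2 + k * x ^ 2) + 2 * (y * d) - 2 * (k * (x * e)) := by ring
  rw [h8, hx, hy]
  linarith

theorem monotone_form (h : IsConePair lam f g f' g') {k : ℝ} (hk : 1 / 4 ≤ k) (hk' : k ≤ 4) :
    Monotone fun t => g t ^ 2 - k * f t ^ 2 := by
  refine monotone_of_deriv_nonneg (fun t => (h.hasDerivAt_form k t).differentiableAt) fun t => ?_
  rw [(h.hasDerivAt_form k t).deriv]
  have := h.pos
  exact le_trans (by positivity) (h.le_deriv_form hk hk' t)

/-- The unstable cone is forward invariant, and the expanding coordinate grows there. -/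
theorem cone_le (h : IsConePair lam f g f' g') {s t : ℝ} (hst : s ≤ t) (hs : 0 < g s)
    (hfg : |f s| ≤ g s) : |f t| ≤ g t ∧ g s * Real.exp (lam / 2 * (t - s)) ≤ g t := by
  have hl := h.pos
  have hN : ∀ t, s ≤ t → |f t| ≤ |g t| := fun t ht => by
    have h1 := h.monotone_form (k := 1) (by norm_num) (by norm_num) ht
    have h2 : f s ^ 2 ≤ g s ^ 2 := sq_le_sq' (by linarith [(abs_le.1 hfg).1]) (abs_le.1 hfg).2
    simp only at h1
    exact sq_le_sq.1 (by linarith)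
  have hmono : MonotoneOn (fun t => g t ^ 2 * Real.exp (-(lam * t))) (Ici s) := by
    refine monotoneOn_of_hasDerivWithinAt_nonneg (convex_Ici s)
      (f' := fun t => (2 * g t * g' t - lam * g t ^ 2) * Real.exp (-(lam * t)))
      (by have := h.continuous_snd; fun_prop) (fun t ht => ?_) (fun t ht => ?_)
    · have h1 := ((h.hasDerivAt_snd t).pow 2).mul ((hasDerivAt_id t).const_mul lam).neg.exp
      refine h1.hasDerivWithinAt.congr_deriv ?_
      simp
      ring
    · have h1 := hN t (interior_subset ht)
      have h2 := h.snd_le t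
      have h3 : |g t * (g' t - lam * g t)| ≤ |g t| * (lam / 16 * (|g t| + |g t|)) := by
        rw [abs_mul]
        refine mul_le_mul_of_nonneg_left (h2.trans ?_) (abs_nonneg _)
        gcongr
      have h4 := (abs_le.1 h3).1
      have h5 : |g t| * (lam / 16 * (|g t| + |g t|)) = lam / 8 * g t ^ 2 := by
        rw [← sq_abs (g t)]; ring
      have h6 : 0 ≤ lam * g t ^ 2 := by positivity
      have : 0 ≤ 2 * g t * g' t - lam * g t ^ 2 := by nlinarith
      positivity
  have hsq : ∀ t, s ≤ t → (g s * Real.exp (lam / 2 * (t - s))) ^ 2 ≤ g t ^ 2 := by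
    intro t ht
    have h1 := hmono self_mem_Ici ht ht
    simp only at h1
    have h2 : (g s * Real.exp (lam / 2 * (t - s))) ^ 2
        = g s ^ 2 * Real.exp (-(lam * s)) * Real.exp (lam * t) := by
      rw [mul_pow, ← Real.exp_nat_mul, mul_assoc, ← Real.exp_add]
      congr 2; push_cast; ring
    have h3 : g t ^ 2 = g t ^ 2 * Real.exp (-(lam * t)) * Real.exp (lam * t) := by
      rw [mul_assoc, ← Real.exp_add]; simp
    rw [h2, h3]
    gcongr
  have hpos : 0 < g t := by
    by_contra hneg
    obtain ⟨r, hr, hr0⟩ := intermediate_value_Icc' hst h.continuous_snd.continuousOn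
      ⟨not_lt.1 hneg, hs.le⟩
    have := hsq r hr.1
    rw [hr0] at this
    have h1 : 0 < (g s * Real.exp (lam / 2 * (r - s))) ^ 2 := by positivity
    norm_num at this
    nlinarith
  refine ⟨(hN t hst).trans_eq (abs_of_pos hpos), ?_⟩
  exact (sq_le_sq₀ (by positivity) hpos.le).1 (hsq t hst)

/-- Horizontal vectors have u = -v and so lie on the boundary of the cone. Strict entry at later
times is what makes the height u + v of such a difference positive. -/
theorem cone_lt (h : IsConePair lam f g f' g') {s t : ℝ} (hst : s < t) (hs : 0 < g s)
    (hfg : |f s| ≤ g s) : |f t| < g t := by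
  have hl := h.pos
  have hstrict : StrictMonoOn (fun t => g t ^ 2 - 1 * f t ^ 2) (Ici s) := by
    refine strictMonoOn_of_deriv_pos (convex_Ici s)
      (fun t _ => (h.hasDerivAt_form 1 t).continuousAt.continuousWithinAt) fun t ht => ?_
    rw [(h.hasDerivAt_form 1 t).deriv]
    refine lt_of_lt_of_le ?_ (h.le_deriv_form (by norm_num) (by norm_num) t)
    have h1 := (h.cone_le (interior_subset ht) hs hfg).2
    have h2 : 0 < g t := lt_of_lt_of_le (by positivity) h1
    positivity
  have h1 := hstrict self_mem_Ici hst.le hst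
  have h2 : f s ^ 2 ≤ g s ^ 2 := sq_le_sq' (by linarith [(abs_le.1 hfg).1]) (abs_le.1 hfg).2
  simp only at h1
  have h3 : 0 ≤ g t := (abs_nonneg _).trans (h.cone_le hst.le hs hfg).1
  have h4 : f t ^ 2 < g t ^ 2 := by linarith
  rw [← abs_of_nonneg h3]
  exact sq_lt_sq.1 h4

/-- Pairs that decay in forward time lie in the stable cone. -/
theorem stable_of_tendsto (h : IsConePair lam f g f' g') (hf : Tendsto f atTop (𝓝 0))
    (hg : Tendsto g atTop (𝓝 0)) (t : ℝ) : |g t| ≤ |f t| / 2 := by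
  have h1 : Tendsto (fun t => g t ^ 2 - 1 / 4 * f t ^ 2) atTop (𝓝 0) := by
    have := (hg.pow 2).sub ((hf.pow 2).const_mul (1 / 4))
    rwa [show (0 : ℝ) ^ 2 - 1 / 4 * 0 ^ 2 = 0 by norm_num] at this
  have h2 := (h.monotone_form (k := 1 / 4) le_rfl (by norm_num)).ge_of_tendsto h1 t
  have h3 : g t ^ 2 ≤ (f t / 2) ^ 2 := by
    linarith [show (f t / 2) ^ 2 = 1 / 4 * f t ^ 2 by ring]
  have := sq_le_sq.1 h3
  rwa [abs_div, abs_two] at this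

/-- Pairs that decay in backward time lie in the unstable cone. -/
theorem unstable_of_tendsto (h : IsConePair lam f g f' g') (hf : Tendsto f atBot (𝓝 0))
    (hg : Tendsto g atBot (𝓝 0)) (t : ℝ) : |f t| ≤ |g t| / 2 := by
  have := h.reverse.stable_of_tendsto (hg.comp tendsto_neg_atTop_atBot)
    (hf.comp tendsto_neg_atTop_atBot) (-t)
  simpa using this

/-- The contracting coordinate stays bounded as long as the expanding one does. -/
theorem fst_le_of_snd_le (h : IsConePair lam f g f' g') {a b r : ℝ} (hab : a ≤ b)
    (hg : ∀ t ∈ Icc a b, |g t| ≤ 4 * r) (hf : |f a| ≤ r) : |f b| ≤ r := by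
  have hl := h.pos
  have hr : 0 ≤ r := (abs_nonneg _).trans hf
  -- The weight exp(lam t) absorbs the linear contraction. With |g| ≤ 4 r the error is too small to
  -- push |f| beyond r.
  have hanti : AntitoneOn (fun t => (f t ^ 2 - r ^ 2) * Real.exp (lam * t)) (Icc a b) := by
    refine antitoneOn_of_hasDerivWithinAt_nonpos (convex_Icc a b)
      (f' := fun t => (2 * f t * f' t + lam * (f t ^ 2 - r ^ 2)) * Real.exp (lam * t))
      (by have := h.continuous_fst; fun_prop) (fun t ht => ?_) (fun t ht => ?_)
    · have h1 := (((h.hasDerivAt_fst t).pow 2).sub_const (r ^ 2)).mul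
        ((hasDerivAt_id t).const_mul lam).exp
      refine h1.hasDerivWithinAt.congr_deriv ?_
      simp
      ring
    · have h1 := hg t (interior_subset ht)
      have h2 := h.fst_le t
      have h3 : |f t * (f' t + lam * f t)| ≤ |f t| * (lam / 16 * (|f t| + 4 * r)) := by
        rw [abs_mul]
        refine mul_le_mul_of_nonneg_left (h2.trans ?_) (abs_nonneg _)
        gcongr
      have h4 := (abs_le.1 h3).2
      have h5 : f t ^ 2 = |f t| ^ 2 := (sq_abs _).symm
      have : 2 * f t * f' t + lam * (f t ^ 2 - r ^ 2) ≤ 0 := by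
        nlinarith [sq_nonneg (|f t| - r), mul_nonneg hl.le (sq_nonneg (|f t| - r)),
          mul_nonneg hl.le (sq_nonneg (|f t|)), mul_nonneg hl.le (sq_nonneg r)]
      exact mul_nonpos_of_nonpos_of_nonneg this (Real.exp_pos _).le
  have h1 := hanti (left_mem_Icc.2 hab) (right_mem_Icc.2 hab) hab
  have h2 : f a ^ 2 ≤ r ^ 2 := sq_le_sq' (by linarith [(abs_le.1 hf).1]) (abs_le.1 hf).2
  simp only at h1
  have h3 : (f a ^ 2 - r ^ 2) * Real.exp (lam * a) ≤ 0 :=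
    mul_nonpos_of_nonpos_of_nonneg (by linarith) (Real.exp_pos _).le
  have h4 : f b ^ 2 - r ^ 2 ≤ 0 := by
    by_contra hc
    have := mul_pos (not_le.1 hc) (Real.exp_pos (lam * b))
    linarith
  rw [← abs_of_nonneg hr]
  exact sq_le_sq.1 (by linarith)

/-- Backward in time, a pair outside the unstable cone grows exponentially. -/
theorem neg_form_le (h : IsConePair lam f g f' g') {a b : ℝ} (hab : a ≤ b) :
    f b ^ 2 - g b ^ 2 ≤ (f a ^ 2 - g a ^ 2) * Real.exp (-(lam / 4 * (b - a))) := by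
  have hl := h.pos
  have hmono : Monotone fun t => (g t ^ 2 - 1 * f t ^ 2) * Real.exp (lam / 4 * t) := by
    have hd : ∀ t, HasDerivAt (fun t => (g t ^ 2 - 1 * f t ^ 2) * Real.exp (lam / 4 * t))
        ((2 * g t * g' t - 1 * (2 * f t * f' t) + lam / 4 * (g t ^ 2 - 1 * f t ^ 2)) *
          Real.exp (lam / 4 * t)) t := fun t => by
      refine ((h.hasDerivAt_form 1 t).mul ((hasDerivAt_id t).const_mul (lam / 4)).exp).congr_deriv ?_
      simp
      ring
    refine monotone_of_deriv_nonneg (fun t => (hd t).differentiableAt) fun t => ?_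
    rw [(hd t).deriv]
    have h1 := h.le_deriv_form (k := 1) (by norm_num) (by norm_num) t
    refine mul_nonneg ?_ (Real.exp_pos _).le
    have : 0 ≤ lam / 4 * g t ^ 2 := by positivity
    linarith
  have h1 := hmono hab
  simp only at h1
  have h2 : Real.exp (-(lam / 4 * (b - a))) = Real.exp (lam / 4 * a) * Real.exp (-(lam / 4 * b)) := by
    rw [← Real.exp_add]; congr 1; ring
  have h3 : f b ^ 2 - g b ^ 2
      = (f b ^ 2 - g b ^ 2) * Real.exp (lam / 4 * b) * Real.exp (-(lam / 4 * b)) := by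
    rw [mul_assoc, ← Real.exp_add]; simp
  rw [h2, ← mul_assoc, h3]
  refine mul_le_mul_of_nonneg_right ?_ (Real.exp_pos _).le
  linarith

end IsConePair

namespace IsConePair

variable {lam : ℝ} {f g f' g' : ℝ → ℝ}

/-- A function that increases along a cone pair at least as fast as the norm of the pair. -/
theorem exists_clock (h : IsConePair lam f g f' g') {s : Set ℝ} (hne : ∀ t ∈ s, f t ≠ 0 ∨ g t ≠ 0) :
    ∃ Ψ Ψ' : ℝ → ℝ, ∀ t ∈ s, HasDerivAt Ψ (Ψ' t) t ∧ lam / 4 * (|f t| + |g t|) ≤ Ψ' t ∧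
      |Ψ t| ≤ |f t| + |g t| := by
  have hl := h.pos
  -- With ρ² = f² + g² and P = g² - f², the function P/ρ is homogeneous of degree one and bounded by
  -- ρ. On the exact saddle its derivative is 2 lam ρ - lam P²/ρ³ ≥ lam ρ. Hence the integral of ρ
  -- over any stay in a box is controlled by boundary values alone.
  refine ⟨fun t => (g t ^ 2 - 1 * f t ^ 2) / √(f t ^ 2 + g t ^ 2), fun t =>
    ((2 * g t * g' t - 1 * (2 * f t * f' t)) * √(f t ^ 2 + g t ^ 2) - (g t ^ 2 - 1 * f t ^ 2) *
      ((2 * f t * f' t + 2 * g t * g' t) / (2 * √(f t ^ 2 + g t ^ 2)))) /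
      √(f t ^ 2 + g t ^ 2) ^ 2, fun t ht => ?_⟩
  have hD : 0 < f t ^ 2 + g t ^ 2 := by
    rcases hne t ht with h1 | h1
    · have : 0 < f t ^ 2 := by positivity
      positivity
    · have : 0 < g t ^ 2 := by positivity
      positivity
  have hρ : 0 < √(f t ^ 2 + g t ^ 2) := Real.sqrt_pos.2 hD
  have hρ2 : √(f t ^ 2 + g t ^ 2) ^ 2 = f t ^ 2 + g t ^ 2 := Real.sq_sqrt hD.le
  have hρle : √(f t ^ 2 + g t ^ 2) ≤ |f t| + |g t| := by
    rw [Real.sqrt_le_left (by positivity)]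
    rw [← sq_abs (f t), ← sq_abs (g t)]
    nlinarith [mul_nonneg (abs_nonneg (f t)) (abs_nonneg (g t))]
  refine ⟨?_, ?_, ?_⟩
  · have h1 : HasDerivAt (fun t => f t ^ 2 + g t ^ 2) (2 * f t * f' t + 2 * g t * g' t) t := by
      refine (((h.hasDerivAt_fst t).pow 2).add ((h.hasDerivAt_snd t).pow 2)).congr_deriv ?_
      norm_num
    exact (h.hasDerivAt_form 1 t).div (h1.sqrt hD.ne') hρ.ne'
  · beta_reduce
    have h1 := h.fst_le t
    have h2 := h.snd_le t
    set x := f t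
    set y := g t
    set ρ := √(x ^ 2 + y ^ 2)
    obtain ⟨e, he⟩ : ∃ e, e = f' t + lam * x := ⟨_, rfl⟩
    obtain ⟨d, hd⟩ : ∃ d, d = g' t - lam * y := ⟨_, rfl⟩
    have e1 : f' t = e - lam * x := by rw [he]; ring
    have e2 : g' t = d + lam * y := by rw [hd]; ring
    rw [← he] at h1
    rw [← hd] at h2
    have hs : (|x| + |y|) ^ 2 ≤ 2 * ρ ^ 2 := by
      rw [hρ2, ← sq_abs x, ← sq_abs y]
      nlinarith [sq_nonneg (|x| - |y|)]
    have hxe : |x * e| + |y * d| ≤ lam / 8 * ρ ^ 2 := by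
      rw [abs_mul, abs_mul]
      calc |x| * |e| + |y| * |d|
          ≤ |x| * (lam / 16 * (|x| + |y|)) + |y| * (lam / 16 * (|x| + |y|)) := by gcongr
        _ = lam / 16 * (|x| + |y|) ^ 2 := by ring
        _ ≤ lam / 16 * (2 * ρ ^ 2) := by gcongr
        _ = _ := by ring
    have hP : |y ^ 2 - x ^ 2| ≤ ρ ^ 2 := by
      rw [hρ2]
      exact abs_le.2 ⟨by nlinarith [sq_nonneg y], by nlinarith [sq_nonneg x]⟩
    have hxy : |x| + |y| ≤ 3 / 2 * ρ := by
      refine abs_le_of_sq_le_sq' ?_ (by positivity) |>.2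
      nlinarith [sq_nonneg ρ]
    obtain ⟨P, hPd⟩ : ∃ P, P = y ^ 2 - x ^ 2 := ⟨_, rfl⟩
    rw [← hPd] at hP
    have hPsq : P ^ 2 ≤ ρ ^ 2 * ρ ^ 2 := by
      nlinarith [abs_nonneg P, sq_abs P, sq_nonneg ρ]
    have n1 : 2 * y * (d + lam * y) - 1 * (2 * x * (e - lam * x))
        = 2 * lam * ρ ^ 2 + 2 * (y * d - x * e) := by rw [hρ2]; ring
    have n2 : 2 * x * (e - lam * x) + 2 * y * (d + lam * y)
        = 2 * lam * P + 2 * (x * e + y * d) := by rw [hPd]; ring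
    have a1 : -(lam / 8 * ρ ^ 2) ≤ y * d - x * e := by
      have := neg_abs_le (y * d); have := le_abs_self (x * e); linarith
    have a2 : |x * e + y * d| ≤ lam / 8 * ρ ^ 2 := (abs_add_le _ _).trans hxe
    have a3 : P * (x * e + y * d) ≤ ρ ^ 2 * (lam / 8 * ρ ^ 2) := by
      refine (le_abs_self _).trans ?_
      rw [abs_mul]
      exact mul_le_mul hP a2 (abs_nonneg _) (sq_nonneg _)
    rw [e1, e2, n1, n2, one_mul, ← hPd, le_div_iff₀ (by positivity)]
    have e3 : (2 * lam * ρ ^ 2 + 2 * (y * d - x * e)) * ρ -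
        P * ((2 * lam * P + 2 * (x * e + y * d)) / (2 * ρ)) =
        ((2 * lam * ρ ^ 2 + 2 * (y * d - x * e)) * ρ ^ 2 - (lam * P ^ 2 + P * (x * e + y * d))) / ρ := by
      field_simp
    rw [e3, le_div_iff₀ hρ]
    have a4 : lam / 4 * (|x| + |y|) * ρ ^ 2 * ρ ≤ lam / 4 * (3 / 2 * ρ) * ρ ^ 2 * ρ := by gcongr
    have a5 : -(lam / 8 * ρ ^ 2) * ρ ^ 2 ≤ (y * d - x * e) * ρ ^ 2 :=
      mul_le_mul_of_nonneg_right a1 (sq_nonneg _)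
    have a6 : lam * P ^ 2 ≤ lam * (ρ ^ 2 * ρ ^ 2) := mul_le_mul_of_nonneg_left hPsq hl.le
    have a7 : 0 ≤ lam * (ρ ^ 2 * ρ ^ 2) := by positivity
    nlinarith
  · rw [abs_div, abs_of_pos hρ, div_le_iff₀ hρ]
    refine le_trans ?_ (mul_le_mul_of_nonneg_right hρle hρ.le)
    rw [← sq, hρ2]
    exact abs_le.2 ⟨by nlinarith [sq_nonneg (g t)], by nlinarith [sq_nonneg (f t)]⟩

end IsConePair

/-! ### Global saddle fields: cones, invariant manifolds, passage and Jacobian near the saddle. -/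

/-- `F` is, up to a Lipschitz error that is small against `lam`, the linear saddle with contracting
coordinate `u`, expanding coordinate `v` and eigenvalues `∓ lam`; the height is `u + v`, and `v`
increases along the `x`-axis. -/
structure IsSaddleField (u v : Plane →L[ℝ] ℝ) (lam : ℝ) (F : Plane → Plane) : Prop where
  pos : 0 < lam
  add : ∀ q, u q + v q = q.2
  dir_pos : 0 < v (1, 0)
  fst_le : ∀ p q, |u (F p - F q) + lam * u (p - q)| ≤ lam / 16 * (|u (p - q)| + |v (p - q)|)
  snd_le : ∀ p q, |v (F p - F q) - lam * v (p - q)| ≤ lam / 16 * (|u (p - q)| + |v (p - q)|)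

namespace IsSaddleField

variable {u v : Plane →L[ℝ] ℝ} {lam : ℝ} {F : Plane → Plane} {φ : ℝ → Plane → Plane}

theorem fst_horizontal (h : IsSaddleField u v lam F) (x : ℝ) : u (x, 0) = -(x * v (1, 0)) := by
  have h1 := h.add (x, 0)
  have h2 : v (x, 0) = x * v (1, 0) := by
    rw [← smul_eq_mul, ← map_smul]; simp
  simp only at h1
  linarith

theorem snd_horizontal (_h : IsSaddleField u v lam F) (x : ℝ) : v (x, 0) = x * v (1, 0) := by
  rw [← smul_eq_mul, ← map_smul]; simp

theorem exists_norm_le (h : IsSaddleField u v lam F) :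
    ∃ C > 0, ∀ q, ‖q‖ ≤ C * (|u q| + |v q|) := by
  have hc := h.dir_pos
  refine ⟨1 + (1 + |v (0, 1)|) / v (1, 0), by positivity, fun q => ?_⟩
  have h2 : |q.2| ≤ |u q| + |v q| := by rw [← h.add]; exact abs_add_le _ _
  have h3 : v q = q.1 * v (1, 0) + q.2 * v (0, 1) := by
    have : q = q.1 • ((1, 0) : Plane) + q.2 • ((0, 1) : Plane) := by ext <;> simp
    conv_lhs => rw [this, map_add, map_smul, map_smul]
    simp
  have h1 : |q.1| * v (1, 0) ≤ (1 + |v (0, 1)|) * (|u q| + |v q|) := by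
    have : q.1 * v (1, 0) = v q - q.2 * v (0, 1) := by rw [h3]; ring
    rw [← abs_of_pos hc, ← abs_mul, this]
    refine (abs_sub _ _).trans ?_
    rw [abs_mul]
    have := mul_le_mul_of_nonneg_right h2 (abs_nonneg (v (0, 1)))
    have := abs_nonneg (u q)
    nlinarith
  have hs : 0 ≤ |u q| + |v q| := by positivity
  have h4 : |q.1| ≤ (1 + |v (0, 1)|) / v (1, 0) * (|u q| + |v q|) := by
    rw [div_mul_eq_mul_div, le_div_iff₀ hc]; exact h1
  have h5 : 0 ≤ (1 + |v (0, 1)|) / v (1, 0) * (|u q| + |v q|) := by positivity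
  rw [Prod.norm_def]
  refine max_le ?_ ?_ <;> rw [Real.norm_eq_abs] <;> linarith

theorem eq_zero (h : IsSaddleField u v lam F) {q : Plane} (hu : u q = 0) (hv : v q = 0) :
    q = 0 := by
  obtain ⟨C, -, hC⟩ := h.exists_norm_le
  have := hC q
  rw [hu, hv] at this
  simpa using this

/-- The error bounds of the field are imposed on differences of points, so any two orbits, not only
those close to the saddle, separate as in a cone pair. -/
theorem conePair_sub (h : IsSaddleField u v lam F) (hφ : IsFlow F φ) (p q : Plane) :
    IsConePair lam (fun t => u (φ t p - φ t q)) (fun t => v (φ t p - φ t q))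
      (fun t => u (F (φ t p) - F (φ t q))) (fun t => v (F (φ t p) - F (φ t q))) where
  pos := h.pos
  hasDerivAt_fst t := hasDerivAt_clm_comp u ((hφ.hasDerivAt p t).sub (hφ.hasDerivAt q t))
  hasDerivAt_snd t := hasDerivAt_clm_comp v ((hφ.hasDerivAt p t).sub (hφ.hasDerivAt q t))
  fst_le _ := h.fst_le _ _
  snd_le _ := h.snd_le _ _

theorem _root_.IsFlow.orbit_of_zero (hφ : IsFlow F φ) {S : Plane} (hS : F S = 0) (t : ℝ) :
    φ t S = S := by
  have := hφ.eq_orbit (γ := fun _ => S) (fun t => by rw [hS]; exact hasDerivAt_const t S) t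
  exact this.symm

theorem conePair_zero (h : IsSaddleField u v lam F) (hφ : IsFlow F φ) {S : Plane} (hS : F S = 0)
    (q : Plane) :
    IsConePair lam (fun t => u (φ t q - S)) (fun t => v (φ t q - S))
      (fun t => u (F (φ t q))) (fun t => v (F (φ t q))) := by
  have := h.conePair_sub hφ q S
  simpa only [hφ.orbit_of_zero hS, hS, sub_zero] using this

/-- The inequalities on differences are homogeneous, so they survive division by the increment and
pass to the derivative. -/
theorem fderiv_le (h : IsSaddleField u v lam F) {q : Plane} (hF : DifferentiableAt ℝ F q)
    (w : Plane) :
    |u (fderiv ℝ F q w) + lam * u w| ≤ lam / 16 * (|u w| + |v w|) ∧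
      |v (fderiv ℝ F q w) - lam * v w| ≤ lam / 16 * (|u w| + |v w|) := by
  have hline : HasDerivAt (fun t : ℝ => F (q + t • w)) (fderiv ℝ F q w) 0 := by
    have h1 : HasDerivAt (fun t : ℝ => q + t • w) w 0 := by
      simpa using ((hasDerivAt_id (0 : ℝ)).smul_const w).const_add q
    have h2 : HasFDerivAt F (fderiv ℝ F q) (q + (0 : ℝ) • w) := by simpa using hF.hasFDerivAt
    exact h2.comp_hasDerivAt 0 h1
  have hlim := hasDerivAt_iff_tendsto_slope_zero.1 hline
  simp only [zero_add, zero_smul, add_zero] at hlim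
  have hev : ∀ L : Plane →L[ℝ] ℝ, ∀ t : ℝ, t ≠ 0 → ∀ c : ℝ,
      L (t⁻¹ • (F (q + t • w) - F q)) + c * L w
        = t⁻¹ * (L (F (q + t • w) - F q) + c * L (q + t • w - q)) := by
    intro L t ht c
    rw [map_smul, add_sub_cancel_left, map_smul]
    simp only [smul_eq_mul]
    field_simp
  have hbd : ∀ t : ℝ, t ≠ 0 → lam / 16 * (|u w| + |v w|) =
      |t⁻¹| * (lam / 16 * (|u (q + t • w - q)| + |v (q + t • w - q)|)) := by
    intro t ht
    rw [add_sub_cancel_left, map_smul, map_smul, smul_eq_mul, smul_eq_mul, abs_mul, abs_mul, abs_inv]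
    have : |t| ≠ 0 := abs_ne_zero.2 ht
    field_simp
  constructor
  · refine le_of_tendsto ((((u.continuous.tendsto _).comp hlim).add_const (lam * u w)).abs) ?_
    filter_upwards [self_mem_nhdsWithin] with t ht
    rw [Function.comp_apply, hev u t ht lam, abs_mul, hbd t ht]
    exact mul_le_mul_of_nonneg_left (h.fst_le _ _) (abs_nonneg _)
  · refine le_of_tendsto ((((v.continuous.tendsto _).comp hlim).sub_const (lam * v w)).abs) ?_
    filter_upwards [self_mem_nhdsWithin] with t ht
    rw [Function.comp_apply, sub_eq_add_neg, ← neg_mul, hev v t ht (-lam), abs_mul, hbd t ht]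
    refine mul_le_mul_of_nonneg_left ?_ (abs_nonneg _)
    rw [neg_mul, ← sub_eq_add_neg]
    exact h.snd_le _ _

/-- The velocity along an orbit is a cone pair. -/
theorem conePair_velocity (h : IsSaddleField u v lam F) (hφ : IsFlow F φ) (q : Plane) :
    IsConePair lam (fun t => u (F (φ t q))) (fun t => v (F (φ t q)))
      (fun t => u (fderiv ℝ F (φ t q) (F (φ t q))))
      (fun t => v (fderiv ℝ F (φ t q) (F (φ t q)))) := by
  have hd : Differentiable ℝ F := hφ.field_contDiff.differentiable two_ne_zero
  have h1 : ∀ t, HasDerivAt (fun t => F (φ t q)) (fderiv ℝ F (φ t q) (F (φ t q))) t := fun t =>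
    (hd (φ t q)).hasFDerivAt.comp_hasDerivAt t (hφ.hasDerivAt q t)
  exact ⟨h.pos, fun t => hasDerivAt_clm_comp u (h1 t), fun t => hasDerivAt_clm_comp v (h1 t),
    fun t => (h.fderiv_le (hd _) _).1, fun t => (h.fderiv_le (hd _) _).2⟩

theorem hasDerivAt_height (hφ : IsFlow F φ) (q : Plane) (t : ℝ) :
    HasDerivAt (fun t => (φ t q).2) (F (φ t q)).2 t :=
  hasDerivAt_clm_comp (.snd ℝ ℝ ℝ) (hφ.hasDerivAt q t)

/-- The orbit of a visible fold point. -/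
theorem fold_orbit (h : IsSaddleField u v lam F) (hφ : IsFlow F φ) {S : Plane} (hS : F S = 0)
    (hβ : S.2 < 0) {a : ℝ} (ha : (F (a, 0)).2 = 0) :
    |u ((a, 0) - S)| ≤ -S.2 ∧ |v ((a, 0) - S)| ≤ -S.2 ∧ (∀ t > 0, 0 < (φ t (a, 0)).2) ∧
      (∀ t, 0 ≤ t → 0 ≤ v (φ t (a, 0) - S)) ∧
      Tendsto (fun t => v (φ t (a, 0) - S)) atTop atTop := by
  have hl := h.pos
  have h1 := h.fst_le (a, 0) S
  have h2 := h.snd_le (a, 0) S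
  have h3 := h.add ((a, 0) - S)
  have h4 := h.add (F (a, 0))
  rw [hS, sub_zero] at h1 h2
  rw [ha] at h4
  simp only [Prod.snd_sub, zero_sub] at h3
  set U := u ((a, 0) - S)
  set W := v ((a, 0) - S)
  -- Tangency means u(F) + v(F) = 0 at the point, hence U and W agree up to a relative error. Their
  -- sum is -β > 0, so both are positive.
  have h5 : lam * |W - U| ≤ lam * ((|U| + |W|) / 8) := by
    rw [← abs_of_pos hl, ← abs_mul, abs_of_pos hl]
    have e : lam * (W - U) = -(v (F (a, 0)) - lam * W) - (u (F (a, 0)) + lam * U) := by linarith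
    rw [e]
    refine (abs_sub _ _).trans ?_
    rw [abs_neg]
    linarith
  have h6 := le_of_mul_le_mul_left h5 hl
  obtain ⟨h7, h8⟩ := abs_le.1 h6
  have hU : 0 < U := by
    by_contra hc
    rw [abs_of_nonpos (not_lt.1 hc)] at h7 h8
    rw [abs_of_nonneg (by linarith : 0 ≤ W)] at h7 h8
    linarith
  have hW : 0 < W := by
    by_contra hc
    rw [abs_of_nonpos (not_lt.1 hc), abs_of_pos hU] at h7 h8
    linarith
  rw [abs_of_pos hU, abs_of_pos hW] at h1 h2 h7 h8
  have hg0 : 0 < v (F (a, 0)) := by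
    have h9 := (abs_le.1 h2).1
    have : lam * (W - (U + W) / 16) ≤ v (F (a, 0)) := by linarith
    refine lt_of_lt_of_le (mul_pos hl ?_) this
    linarith
  have hp := h.conePair_velocity hφ (a, 0)
  -- The velocity at the fold is on the boundary of the unstable cone; it enters the interior at
  -- once, and there the vertical speed is positive.
  have hf0 : |u (F (φ 0 (a, 0)))| ≤ v (F (φ 0 (a, 0))) := by
    rw [hφ.zero, show u (F (a, 0)) = -v (F (a, 0)) by linarith, abs_neg, abs_of_pos hg0]
  have hg0' : 0 < v (F (φ 0 (a, 0))) := by rwa [hφ.zero]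
  have hmono : StrictMonoOn (fun t => (φ t (a, 0)).2) (Ici 0) := by
    refine strictMonoOn_of_deriv_pos (convex_Ici 0)
      (fun t _ => (hasDerivAt_height hφ (a, 0) t).continuousAt.continuousWithinAt) fun t ht => ?_
    rw [interior_Ici] at ht
    rw [(hasDerivAt_height hφ (a, 0) t).deriv, ← h.add]
    have := hp.cone_lt (s := 0) ht hg0' hf0
    have := (abs_lt.1 this).1
    linarith
  have hgrow : ∀ t, 0 ≤ t → W + v (F (a, 0)) * t ≤ v (φ t (a, 0) - S) := by
    intro t ht
    have hd : ∀ t, HasDerivAt (fun t => v (φ t (a, 0) - S)) (v (F (φ t (a, 0)))) t := fun t =>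
      hasDerivAt_clm_comp v ((hφ.hasDerivAt (a, 0) t).sub_const S)
    have := (convex_Icc 0 t).mul_sub_le_image_sub_of_le_deriv
      (f := fun t => v (φ t (a, 0) - S)) (C := v (F (a, 0)))
      (fun s _ => (hd s).continuousAt.continuousWithinAt)
      (fun s _ => (hd s).differentiableAt.differentiableWithinAt) (fun s hs => by
        rw [(hd s).deriv]
        have h9 := (hp.cone_le (s := 0) (interior_subset hs).1 hg0' hf0).2
        rw [hφ.zero] at h9
        refine le_trans (le_mul_of_one_le_right hg0.le (Real.one_le_exp ?_)) h9
        have := (interior_subset hs).1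
        have : 0 ≤ s - 0 := by linarith
        positivity) 0 (left_mem_Icc.2 ht) t (right_mem_Icc.2 ht) ht
    simp only [hφ.zero] at this
    linarith
  refine ⟨?_, ?_, fun t ht => ?_, fun t ht => ?_, ?_⟩
  · rw [abs_of_pos hU]; linarith
  · rw [abs_of_pos hW]; linarith
  · have := hmono self_mem_Ici ht.le ht
    simpa only [hφ.zero] using this
  · have := hgrow t ht
    have : 0 ≤ v (F (a, 0)) * t := by positivity
    linarith
  · refine tendsto_atTop_mono' atTop ((eventually_ge_atTop 0).mono hgrow) ?_
    exact tendsto_atTop_add_const_left _ _ (tendsto_id.const_mul_atTop hg0)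

/-- Orbits that start on `{y = 0}` to the right of a reference orbit in `{y ≥ 0}` stay in `{y > 0}`
and leave along the unstable direction. -/
theorem orbit_right_of (h : IsSaddleField u v lam F) (hφ : IsFlow F φ) {S : Plane} (hS : F S = 0)
    {a x r R : ℝ} (hax : a < x) (hrR : r ≤ R) (h1 : ∀ t, 0 ≤ t → 0 ≤ (φ t (a, 0)).2)
    (h2 : ∀ t, 0 ≤ t → -r ≤ v (φ t (a, 0) - S)) (hu : |u ((x, 0) - S)| ≤ r)
    (hv : v ((x, 0) - S) < r) :
    (∀ t > 0, 0 < (φ t (x, 0)).2) ∧ (∀ t, 0 ≤ t → v (φ t (a, 0) - S) ≤ v (φ t (x, 0) - S)) ∧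
      (∃ T > 0, v (φ T (x, 0) - S) = r ∧
        ∀ t ∈ Icc 0 T, |u (φ t (x, 0) - S)| ≤ r ∧ |v (φ t (x, 0) - S)| ≤ r) ∧
      ∀ t, 0 ≤ t → v (φ t (x, 0) - S) ≤ R →
        ∀ s ∈ Icc 0 t, |u (φ s (x, 0) - S)| ≤ R ∧ |v (φ s (x, 0) - S)| ≤ R := by
  have hl := h.pos
  have hc := h.dir_pos
  have hd := h.conePair_sub hφ (x, 0) (a, 0)
  have hdx : ((x, 0) : Plane) - (a, 0) = (x - a, 0) := by simp
  have hg0 : 0 < v (φ 0 (x, 0) - φ 0 (a, 0)) := by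
    rw [hφ.zero, hφ.zero, hdx, h.snd_horizontal]
    exact mul_pos (by linarith) hc
  have hf0 : |u (φ 0 (x, 0) - φ 0 (a, 0))| ≤ v (φ 0 (x, 0) - φ 0 (a, 0)) := by
    rw [hφ.zero, hφ.zero, hdx, h.snd_horizontal, h.fst_horizontal, abs_neg,
      abs_of_pos (mul_pos (by linarith) hc)]
  -- The reference orbit keeps v above -r while the difference of the orbits grows exponentially, so
  -- v must reach r.
  have hsplit : ∀ t, v (φ t (x, 0) - S) = v (φ t (a, 0) - S) + v (φ t (x, 0) - φ t (a, 0)) := by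
    intro t; rw [← map_add]; congr 1; abel
  have hdv : ∀ t, 0 ≤ t → 0 < v (φ t (x, 0) - φ t (a, 0)) := fun t ht =>
    lt_of_lt_of_le (by positivity) (hd.cone_le ht hg0 hf0).2
  have hvc : Continuous fun t => v (φ t (x, 0) - S) :=
    v.continuous.comp ((hφ.continuous_orbit _).sub continuous_const)
  have htop : ∃ t, 0 ≤ t ∧ r ≤ v (φ t (x, 0) - S) := by
    have ht : Tendsto (fun t => v (φ 0 (x, 0) - φ 0 (a, 0)) * Real.exp (lam / 2 * (t - 0))) atTop
        atTop := by
      refine Tendsto.const_mul_atTop hg0 (Real.tendsto_exp_atTop.comp ?_)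
      simpa using tendsto_id.const_mul_atTop (by positivity : 0 < lam / 2)
    obtain ⟨t, ht1, ht2⟩ := ((ht.eventually_ge_atTop (2 * r)).and (eventually_ge_atTop 0)).exists
    refine ⟨t, ht2, ?_⟩
    rw [hsplit]
    linarith [h2 t ht2, (hd.cone_le ht2 hg0 hf0).2]
  have hlow : ∀ t, 0 ≤ t → -r ≤ v (φ t (x, 0) - S) := fun t ht => by
    rw [hsplit]; linarith [h2 t ht, hdv t ht]
  have hp := h.conePair_zero hφ hS (x, 0)
  obtain ⟨T, hT0, hTr, hTbox⟩ : ∃ T > 0, v (φ T (x, 0) - S) = r ∧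
      ∀ t ∈ Icc 0 T, |u (φ t (x, 0) - S)| ≤ r ∧ |v (φ t (x, 0) - S)| ≤ r := by
    obtain ⟨T, hT, hTr, hTle⟩ := exists_first_hit hvc (by simpa only [hφ.zero] using hv) htop
    have hvb : ∀ t ∈ Icc 0 T, |v (φ t (x, 0) - S)| ≤ r := fun t ht =>
      abs_le.2 ⟨hlow t ht.1, hTle t ht⟩
    refine ⟨T, hT, hTr, fun t ht => ⟨?_, hvb t ht⟩⟩
    exact hp.fst_le_of_snd_le ht.1 (fun s hs => (hvb s ⟨hs.1, hs.2.trans ht.2⟩).trans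
      (by linarith [(abs_nonneg _).trans hu]))
      (by simpa only [hφ.zero] using hu)
  have hr0 : 0 ≤ r := (abs_nonneg _).trans hu
  refine ⟨fun t ht => ?_, fun t ht => ?_, ⟨T, hT0, hTr, hTbox⟩, fun t ht htR s hs => ?_⟩
  · have h3 := (abs_lt.1 (hd.cone_lt ht hg0 hf0)).1
    have h4 := h.add (φ t (x, 0) - φ t (a, 0))
    rw [Prod.snd_sub] at h4
    linarith [h1 t ht.le]
  · rw [hsplit]; linarith [hdv t ht]
  · rcases le_or_gt s T with hsT | hsT
    · have := hTbox s ⟨hs.1, hsT⟩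
      exact ⟨this.1.trans hrR, this.2.trans hrR⟩
    · rcases hr0.eq_or_lt with h0 | h0
      · exfalso
        have h3 := hv
        rw [← h0] at h3
        have := hlow 0 le_rfl
        rw [hφ.zero, ← h0] at this
        linarith
      have h3 : |u (φ T (x, 0) - S)| ≤ v (φ T (x, 0) - S) := by
        rw [hTr]; exact (hTbox T (right_mem_Icc.2 hT0.le)).1
      have h4 := hp.cone_le hsT.le (by rwa [hTr]) h3
      have h5 : 0 < v (φ s (x, 0) - S) := lt_of_lt_of_le (by rw [hTr]; positivity) h4.2
      have h6 := (hp.cone_le hs.2 h5 h4.1).2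
      have h7 : v (φ s (x, 0) - S) ≤ R := by
        refine le_trans (le_mul_of_one_le_right h5.le (Real.one_le_exp ?_)) (h6.trans htR)
        have : 0 ≤ t - s := sub_nonneg.2 hs.2
        positivity
      exact ⟨h4.1.trans h7, by rwa [abs_of_pos h5]⟩

end IsSaddleField

namespace IsSaddleField

variable {u v : Plane →L[ℝ] ℝ} {lam : ℝ} {F : Plane → Plane} {φ : ℝ → Plane → Plane}

theorem stable_cone (h : IsSaddleField u v lam F) (hφ : IsFlow F φ) {S q : Plane} (hS : F S = 0)
    (hq : Tendsto (fun t => φ t q) atTop (𝓝 S)) (t : ℝ) :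
    |v (φ t q - S)| ≤ |u (φ t q - S)| / 2 := by
  have h0 : ∀ L : Plane →L[ℝ] ℝ, Tendsto (fun t => L (φ t q - S)) atTop (𝓝 0) := fun L => by
    have := (L.continuous.tendsto _).comp (hq.sub_const S)
    rwa [sub_self, map_zero] at this
  exact (h.conePair_zero hφ hS q).stable_of_tendsto (h0 u) (h0 v) t

theorem unstable_cone (h : IsSaddleField u v lam F) (hφ : IsFlow F φ) {S q : Plane} (hS : F S = 0)
    (hq : Tendsto (fun t => φ t q) atBot (𝓝 S)) (t : ℝ) :
    |u (φ t q - S)| ≤ |v (φ t q - S)| / 2 := by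
  have h0 : ∀ L : Plane →L[ℝ] ℝ, Tendsto (fun t => L (φ t q - S)) atBot (𝓝 0) := fun L => by
    have := (L.continuous.tendsto _).comp (hq.sub_const S)
    rwa [sub_self, map_zero] at this
  exact (h.conePair_zero hφ hS q).unstable_of_tendsto (h0 u) (h0 v) t

/-- A horizontal line contains at most one point of the stable manifold. -/
theorem horizontal_unique (h : IsSaddleField u v lam F) (hφ : IsFlow F φ) {S : Plane} {a b : ℝ}
    (ha : Tendsto (fun t => φ t (a, 0)) atTop (𝓝 S))
    (hb : Tendsto (fun t => φ t (b, 0)) atTop (𝓝 S)) : a = b := by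
  have h0 : ∀ L : Plane →L[ℝ] ℝ, Tendsto (fun t => L (φ t (a, 0) - φ t (b, 0))) atTop (𝓝 0) :=
    fun L => by
      have := (L.continuous.tendsto _).comp (ha.sub hb)
      rwa [sub_self, map_zero] at this
  have h1 := (h.conePair_sub hφ (a, 0) (b, 0)).stable_of_tendsto (h0 u) (h0 v) 0
  have hab : ((a, 0) : Plane) - (b, 0) = (a - b, 0) := by simp
  rw [hφ.zero, hφ.zero, hab, h.fst_horizontal, h.snd_horizontal, abs_neg] at h1
  have h2 : |(a - b) * v (1, 0)| = 0 := by linarith [abs_nonneg ((a - b) * v (1, 0))]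
  have h3 := (mul_eq_zero.1 (abs_eq_zero.1 h2)).resolve_right h.dir_pos.ne'
  linarith

/-- The branch of the stable manifold below a saddle of positive height meets `{y = 0}`. -/
theorem exists_stable_point (h : IsSaddleField u v lam F) (hφ : IsFlow F φ) {S m : Plane}
    (hS : F S = 0) (hβ : 0 < S.2) (hm : Tendsto (fun t => φ t m) atTop (𝓝 S))
    (hum : u (m - S) < 0) :
    ∃ a s : ℝ, φ s (a, 0) = m ∧ Tendsto (fun t => φ t (a, 0)) atTop (𝓝 S) ∧
      (∀ t > 0, 0 < (φ t (a, 0)).2) ∧ (∀ t, 0 ≤ t → |u (φ t (a, 0) - S)| ≤ 2 * S.2) ∧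
      (∀ t, 0 ≤ t → |v (φ t (a, 0) - S)| ≤ S.2) ∧ 0 < (F (a, 0)).2 := by
  have hl := h.pos
  have hcone := h.stable_cone hφ hS hm
  have hp := h.conePair_zero hφ hS m
  have hr := hp.reverse.neg
  have hcone' : ∀ s, |-(fun t => v (φ t m - S)) (-s)| ≤ |u (φ (-s) m - S)| := fun s => by
    rw [abs_neg]
    have := hcone (-s)
    have := abs_nonneg (u (φ (-s) m - S))
    simp only
    linarith
  have huc : Continuous fun t => u (φ t m - S) :=
    u.continuous.comp ((hφ.continuous_orbit _).sub continuous_const)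
  have hune : ∀ t, u (φ t m - S) ≠ 0 := by
    intro t h0
    have h1 := hcone t
    rw [h0, abs_zero, zero_div] at h1
    have h2 := h.eq_zero h0 (abs_eq_zero.1 (le_antisymm h1 (abs_nonneg _)))
    have h3 : m = S := by
      have := hφ.add (-t) t m
      rw [neg_add_cancel, hφ.zero, sub_eq_zero.1 h2, hφ.orbit_of_zero hS] at this
      exact this
    rw [h3] at hum
    simp at hum
  have huneg : ∀ t, u (φ t m - S) < 0 := by
    intro t
    by_contra hc
    have h1 : u (φ 0 m - S) < 0 := by rwa [hφ.zero]
    obtain ⟨s, -, hs⟩ := intermediate_value_uIcc (a := 0) (b := t) huc.continuousOn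
      (show (0 : ℝ) ∈ uIcc _ _ from mem_uIcc.2 (Or.inl ⟨h1.le, not_lt.1 hc⟩))
    exact hune s hs
  -- The time-reversed pair lies in its unstable cone, so -u grows exponentially backward in time
  -- and the branch descends below Σ.
  have hgrow : ∀ s t, s ≤ t → -u (φ t m - S) * Real.exp (lam / 2 * (t - s)) ≤ -u (φ s m - S) := by
    intro s t hst
    have h1 := hr.cone_le (s := -t) (t := -s) (by linarith)
      (by simpa using huneg t) (by
        have := hcone' (-t)
        rw [neg_neg, abs_of_neg (huneg t)] at this
        simpa only [neg_neg] using this)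
    have h2 := h1.2
    simp only [neg_neg] at h2
    rwa [show -s - -t = t - s by ring] at h2
  have hy : ∀ t, (φ t m).2 = S.2 + (u (φ t m - S) + v (φ t m - S)) := fun t => by
    rw [h.add, Prod.snd_sub]; ring
  have hcone2 : ∀ t, |v (φ t m - S)| ≤ -u (φ t m - S) / 2 := fun t => by
    have := hcone t; rwa [abs_of_neg (huneg t)] at this
  -- On this branch u < 0 and |v| ≤ |u|/2. The vertical speed is close to lam (v - u), hence
  -- positive, and the height crosses 0 only once.
  have hvel : ∀ t, 0 < (F (φ t m)).2 := by
    intro t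
    have h1 := hp.fst_le t
    have h2 := hp.snd_le t
    have h3 := hcone2 t
    rw [abs_of_neg (huneg t)] at h1 h2
    rw [← h.add]
    have h4 := (abs_le.1 h1).1
    have h5 := (abs_le.1 h2).1
    have h6 := (abs_le.1 h3).1
    have h7 := huneg t
    have h8 : 0 < lam * -u (φ t m - S) := mul_pos hl (by linarith)
    have h9 : lam * (u (φ t m - S) / 2) ≤ lam * v (φ t m - S) :=
      mul_le_mul_of_nonneg_left (by linarith) hl.le
    have h10 : lam * |v (φ t m - S)| ≤ lam * (-u (φ t m - S) / 2) :=
      mul_le_mul_of_nonneg_left h3 hl.le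
    linarith
  have hmono : StrictMono fun t => (φ t m).2 := strictMono_of_deriv_pos fun t => by
    rw [(hasDerivAt_height hφ m t).deriv]; exact hvel t
  have hyc : Continuous fun t => (φ t m).2 := continuous_snd.comp (hφ.continuous_orbit m)
  obtain ⟨s₁, hs₁⟩ : ∃ s, (φ s m).2 < 0 := by
    have ht : Tendsto (fun s => -u (φ 0 m - S) * Real.exp (lam / 2 * (0 - s))) atBot atTop := by
      refine Tendsto.const_mul_atTop (by have := huneg 0; linarith)
        (Real.tendsto_exp_atTop.comp ?_)
      refine Tendsto.const_mul_atTop (by positivity) ?_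
      exact tendsto_neg_atBot_atTop.congr fun s => (zero_sub s).symm
    obtain ⟨s, hs, hs0⟩ := ((ht.eventually_gt_atTop (2 * S.2)).and (eventually_le_atBot 0)).exists
    refine ⟨s, ?_⟩
    rw [hy]
    have := hgrow s 0 hs0
    have := (abs_le.1 (hcone2 s)).2
    linarith
  obtain ⟨s₂, hs₂⟩ : ∃ s, 0 < (φ s m).2 := by
    have : Tendsto (fun t => (φ t m).2) atTop (𝓝 S.2) := (continuous_snd.tendsto _).comp hm
    exact (this.eventually (lt_mem_nhds hβ)).exists
  obtain ⟨s, -, hs⟩ := intermediate_value_uIcc (a := s₁) (b := s₂) hyc.continuousOn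
    (show (0 : ℝ) ∈ uIcc _ _ from mem_uIcc.2 (Or.inl ⟨hs₁.le, hs₂.le⟩))
  have hpt : φ s m = ((φ s m).1, 0) := Prod.ext rfl hs
  have hsh : ∀ t, φ t ((φ s m).1, 0) = φ (t + s) m := fun t => by rw [← hpt, hφ.add]
  have hu2 : ∀ t, 0 ≤ t → |u (φ (t + s) m - S)| ≤ 2 * S.2 := by
    intro t ht
    have h1 := hgrow s (t + s) (by linarith)
    have h2 := hcone2 s
    have h3 := hy s
    simp only at hs
    rw [hs] at h3
    have h4 := (abs_le.1 h2).2
    have h5 : -u (φ (t + s) m - S) ≤ -u (φ s m - S) := by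
      refine le_trans (le_mul_of_one_le_right ?_ (Real.one_le_exp ?_)) h1
      · linarith [huneg (t + s)]
      · have : 0 ≤ t + s - s := by linarith
        positivity
    rw [abs_of_neg (huneg _)]
    linarith
  refine ⟨(φ s m).1, -s, ?_, ?_, fun t ht => ?_, fun t ht => ?_, fun t ht => ?_, ?_⟩
  · rw [hsh, neg_add_cancel, hφ.zero]
  · simp only [hsh]
    exact hm.comp (tendsto_atTop_add_const_right _ _ tendsto_id)
  · rw [hsh, ← hs]
    exact hmono (by linarith)
  · rw [hsh]; exact hu2 t ht
  · rw [hsh]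
    have h1 := hu2 t ht
    rw [abs_of_neg (huneg _)] at h1
    linarith [hcone2 (t + s)]
  · rw [← hpt]; exact hvel s

/-- Orbits that stay near the saddle for a long time leave close to the unstable manifold of a
nearby field. -/
theorem exists_passage {F₀ : Plane → Plane} {φ₀ : ℝ → Plane → Plane}
    (h₀ : IsSaddleField u v lam F₀) (hφ₀ : IsFlow F₀ φ₀) {E : Plane}
    (hE : Tendsto (fun t => φ₀ t E) atBot (𝓝 0)) {ρ : ℝ} (hρ : 0 < ρ) :
    ∃ T > 0, ∃ ε > 0, ∀ F φ S, IsFlow F φ → (∀ x, dist (F x) (F₀ x) ≤ ε) → ‖S‖ ≤ ε → ∀ q,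
      |u (q - S)| ≤ v E → v (φ T q - S) = v E → dist (φ T q) E < ρ := by
  have hl := h₀.pos
  obtain ⟨C, hC, hnorm⟩ := h₀.exists_norm_le
  obtain ⟨M, hM⟩ := hφ₀.lipschitz
  -- K bounds the initial separation in u between q and the reference point: v E for q relative to
  -- S, and one ‖u‖ each for S and for φ₀(-T) E, both in the closed unit ball.
  set K := |v E| + ‖u‖ + ‖u‖ with hK
  set η := ρ / (8 * C) with hη
  have hη0 : 0 < η := by positivity
  have hexp : Tendsto (fun T : ℝ => K ^ 2 * Real.exp (-(lam / 4 * T))) atTop (𝓝 0) := by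
    have h1 : Tendsto (fun T : ℝ => Real.exp (-(lam / 4 * T))) atTop (𝓝 0) :=
      Real.tendsto_exp_neg_atTop_nhds_zero.comp (tendsto_id.const_mul_atTop (by positivity))
    simpa using h1.const_mul (K ^ 2)
  have hEball : ∀ᶠ T : ℝ in atTop, φ₀ (-T) E ∈ Metric.ball (0 : Plane) 1 :=
    (hE.comp tendsto_neg_atTop_atBot).eventually (Metric.ball_mem_nhds _ one_pos)
  obtain ⟨T, ⟨hT1, hT2⟩, hT0⟩ := ((hEball.and
    (hexp.eventually (gt_mem_nhds (by positivity : 0 < η ^ 2)))).and (eventually_gt_atTop 0)).exists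
  set δ := min (ρ / 4) (η / (2 * (‖v‖ + 1))) with hδ
  have hδ0 : 0 < δ := by positivity
  obtain ⟨s, hs0, hsδ, hsb⟩ := exists_gronwallBound_lt M T hδ0
  refine ⟨T, hT0, min s 1, by positivity, fun F φ S hφ hF hS q hu hv => ?_⟩
  have hSs : ‖S‖ ≤ s := hS.trans (min_le_left _ _)
  have hS1 : ‖S‖ ≤ 1 := hS.trans (min_le_right _ _)
  have hd1 : dist (φ T q) (φ₀ T q) < δ := by
    refine (hφ.dist_le hM (fun x => (hF x).trans (min_le_left _ _)) (γ := fun t => φ₀ t q)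
      (hφ₀.hasDerivAt q) (x := q) (δ := s) (by rw [hφ₀.zero, dist_self]; exact hs0.le)
      ⟨hT0.le, le_rfl⟩).trans_lt hsb
  -- The reference orbit arrives at E at time T, when the difference of the v-coordinates is small.
  -- A large difference in u at that time would have been exponentially larger at time 0, against
  -- the bound K.
  have hp := h₀.conePair_sub hφ₀ q (φ₀ (-T) E)
  have hend : φ₀ T (φ₀ (-T) E) = E := by rw [← hφ₀.add, add_neg_cancel, hφ₀.zero]
  have hL : ∀ (L : Plane →L[ℝ] ℝ) (w : Plane), |L w| ≤ ‖L‖ * ‖w‖ := fun L w => L.le_opNorm w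
  have hg : |v (φ₀ T q - E)| ≤ η := by
    have e : v (φ₀ T q - E) = v (φ₀ T q - φ T q) + v S := by
      simp only [map_sub] at hv ⊢; linarith
    rw [e]
    have h1 := hL v (φ₀ T q - φ T q)
    have h2 := hL v S
    rw [← dist_eq_norm, dist_comm] at h1
    have h3 : ‖v‖ * dist (φ T q) (φ₀ T q) ≤ ‖v‖ * δ := by gcongr
    have h4 : ‖v‖ * ‖S‖ ≤ ‖v‖ * δ := by gcongr; exact hSs.trans hsδ
    have h5 : (‖v‖ + 1) * δ ≤ η / 2 := by
      have : δ ≤ η / (2 * (‖v‖ + 1)) := min_le_right _ _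
      calc (‖v‖ + 1) * δ ≤ (‖v‖ + 1) * (η / (2 * (‖v‖ + 1))) := by gcongr
        _ = η / 2 := by field_simp
    linarith [abs_add_le (v (φ₀ T q - φ T q)) (v S)]
  have hf0 : |u (q - φ₀ (-T) E)| ≤ K := by
    have e : u (q - φ₀ (-T) E) = u (q - S) + (u S - u (φ₀ (-T) E)) := by
      simp only [map_sub]; ring
    rw [e]
    have h1 := hL u S
    have h2 := hL u (φ₀ (-T) E)
    have h3 : ‖u‖ * ‖S‖ ≤ ‖u‖ * 1 := by gcongr
    have h4 : ‖u‖ * ‖φ₀ (-T) E‖ ≤ ‖u‖ * 1 := by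
      gcongr; exact (mem_ball_zero_iff.1 hT1).le
    have := abs_add_le (u (q - S)) (u S - u (φ₀ (-T) E))
    have := abs_sub (u S) (u (φ₀ (-T) E))
    have := le_abs_self (v E)
    rw [hK]
    linarith
  have hf : |u (φ₀ T q - E)| ≤ 2 * η := by
    have h1 := hp.neg_form_le (a := 0) (b := T) hT0.le
    simp only [hend, hφ₀.zero, sub_zero] at h1
    have h2 : (u (q - φ₀ (-T) E) ^ 2 - v (q - φ₀ (-T) E) ^ 2) * Real.exp (-(lam / 4 * T)) ≤
        K ^ 2 * Real.exp (-(lam / 4 * T)) := by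
      gcongr
      have := sq_le_sq' (by linarith [(abs_le.1 hf0).1]) (abs_le.1 hf0).2
      linarith [sq_nonneg (v (q - φ₀ (-T) E))]
    have h3 := sq_le_sq' (by linarith [(abs_le.1 hg).1]) (abs_le.1 hg).2
    have h4 : u (φ₀ T q - E) ^ 2 ≤ (2 * η) ^ 2 := by nlinarith [sq_nonneg η]
    exact abs_le_of_sq_le_sq h4 (by positivity)
  have h5 : dist (φ₀ T q) E ≤ 3 / 8 * ρ := by
    rw [dist_eq_norm]
    refine (hnorm _).trans ?_
    calc C * (|u (φ₀ T q - E)| + |v (φ₀ T q - E)|) ≤ C * (2 * η + η) := by gcongr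
      _ = 3 / 8 * ρ := by rw [hη]; field_simp; ring
  have h6 : δ ≤ ρ / 4 := min_le_left _ _
  linarith [dist_triangle (φ T q) (φ₀ T q) E]

/-- Orbits that start close to the equilibrium need a long time to leave. -/
theorem _root_.IsFlow.dist_zero_le (hφ : IsFlow F φ) {M : NNReal} (hM : LipschitzWith M F)
    {S q : Plane} (hS : F S = 0) {t : ℝ} (ht : 0 ≤ t) :
    dist (φ t q) S ≤ dist q S * Real.exp (M * t) := by
  have := hφ.dist_le hM (ε := 0) (δ := dist q S) (T := t) (fun x => (dist_self _).le)
    (γ := fun _ => S) (fun t => by rw [hS]; exact hasDerivAt_const t S) (x := q) le_rfl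
    ⟨ht, le_rfl⟩
  rwa [gronwallBound_ε0] at this

/-- Near a saddle of zero divergence the Jacobian of the flow is bounded independently of the time
spent there. -/
theorem flowJacobian_bounds (h : IsSaddleField u v lam F) (hφ : IsFlow F φ) {S q : Plane}
    (hS : F S = 0) (hq : q ≠ S) {t L R : ℝ} (ht : 0 ≤ t) (hL : 0 ≤ L)
    (hbox : ∀ s ∈ Icc 0 t, |u (φ s q - S)| ≤ R ∧ |v (φ s q - S)| ≤ R)
    (hdiv : ∀ s ∈ Icc 0 t, |planeDiv F (φ s q)| ≤ L * (|u (φ s q - S)| + |v (φ s q - S)|)) :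
    Real.exp (-(16 * L * R / lam)) ≤ flowJacobian φ q t ∧
      flowJacobian φ q t ≤ Real.exp (16 * L * R / lam) := by
  have hl := h.pos
  have hp := h.conePair_zero hφ hS q
  obtain ⟨Ψ, Ψ', hΨ⟩ := hp.exists_clock (s := Icc 0 t) (fun s _ => by
    by_contra hc
    push Not at hc
    have h2 := h.eq_zero hc.1 hc.2
    have := hφ.add (-s) s q
    rw [neg_add_cancel, hφ.zero, sub_eq_zero.1 h2, hφ.orbit_of_zero hS] at this
    exact hq this)
  have hb := linear_ode_bounds (J := flowJacobian φ q) (d := fun s => planeDiv F (φ s q))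
    (Ψ := fun s => 4 * L / lam * Ψ s) (Ψ' := fun s => 4 * L / lam * Ψ' s) ht
    (fun s _ => hφ.hasDerivAt_flowJacobian q s) (fun s hs => (hΨ s hs).1.const_mul _)
    (fun s hs => (hdiv s hs).trans (by
      calc L * (|u (φ s q - S)| + |v (φ s q - S)|)
          = 4 * L / lam * (lam / 4 * (|u (φ s q - S)| + |v (φ s q - S)|)) := by field_simp
        _ ≤ _ := mul_le_mul_of_nonneg_left (hΨ s hs).2.1 (by positivity)))
    (by rw [hφ.flowJacobian_zero]; exact one_pos)
  rw [hφ.flowJacobian_zero, one_mul, one_mul, ← mul_sub] at hb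
  have hΨR : ∀ s ∈ Icc 0 t, |Ψ s| ≤ 2 * R := fun s hs =>
    (hΨ s hs).2.2.trans (by linarith [(hbox s hs).1, (hbox s hs).2])
  have h1 := hΨR 0 (left_mem_Icc.2 ht)
  have h2 := hΨR t (right_mem_Icc.2 ht)
  have h3 : 4 * L / lam * (Ψ t - Ψ 0) ≤ 16 * L * R / lam := by
    calc 4 * L / lam * (Ψ t - Ψ 0) ≤ 4 * L / lam * (4 * R) := by
          gcongr; linarith [(abs_le.1 h1).1, (abs_le.1 h2).2]
      _ = _ := by ring
  exact ⟨(Real.exp_le_exp.2 (neg_le_neg h3)).trans hb.1, hb.2.trans (Real.exp_le_exp.2 h3)⟩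

end IsSaddleField

/-! ### Consequences of the C² linearization: zero divergence and the diagonal normal form. -/

/-- A field that is `C²`-conjugate near `S` to an affine saddle of ratio one has zero divergence
at `S`. -/
theorem IsResonantLinearizableAt.planeDiv_eq_zero {X : Plane → Plane} {S : Plane}
    (h : IsResonantLinearizableAt X S) (hX : DifferentiableAt ℝ X S) : planeDiv X S = 0 := by
  obtain ⟨a, b, w, ψ, ha, hb, hw, hψw, hψ, hψ', hconj, -⟩ := h
  have hsrc : ψ.source ∈ 𝓝 w := ψ.open_source.mem_nhds hw
  have hψd : DifferentiableAt ℝ ψ w := (hψ.contDiffAt hsrc).differentiableAt two_ne_zero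
  have hSt : S ∈ ψ.target := hψw ▸ ψ.map_source hw
  have hψsd : DifferentiableAt ℝ ψ.symm S :=
    (hψ'.contDiffAt (ψ.open_target.mem_nhds hSt)).differentiableAt two_ne_zero
  have hψ2 : DifferentiableAt ℝ (fderiv ℝ ψ) w :=
    ((hψ.contDiffAt hsrc).fderiv_right (m := 1) (by norm_num)).differentiableAt one_ne_zero
  set B := fderiv ℝ ψ w with hB
  set A : Plane →L[ℝ] Plane :=
    (a • ContinuousLinearMap.snd ℝ ℝ ℝ).prod (b • ContinuousLinearMap.fst ℝ ℝ ℝ) with hA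
  have hWA : ∀ q, affineSaddle a b w q = A (q - w) := fun q => by simp [affineSaddle, hA]
  have hW : HasFDerivAt (affineSaddle a b w) A w := by
    have h1 : HasFDerivAt (fun q => A (q - w)) (A ∘L .id ℝ Plane) w :=
      A.hasFDerivAt.comp w ((hasFDerivAt_id w).sub_const w)
    rw [ContinuousLinearMap.comp_id] at h1
    exact h1.congr_of_eventuallyEq (Filter.Eventually.of_forall hWA)
  have h1 := hψ2.hasFDerivAt.clm_apply hW
  have h2 : HasFDerivAt (fun q => X (ψ q)) (fderiv ℝ X S ∘L B) w := by
    have h3 : HasFDerivAt X (fderiv ℝ X S) (ψ w) := by rw [hψw]; exact hX.hasFDerivAt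
    exact h3.comp w hψd.hasFDerivAt
  have h4 := h2.congr_of_eventuallyEq (mem_of_superset hsrc fun q hq => hconj q hq)
  -- The conjugacy relation is differentiated at w. The term with the second derivative of ψ
  -- vanishes because W(w) = 0, so DX(S) is linearly conjugate to A, which has trace zero.
  have hLB : ∀ x, fderiv ℝ X S (B x) = B (A x) := by
    intro x
    have := DFunLike.congr_fun (h4.unique h1) x
    simpa [hWA w] using this
  have hdet : areaForm (B (1, 0)) (B (0, 1)) ≠ 0 := by
    intro h0
    have h5 : HasFDerivAt (fun q => ψ.symm (ψ q)) (fderiv ℝ ψ.symm S ∘L B) w := by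
      have h3 : HasFDerivAt ψ.symm (fderiv ℝ ψ.symm S) (ψ w) := by
        rw [hψw]; exact hψsd.hasFDerivAt
      exact h3.comp w hψd.hasFDerivAt
    have h6 := h5.unique ((hasFDerivAt_id w).congr_of_eventuallyEq
      (mem_of_superset hsrc fun q hq => ψ.left_inv hq))
    have h7 : ∀ x, fderiv ℝ ψ.symm S (B x) = x := fun x => DFunLike.congr_fun h6 x
    have h8 := areaForm_map (fderiv ℝ ψ.symm S) (B (1, 0)) (B (0, 1))
    rw [h7, h7, h0, mul_zero] at h8
    simp [areaForm] at h8
  have h9 := areaForm_add_areaForm (fderiv ℝ X S) (B (1, 0)) (B (0, 1))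
  have h10 : A (1, 0) = (0, b) := by simp [hA]
  have h11 : A (0, 1) = (a, 0) := by simp [hA]
  rw [hLB, hLB, h10, h11, areaForm_map B (0, b) (0, 1), areaForm_map B (1, 0) (a, 0)] at h9
  have h12 : planeDiv X S * areaForm (B (1, 0)) (B (0, 1)) = 0 := by
    rw [planeDiv, ← h9]; simp [areaForm]
  exact (mul_eq_zero.1 h12).resolve_right hdet

/-- `Θ` conjugates, on the square of radius `ρ`, the linear saddle with eigenvalues `∓ κ` to `F`. -/
structure IsNormalForm (F : Plane → Plane) (S : Plane) (κ ρ : ℝ) (Θ Ξ : Plane → Plane)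
    (W : Set Plane) : Prop where
  κ_pos : 0 < κ
  ρ_pos : 0 < ρ
  isOpen : IsOpen W
  map_zero : Θ 0 = S
  contDiffOn : ContDiffOn ℝ 2 Θ (Metric.ball 0 ρ)
  contDiffOn_inv : ContDiffOn ℝ 2 Ξ W
  mapsTo : ∀ z ∈ Metric.ball 0 ρ, Θ z ∈ W
  left_inv : ∀ z ∈ Metric.ball 0 ρ, Ξ (Θ z) = z
  right_inv : ∀ q ∈ W, Θ (Ξ q) = q
  conj : ∀ z ∈ Metric.ball 0 ρ, fderiv ℝ Θ z (-(κ * z.1), κ * z.2) = F (Θ z)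

/-- A has eigenvectors (√a, -√b) and (√a, √b) with eigenvalues ∓√(ab), and P diagonalizes it. The
target of ψ is cut down so that the inverse takes values in the ball and the image lies in G. -/
theorem IsResonantLinearizableAt.exists_isNormalForm {X F : Plane → Plane} {S : Plane}
    (h : IsResonantLinearizableAt X S) {G : Set Plane} (hG : G ∈ 𝓝 S) (hXF : EqOn X F G) :
    ∃ κ ρ Θ Ξ W, IsNormalForm F S κ ρ Θ Ξ W ∧ W ⊆ G := by
  obtain ⟨a, b, w, ψ, ha, hb, hw, hψw, hψ, hψ', hconj, -⟩ := h
  have hSt : S ∈ ψ.target := hψw ▸ ψ.map_source hw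
  set α := √a
  set β := √b
  have hα : 0 < α := Real.sqrt_pos.2 ha
  have hβ : 0 < β := Real.sqrt_pos.2 hb
  have hαa : α * α = a := Real.mul_self_sqrt ha.le
  have hβb : β * β = b := Real.mul_self_sqrt hb.le
  set P : Plane →L[ℝ] Plane :=
    (α • (ContinuousLinearMap.fst ℝ ℝ ℝ + ContinuousLinearMap.snd ℝ ℝ ℝ)).prod
      (β • (ContinuousLinearMap.snd ℝ ℝ ℝ - ContinuousLinearMap.fst ℝ ℝ ℝ)) with hP
  have hPz : ∀ z, P z = (α * (z.1 + z.2), β * (z.2 - z.1)) := fun z => by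
    simp [hP, mul_add, mul_sub]
  set Q : Plane → Plane := fun q => ((q.1 / α - q.2 / β) / 2, (q.1 / α + q.2 / β) / 2) with hQ
  have hQP : ∀ z, Q (P z) = z := fun z => by
    rw [hPz]; ext <;> simp only [hQ] <;> field_simp <;> ring
  have hPQ : ∀ q, P (Q q) = q := fun q => by
    rw [hPz]; ext <;> simp only [hQ] <;> field_simp <;> ring
  have hQc : ContDiff ℝ 2 Q := by
    have h1 : ContDiff ℝ 2 fun q : Plane => q.1 / α := contDiff_fst.div_const α
    have h2 : ContDiff ℝ 2 fun q : Plane => q.2 / β := contDiff_snd.div_const β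
    exact ((h1.sub h2).div_const 2).prodMk ((h1.add h2).div_const 2)
  set Λ : Plane → Plane := fun z => w + P z with hΛ
  have hΛc : ContDiff ℝ 2 Λ := contDiff_const.add P.contDiff
  set Ξ : Plane → Plane := fun q => Q (ψ.symm q - w) with hΞ
  have hΞc : ContDiffOn ℝ 2 Ξ ψ.target := hQc.comp_contDiffOn (hψ'.sub contDiffOn_const)
  have hΛ0 : Λ 0 = w := by simp [hΛ]
  have hcont0 : ContinuousAt (fun z => ψ (Λ z)) 0 := by
    refine ContinuousAt.comp (g := ψ) ?_ hΛc.continuous.continuousAt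
    rw [hΛ0]; exact ψ.continuousAt hw
  obtain ⟨ρ, hρ, hball⟩ : ∃ ρ > 0, Metric.ball (0 : Plane) ρ ⊆
      {z | Λ z ∈ ψ.source ∧ ψ (Λ z) ∈ interior G} := by
    refine Metric.mem_nhds_iff.1 (Filter.inter_mem ?_ ?_)
    · exact hΛc.continuous.continuousAt (by rw [hΛ0]; exact ψ.open_source.mem_nhds hw)
    · refine hcont0.preimage_mem_nhds (t := interior G) ?_
      rw [hΛ0, hψw]
      exact isOpen_interior.mem_nhds (mem_interior_iff_mem_nhds.2 hG)
  have hleft : ∀ z ∈ Metric.ball (0 : Plane) ρ, Ξ (ψ (Λ z)) = z := fun z hz => by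
    simp only [hΞ]
    rw [ψ.left_inv (hball hz).1]
    simp only [hΛ, add_sub_cancel_left, hQP]
  have hΛQ : ∀ q, Λ (Ξ q) = ψ.symm q := fun q => by simp [hΛ, hΞ, hPQ]
  have hright : ∀ q ∈ ψ.target, ψ (Λ (Ξ q)) = q := fun q hq => by rw [hΛQ, ψ.right_inv hq]
  refine ⟨α * β, ρ, fun z => ψ (Λ z), Ξ, ψ.target ∩ Ξ ⁻¹' Metric.ball 0 ρ, ⟨by positivity, hρ,
    hΞc.continuousOn.isOpen_inter_preimage ψ.open_target Metric.isOpen_ball, by simp only [hΛ0, hψw],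
    hψ.comp hΛc.contDiffOn fun z hz => (hball hz).1, hΞc.mono inter_subset_left, fun z hz =>
    ⟨ψ.map_source (hball hz).1, by rw [mem_preimage, hleft z hz]; exact hz⟩, hleft,
    fun q hq => hright q hq.1, fun z hz => ?_⟩, fun q hq => ?_⟩
  · have hs := (hball hz).1
    have h1 : HasFDerivAt Λ P z := P.hasFDerivAt.const_add w
    have h2 : HasFDerivAt ψ (fderiv ℝ ψ (Λ z)) (Λ z) :=
      ((hψ.contDiffAt (ψ.open_source.mem_nhds hs)).differentiableAt two_ne_zero).hasFDerivAt
    have h3 : HasFDerivAt (fun z => ψ (Λ z)) (fderiv ℝ ψ (Λ z) ∘L P) z := h2.comp z h1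
    rw [h3.fderiv, ContinuousLinearMap.comp_apply, ← hXF (interior_subset (hball hz).2),
      ← hconj _ hs]
    congr 1
    rw [hPz]
    simp only [affineSaddle, hΛ, Prod.fst_add, Prod.snd_add, add_sub_cancel_left, hPz, ← hαa, ← hβb]
    ext <;> simp only <;> ring
  · have := (hball hq.2).2
    simp only [hright q hq.1] at this
    exact interior_subset this

namespace IsNormalForm

variable {F : Plane → Plane} {φ : ℝ → Plane → Plane} {S : Plane} {κ ρ : ℝ} {Θ Ξ : Plane → Plane}
  {W : Set Plane}

theorem _root_.mem_ball_plane {z : Plane} {ρ : ℝ} :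
    z ∈ Metric.ball (0 : Plane) ρ ↔ |z.1| < ρ ∧ |z.2| < ρ := by
  rw [mem_ball_zero_iff, Prod.norm_def, max_lt_iff]; rfl

/-- The flow in the normal form. -/
theorem flow_eq (h : IsNormalForm F S κ ρ Θ Ξ W) (hφ : IsFlow F φ) {z : Plane} {T : ℝ} (hT : 0 ≤ T)
    (h1 : |z.1| < ρ) (h2 : |z.2| * Real.exp (κ * T) < ρ) :
    φ T (Θ z) = Θ (z.1 * Real.exp (-(κ * T)), z.2 * Real.exp (κ * T)) := by
  have hκ := h.κ_pos
  set l : ℝ → Plane := fun t => (z.1 * Real.exp (-(κ * t)), z.2 * Real.exp (κ * t)) with hl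
  have hmem : ∀ t ∈ Icc 0 T, l t ∈ Metric.ball 0 ρ := by
    intro t ht
    rw [mem_ball_plane]
    simp only [hl, abs_mul, Real.abs_exp]
    have h3 : 0 ≤ κ * t := mul_nonneg hκ.le ht.1
    constructor
    · exact (mul_le_of_le_one_right (abs_nonneg _) (Real.exp_le_one_iff.2 (by linarith))).trans_lt h1
    · refine lt_of_le_of_lt ?_ h2
      gcongr
      exact ht.2
  have hder : ∀ t, HasDerivAt l (-(κ * (l t).1), κ * (l t).2) t := by
    intro t
    have h3 : HasDerivAt (fun t : ℝ => κ * t) κ t := by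
      simpa using (hasDerivAt_id t).const_mul κ
    refine ((h3.neg.exp.const_mul z.1).prodMk (h3.exp.const_mul z.2)).congr_deriv ?_
    simp only [hl]
    ext <;> simp <;> ring
  have hcurve : IsIntegralCurveOn (fun t => Θ (l t)) (fun _ => F) (Icc 0 T) := by
    intro t ht
    have h3 : HasFDerivAt Θ (fderiv ℝ Θ (l t)) (l t) :=
      ((h.contDiffOn.contDiffAt (Metric.isOpen_ball.mem_nhds (hmem t ht))).differentiableAt
        two_ne_zero).hasFDerivAt
    have h4 := h3.comp_hasDerivAt t (hder t)
    rw [h.conj _ (hmem t ht)] at h4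
    exact h4.hasDerivWithinAt
  have := hφ.eq_of_isIntegralCurveOn hcurve (right_mem_Icc.2 hT)
  simp only [sub_zero, hl, mul_zero, neg_zero, Real.exp_zero, mul_one] at this
  exact this.symm

theorem contDiffAt (h : IsNormalForm F S κ ρ Θ Ξ W) {z : Plane} (hz : z ∈ Metric.ball 0 ρ) :
    ContDiffAt ℝ 2 Θ z := h.contDiffOn.contDiffAt (Metric.isOpen_ball.mem_nhds hz)

theorem tendsto_stable (h : IsNormalForm F S κ ρ Θ Ξ W) (hφ : IsFlow F φ) {ξ : ℝ} (hξ : |ξ| < ρ) :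
    Tendsto (fun t => φ t (Θ (ξ, 0))) atTop (𝓝 S) := by
  have h0 : (0 : Plane) ∈ Metric.ball (0 : Plane) ρ := Metric.mem_ball_self h.ρ_pos
  have h1 : Tendsto (fun t : ℝ => Θ (ξ * Real.exp (-(κ * t)), 0)) atTop (𝓝 S) := by
    rw [← h.map_zero]
    refine (h.contDiffAt h0).continuousAt.tendsto.comp ?_
    refine Tendsto.prodMk_nhds ?_ tendsto_const_nhds
    simpa using (Real.tendsto_exp_neg_atTop_nhds_zero.comp
      (tendsto_id.const_mul_atTop h.κ_pos)).const_mul ξ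
  refine h1.congr' ?_
  filter_upwards [eventually_ge_atTop 0] with t ht
  have := h.flow_eq hφ (z := (ξ, 0)) ht hξ (by simpa using h.ρ_pos)
  simpa using this.symm

theorem tendsto_unstable (h : IsNormalForm F S κ ρ Θ Ξ W) (hφ : IsFlow F φ) {ζ : ℝ} (hζ : |ζ| < ρ) :
    Tendsto (fun t => φ t (Θ (0, ζ))) atBot (𝓝 S) := by
  have h0 : (0 : Plane) ∈ Metric.ball (0 : Plane) ρ := Metric.mem_ball_self h.ρ_pos
  have h1 : Tendsto (fun t : ℝ => Θ (0, ζ * Real.exp (κ * t))) atBot (𝓝 S) := by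
    rw [← h.map_zero]
    refine (h.contDiffAt h0).continuousAt.tendsto.comp ?_
    refine Tendsto.prodMk_nhds tendsto_const_nhds ?_
    simpa using (Real.tendsto_exp_atBot.comp
      (tendsto_id.const_mul_atBot h.κ_pos)).const_mul ζ
  refine h1.congr' ?_
  filter_upwards [eventually_le_atBot 0] with t ht
  have hexp : Real.exp (κ * t) * Real.exp (κ * -t) = 1 := by
    rw [← Real.exp_add]; simp
  have := h.flow_eq hφ (z := (0, ζ * Real.exp (κ * t))) (T := -t) (by linarith)
    (by simpa using h.ρ_pos) (by
      simp only
      rw [abs_mul, Real.abs_exp, mul_assoc, hexp, mul_one]; exact hζ)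
  simp only [zero_mul, mul_assoc, hexp, mul_one] at this
  rw [← this, ← hφ.add, add_neg_cancel, hφ.zero]

end IsNormalForm

/-! ### Passage through the saddle in the normal form, up to the stable manifold. -/

namespace IsSaddleField

variable {u v : Plane →L[ℝ] ℝ} {lam : ℝ} {F : Plane → Plane} {φ : ℝ → Plane → Plane} {S : Plane}
  {κ ρ : ℝ} {Θ Ξ : Plane → Plane} {W : Set Plane}

/-- Two points of the stable manifold with the same u coincide, by the stable cone. So u is
injective and continuous along the stable axis, hence strictly monotone, and it is negative on one
side of its zero. -/
theorem exists_lower_stable (h : IsSaddleField u v lam F) (hφ : IsFlow F φ)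
    (hn : IsNormalForm F S κ ρ Θ Ξ W) : ∃ ξ, |ξ| < ρ ∧ u (Θ (ξ, 0) - S) < 0 := by
  have hρ := hn.ρ_pos
  have hmem : ∀ ξ ∈ Icc (-(ρ / 2)) (ρ / 2), |ξ| < ρ := fun ξ hξ =>
    abs_lt.2 ⟨by linarith [hξ.1], by linarith [hξ.2]⟩
  have hball : ∀ ξ ∈ Icc (-(ρ / 2)) (ρ / 2), ((ξ, 0) : Plane) ∈ Metric.ball (0 : Plane) ρ :=
    fun ξ hξ => mem_ball_plane.2 ⟨hmem ξ hξ, by simpa using hρ⟩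
  set g : ℝ → ℝ := fun ξ => u (Θ (ξ, 0) - S) with hg
  have hgc : ContinuousOn g (Icc (-(ρ / 2)) (ρ / 2)) := by
    intro ξ hξ
    have h1 : ContinuousAt (fun ξ : ℝ => Θ (ξ, 0)) ξ :=
      ContinuousAt.comp (g := Θ) (hn.contDiffAt (hball ξ hξ)).continuousAt (by fun_prop)
    exact (u.continuous.continuousAt.comp (h1.sub continuousAt_const)).continuousWithinAt
  have hinj : InjOn g (Icc (-(ρ / 2)) (ρ / 2)) := by
    intro x hx y hy hxy
    have h0 : ∀ L : Plane →L[ℝ] ℝ, Tendsto (fun t => L (φ t (Θ (x, 0)) - φ t (Θ (y, 0)))) atTop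
        (𝓝 0) := fun L => by
      have := (L.continuous.tendsto _).comp ((hn.tendsto_stable hφ (hmem x hx)).sub
        (hn.tendsto_stable hφ (hmem y hy)))
      rwa [sub_self, map_zero] at this
    have h1 := (h.conePair_sub hφ (Θ (x, 0)) (Θ (y, 0))).stable_of_tendsto (h0 u) (h0 v) 0
    rw [hφ.zero, hφ.zero] at h1
    have h2 : u (Θ (x, 0) - Θ (y, 0)) = 0 := by
      simp only [hg, map_sub] at hxy ⊢; linarith
    rw [h2, abs_zero, zero_div] at h1
    have h3 := h.eq_zero h2 (abs_eq_zero.1 (le_antisymm h1 (abs_nonneg _)))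
    have h4 := congrArg Ξ (sub_eq_zero.1 h3)
    rw [hn.left_inv _ (hball x hx), hn.left_inv _ (hball y hy)] at h4
    exact congrArg Prod.fst h4
  have h0 : g 0 = 0 := by
    have : ((0 : ℝ), (0 : ℝ)) = (0 : Plane) := rfl
    simp [hg, this, hn.map_zero]
  have m1 : -(ρ / 2) ∈ Icc (-(ρ / 2)) (ρ / 2) := ⟨le_rfl, by linarith⟩
  have m2 : ρ / 2 ∈ Icc (-(ρ / 2)) (ρ / 2) := ⟨by linarith, le_rfl⟩
  have m0 : (0 : ℝ) ∈ Icc (-(ρ / 2)) (ρ / 2) := ⟨by linarith, by linarith⟩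
  rcases hgc.strictMonoOn_of_injOn_Icc' (by linarith) hinj with hm | hm
  · refine ⟨-(ρ / 2), hmem _ m1, ?_⟩
    have := hm m1 m0 (by linarith)
    rw [h0] at this
    exact this
  · refine ⟨ρ / 2, hmem _ m2, ?_⟩
    have := hm m0 m2 (by linarith)
    rw [h0] at this
    exact this

/-- If the orbit of `(a, 0)` is on the stable manifold, the points to its right are carried by the
flow onto a `C²` curve that starts on the unstable manifold. -/
theorem exists_exit_curve (h : IsSaddleField u v lam F) (hφ : IsFlow F φ)
    (hS : F S = 0) (hn : IsNormalForm F S κ ρ Θ Ξ W) {a s ξ r : ℝ} (hs : 0 ≤ s) (hξ : |ξ| < ρ)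
    (ha : φ s (a, 0) = Θ (ξ, 0)) (hW : ∀ q ∈ W, |v (q - S)| < r)
    (hright : ∀ᶠ x in 𝓝[>] a, ∀ t, 0 ≤ t → -r ≤ v (φ t (x, 0) - S)) :
    ∃ m : ℝ → Plane, ContDiffAt ℝ 2 m a ∧ Tendsto (fun t => φ t (m a)) atBot (𝓝 S) ∧
      v (m a - S) = r ∧ ∀ᶠ x in 𝓝[>] a, ∃ t, 0 ≤ t ∧ φ t (x, 0) = m x := by
  have hl := h.pos
  have hκ := hn.κ_pos
  have hρ := hn.ρ_pos
  have hsplit : ∀ t p, φ t (φ s p) = φ (t + s) p := fun t p => (hφ.add t s p).symm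
  have hball : ((ξ, 0) : Plane) ∈ Metric.ball (0 : Plane) ρ :=
    mem_ball_plane.2 ⟨hξ, by simpa using hρ⟩
  have hconv : ∀ p, ∀ ξ, |ξ| < ρ → φ s p = Θ (ξ, 0) → Tendsto (fun t => φ t p) atTop (𝓝 S) := by
    intro p ξ hξ hp
    have h1 := hn.tendsto_stable hφ hξ
    rw [← hp] at h1
    simp only [hsplit] at h1
    have h2 := h1.comp (tendsto_atTop_add_const_right atTop (-s) tendsto_id)
    refine h2.congr fun t => ?_
    simp
  set z : ℝ → Plane := fun x => Ξ (φ s (x, 0)) with hz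
  have hΞW : ContDiffAt ℝ 2 Ξ (φ s (a, 0)) := by
    rw [ha]
    exact hn.contDiffOn_inv.contDiffAt (hn.isOpen.mem_nhds (hn.mapsTo _ hball))
  have hline : ContDiffAt ℝ 2 (fun x : ℝ => φ s (x, 0)) a :=
    (hφ.contDiff_map s).contDiffAt.comp a (contDiffAt_id.prodMk contDiffAt_const)
  have hzc : ContDiffAt ℝ 2 z a := hΞW.comp a hline
  have hza : z a = (ξ, 0) := by simp only [hz]; rw [ha, hn.left_inv _ hball]
  have hev : ∀ᶠ x in 𝓝 a, φ s (x, 0) ∈ W ∧ |(z x).1| < ρ ∧ |(z x).2| < ρ / 2 ∧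
      ContinuousAt z x := by
    have hWn : W ∈ 𝓝 (φ s (a, 0)) := by rw [ha]; exact hn.isOpen.mem_nhds (hn.mapsTo _ hball)
    have h1 : ∀ᶠ x in 𝓝 a, |(z x).1| < ρ :=
      (continuous_abs.continuousAt.comp (continuous_fst.continuousAt.comp hzc.continuousAt)).eventually
        (gt_mem_nhds (by simpa [hza] using hξ))
    have h2 : ∀ᶠ x in 𝓝 a, |(z x).2| < ρ / 2 :=
      (continuous_abs.continuousAt.comp (continuous_snd.continuousAt.comp hzc.continuousAt)).eventually
        (gt_mem_nhds (by simpa [hza] using hρ))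
    have h3 : ∀ᶠ x in 𝓝 a, ContinuousAt z x := by
      filter_upwards [(hzc.of_le (by norm_num : (1 : WithTop ℕ∞) ≤ 2)).eventually (by simp)] with x hx
        using hx.continuousAt
    filter_upwards [hline.continuousAt.eventually hWn, h1, h2, h3] with x a1 a2 a3 a4
      using ⟨a1, a2, a3, a4⟩
  obtain ⟨δ, hδ, hδs⟩ : ∃ δ > a, ∀ x ∈ Ioo a δ, (φ s (x, 0) ∈ W ∧ |(z x).1| < ρ ∧
      |(z x).2| < ρ / 2 ∧ ContinuousAt z x) ∧ ∀ t, 0 ≤ t → -r ≤ v (φ t (x, 0) - S) := by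
    obtain ⟨δ, hδ, h1⟩ := mem_nhdsGT_iff_exists_Ioo_subset.1
      ((hev.filter_mono nhdsWithin_le_nhds).and hright)
    exact ⟨δ, hδ, fun x hx => h1 hx⟩
  -- A zero would put (x, 0) on the stable manifold, which a horizontal line meets at most once.
  have hne : ∀ x ∈ Ioo a δ, (z x).2 ≠ 0 := by
    intro x hx h0
    have h1 : φ s (x, 0) = Θ ((z x).1, 0) := by
      have : ((z x).1, 0) = z x := Prod.ext rfl h0.symm
      rw [this]; exact (hn.right_inv _ (hδs x hx).1.1).symm
    have := h.horizontal_unique hφ (hconv _ _ hξ ha) (hconv _ _ (hδs x hx).1.2.1 h1)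
    exact absurd this hx.1.ne
  obtain ⟨σ, hσ, hσpos⟩ : ∃ σ : ℝ, |σ| = 1 ∧ ∀ x ∈ Ioo a δ, 0 < σ * (z x).2 := by
    have hcont : ContinuousOn (fun x => (z x).2) (Ioo a δ) := fun x hx =>
      (continuous_snd.continuousAt.comp (hδs x hx).1.2.2.2).continuousWithinAt
    by_cases hall : ∀ x ∈ Ioo a δ, 0 < (z x).2
    · exact ⟨1, abs_one, fun x hx => by simpa using hall x hx⟩
    · refine ⟨-1, by simp, fun x hx => ?_⟩
      push Not at hall
      obtain ⟨y, hy, hy0⟩ := hall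
      by_contra hc
      have hsub : uIcc y x ⊆ Ioo a δ := OrdConnected.uIcc_subset inferInstance hy hx
      obtain ⟨p, hp, hp0⟩ := intermediate_value_uIcc (hcont.mono hsub)
        (show (0 : ℝ) ∈ uIcc _ _ from mem_uIcc.2 (Or.inl ⟨hy0, by linarith⟩))
      exact hne p (hsub hp) hp0
  have hσ2 : σ * σ = 1 := by rw [← abs_mul_abs_self, hσ, one_mul]
  set ζ₀ := σ * (ρ / 2) with hζ₀
  have hζabs : |ζ₀| = ρ / 2 := by rw [hζ₀, abs_mul, hσ, one_mul, abs_of_pos (by positivity)]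
  have hζne : ζ₀ ≠ 0 := by rw [← abs_pos, hζabs]; positivity
  have hball0 : ((0, ζ₀) : Plane) ∈ Metric.ball (0 : Plane) ρ :=
    mem_ball_plane.2 ⟨by simpa using hρ, by simp only; rw [hζabs]; linarith⟩
  -- Because the eigenvalues are opposite, z₁z₂ is constant along orbits and the crossing of z₂ = ζ₀
  -- is known without the transit time. This keeps the curve C² at x = a, where the time blows up.
  set m₀ : ℝ → Plane := fun x => Θ ((z x).1 * (z x).2 / ζ₀, ζ₀) with hm₀
  have hm₀a : m₀ a = Θ (0, ζ₀) := by simp [hm₀, hza]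
  have hm₀c : ContDiffAt ℝ 2 m₀ a := by
    refine ContDiffAt.comp (g := Θ) a ?_ (((hzc.fst.mul hzc.snd).div_const ζ₀).prodMk
      contDiffAt_const)
    have : ((z a).1 * (z a).2 / ζ₀, ζ₀) = (0, ζ₀) := by rw [hza]; simp
    rw [this]
    exact hn.contDiffAt hball0
  have hreach : ∀ x ∈ Ioo a δ, ∃ t, 0 ≤ t ∧ φ t (x, 0) = m₀ x := by
    intro x hx
    obtain ⟨⟨hxW, hx1, hx2, -⟩, -⟩ := hδs x hx
    have hp := hσpos x hx
    have habs : |(z x).2| = σ * (z x).2 := by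
      rw [← one_mul |(z x).2|, ← hσ, ← abs_mul, abs_of_pos hp]
    have hratio : 1 ≤ ρ / 2 / (σ * (z x).2) := by
      rw [one_le_div hp, ← habs]; exact hx2.le
    set T := Real.log (ρ / 2 / (σ * (z x).2)) / κ with hT
    have hT0 : 0 ≤ T := div_nonneg (Real.log_nonneg hratio) hκ.le
    have hexp : Real.exp (κ * T) = ρ / 2 / (σ * (z x).2) := by
      rw [hT, mul_div_cancel₀ _ hκ.ne', Real.exp_log (by linarith)]
    have hz2 : (z x).2 ≠ 0 := hne x hx
    have hσne : σ ≠ 0 := by rintro rfl; simp at hσ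
    have h1 := hn.flow_eq hφ (z := z x) hT0 hx1 (by
      rw [hexp, habs, mul_div_cancel₀ _ hp.ne']; linarith)
    rw [hn.right_inv _ hxW, hsplit] at h1
    refine ⟨T + s, by linarith, h1.trans ?_⟩
    simp only [hm₀]
    rw [Real.exp_neg, hexp, hζ₀]
    congr 2
    · field_simp
      rw [sq, hσ2, mul_one]
    · have : σ⁻¹ = σ := inv_eq_of_mul_eq_one_left hσ2
      field_simp
      linarith
  have hun := hn.tendsto_unstable hφ (ζ := ζ₀) (by rw [hζabs]; linarith)
  have hcone := h.unstable_cone hφ hS hun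
  have hp := h.conePair_zero hφ hS (Θ (0, ζ₀))
  have hv0 : v (Θ (0, ζ₀) - S) ≠ 0 := by
    intro h0
    have h1 := hcone 0
    rw [hφ.zero, h0, abs_zero, zero_div] at h1
    have h2 := h.eq_zero (abs_eq_zero.1 (le_antisymm h1 (abs_nonneg _))) h0
    have h3 := congrArg Ξ ((sub_eq_zero.1 h2).trans hn.map_zero.symm)
    rw [hn.left_inv _ hball0, hn.left_inv _ (Metric.mem_ball_self hρ)] at h3
    exact hζne (congrArg Prod.snd h3)
  have hgrow : ∀ w : ℝ, 0 < w → ∃ t ≥ 0, r < w * Real.exp (lam / 2 * (t - 0)) := by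
    intro w hw
    have : Tendsto (fun t => w * Real.exp (lam / 2 * (t - 0))) atTop atTop := by
      refine Tendsto.const_mul_atTop hw (Real.tendsto_exp_atTop.comp ?_)
      simpa using tendsto_id.const_mul_atTop (by positivity : 0 < lam / 2)
    obtain ⟨t, h1, h2⟩ := ((this.eventually_gt_atTop r).and (eventually_ge_atTop 0)).exists
    exact ⟨t, h2, h1⟩
  have hcone0 : |u (φ 0 (Θ (0, ζ₀)) - S)| ≤ |v (φ 0 (Θ (0, ζ₀)) - S)| :=
    (hcone 0).trans (by linarith [abs_nonneg (v (φ 0 (Θ (0, ζ₀)) - S))])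
  -- On the other unstable branch, orbits from points just right of a would follow it to v < -r,
  -- which `hright` excludes.
  have hvpos : 0 < v (Θ (0, ζ₀) - S) := by
    by_contra hc
    have hneg : v (Θ (0, ζ₀) - S) < 0 := lt_of_le_of_ne (not_lt.1 hc) hv0
    obtain ⟨t, ht0, ht⟩ := hgrow (-v (Θ (0, ζ₀) - S)) (by linarith)
    have h1 := hp.neg.cone_le (s := 0) ht0 (by rw [hφ.zero]; linarith) (by
      rw [abs_neg]
      refine hcone0.trans_eq ?_
      rw [hφ.zero, abs_of_neg hneg])
    have h2 := h1.2
    rw [hφ.zero] at h2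
    have h3 : v (φ t (m₀ a) - S) < -r := by rw [hm₀a]; linarith
    have h4 : ContinuousAt (fun x => v (φ t (m₀ x) - S)) a :=
      v.continuous.continuousAt.comp
        (((hφ.continuous_map t).continuousAt.comp hm₀c.continuousAt).sub continuousAt_const)
    obtain ⟨x, hx1, hx2⟩ := (((h4.eventually (gt_mem_nhds h3)).filter_mono
      nhdsWithin_le_nhds).and (Ioo_mem_nhdsGT hδ)).exists
    obtain ⟨t', ht', heq⟩ := hreach x hx2
    rw [← heq, ← hφ.add] at hx1
    exact absurd ((hδs x hx2).2 (t + t') (by linarith)) (not_le.2 hx1)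
  obtain ⟨τ, hτ0, hτ⟩ : ∃ τ ≥ 0, v (φ τ (Θ (0, ζ₀)) - S) = r := by
    obtain ⟨t, ht0, ht⟩ := hgrow _ hvpos
    have h1 := (hp.cone_le (s := 0) ht0 (by rwa [hφ.zero]) (by
      refine hcone0.trans_eq ?_
      rw [hφ.zero, abs_of_pos hvpos])).2
    rw [hφ.zero] at h1
    have hc : Continuous fun t => v (φ t (Θ (0, ζ₀)) - S) :=
      v.continuous.comp ((hφ.continuous_orbit _).sub continuous_const)
    obtain ⟨τ, hτ, hτr⟩ := intermediate_value_Icc ht0 hc.continuousOn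
      (show r ∈ Icc _ _ from ⟨by
        rw [hφ.zero]; exact (abs_lt.1 (hW _ (hn.mapsTo _ hball0))).2.le, by linarith⟩)
    exact ⟨τ, hτ.1, hτr⟩
  refine ⟨fun x => φ τ (m₀ x), (hφ.contDiff_map τ).contDiffAt.comp a hm₀c, ?_, ?_, ?_⟩
  · have h1 := hun.comp (tendsto_atBot_add_const_right atBot τ tendsto_id)
    refine h1.congr fun t => ?_
    simp only [Function.comp_apply, id, hm₀a, hφ.add]
  · simp only [hm₀a]; exact hτ
  · filter_upwards [Ioo_mem_nhdsGT hδ] with x hx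
    obtain ⟨t, ht, heq⟩ := hreach x hx
    exact ⟨τ + t, by linarith, by rw [hφ.add, heq]⟩

end IsSaddleField

/-! ### C² closeness on balls, concatenation and uniqueness of arcs, uniform hitting maps. -/

/-- `X` is `ε`-close to `X₀` in the `C²` sense on the closed ball of radius `R`. -/
structure IsJetClose (R ε : ℝ) (X X₀ : Plane → Plane) : Prop where
  dist_le : ∀ q ∈ Metric.closedBall (0 : Plane) R, dist (X q) (X₀ q) ≤ ε
  fderiv_le : ∀ q ∈ Metric.closedBall (0 : Plane) R, ‖fderiv ℝ X q - fderiv ℝ X₀ q‖ ≤ ε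
  fderiv_fderiv_le : ∀ q ∈ Metric.closedBall (0 : Plane) R,
    ‖fderiv ℝ (fderiv ℝ X) q - fderiv ℝ (fderiv ℝ X₀) q‖ ≤ ε

theorem IsJetClose.mono {R R' ε ε' : ℝ} {X X₀ : Plane → Plane} (h : IsJetClose R ε X X₀)
    (hR : R' ≤ R) (hε : ε ≤ ε') : IsJetClose R' ε' X X₀ where
  dist_le q hq := (h.dist_le q (Metric.closedBall_subset_closedBall hR hq)).trans hε
  fderiv_le q hq := (h.fderiv_le q (Metric.closedBall_subset_closedBall hR hq)).trans hε
  fderiv_fderiv_le q hq :=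
    (h.fderiv_fderiv_le q (Metric.closedBall_subset_closedBall hR hq)).trans hε

theorem SmoothField.eventually_isJetClose {l : ℕ∞} (hl : 2 ≤ l) (X₀ : SmoothField l) (R : ℝ)
    {ε : ℝ} (hε : 0 < ε) : ∀ᶠ X in 𝓝 X₀, IsJetClose R ε X.1 X₀.1 := by
  have hjet : Continuous (SmoothField.jet (l := l)) := continuous_induced_dom
  have key : ∀ i : ℕ, (i : ℕ∞) ≤ l → ∀ᶠ X in 𝓝 X₀, ∀ q ∈ Metric.closedBall (0 : Plane) R,
      ‖iteratedFDeriv ℝ i (X.1 - X₀.1) q‖ ≤ ε := by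
    intro i hi
    have h1 : Tendsto (fun X : SmoothField l => SmoothField.jet X ⟨i, hi⟩) (𝓝 X₀)
        (𝓝 (SmoothField.jet X₀ ⟨i, hi⟩)) :=
      ((continuous_apply (⟨i, hi⟩ : {i : ℕ // (i : ℕ∞) ≤ l})).comp hjet).tendsto X₀
    rw [ContinuousMap.tendsto_iff_forall_isCompact_tendstoUniformlyOn] at h1
    have h2 := Metric.tendstoUniformlyOn_iff.1
      (h1 _ (isCompact_closedBall (0 : Plane) R)) ε hε
    filter_upwards [h2] with X hX q hq
    have hi' : ((i : ℕ∞) : WithTop ℕ∞) ≤ (l : WithTop ℕ∞) := by exact_mod_cast hi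
    rw [iteratedFDeriv_sub (X.2.of_le hi') (X₀.2.of_le hi'), Pi.sub_apply, ← dist_eq_norm,
      dist_comm]
    exact (hX q hq).le
  have hl1 : (1 : ℕ∞) ≤ l := le_trans (by norm_num) hl
  filter_upwards [key 0 (by simp), key 1 (by exact_mod_cast hl1), key 2 (by exact_mod_cast hl)]
    with X h0 h1 h2
  have hlw : ((2 : ℕ∞) : WithTop ℕ∞) ≤ (l : WithTop ℕ∞) := WithTop.coe_le_coe.2 hl
  have hX : ContDiff ℝ 2 X.1 := X.2.of_le hlw
  have hX₀ : ContDiff ℝ 2 X₀.1 := X₀.2.of_le hlw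
  have hd : fderiv ℝ (X.1 - X₀.1) = fderiv ℝ X.1 - fderiv ℝ X₀.1 := by
    ext1 q
    exact fderiv_sub (hX.differentiable two_ne_zero q) (hX₀.differentiable two_ne_zero q)
  refine ⟨fun q hq => ?_, fun q hq => ?_, fun q hq => ?_⟩
  · simpa [dist_eq_norm] using h0 q hq
  · simpa [norm_iteratedFDeriv_one, hd] using h1 q hq
  · have h3 := h2 q hq
    rw [← norm_iteratedFDeriv_fderiv, norm_iteratedFDeriv_one, hd] at h3
    have hX' : ContDiff ℝ 1 (fderiv ℝ X.1) := hX.fderiv_right (by norm_num)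
    have hX₀' : ContDiff ℝ 1 (fderiv ℝ X₀.1) := hX₀.fderiv_right (by norm_num)
    rwa [fderiv_sub (hX'.differentiable one_ne_zero q)
      (hX₀'.differentiable one_ne_zero q)] at h3

theorem HasArc.trans {F : Plane → Plane} {D : Set Plane} {p q r : Plane} (h : HasArc F D p q)
    (hq : q ∈ D) (h' : HasArc F D q r) : HasArc F D p r := by
  obtain ⟨T, γ, hT, hγ, hγ0, hγT, hγD⟩ := h
  obtain ⟨T', γ', hT', hγ', hγ'0, hγ'T, hγ'D⟩ := h'
  have hright : ∀ t, T ≤ t → (if t ≤ T then γ t else γ' (t - T)) = γ' (t - T) := by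
    intro t ht
    split_ifs with h1
    · obtain rfl := le_antisymm h1 ht
      rw [sub_self, hγT, hγ'0]
    · rfl
  refine ⟨T + T', fun t => if t ≤ T then γ t else γ' (t - T), by positivity, ?_, by
    simp [hT.le, hγ0], (hright _ (by linarith)).trans (by simpa using hγ'T), ?_⟩
  · have h2 : ∀ t ∈ Icc T (T + T'), HasDerivWithinAt (fun t => γ' (t - T)) (F (γ' (t - T)))
        (Icc T (T + T')) t := by
      intro t ht
      have h3 := hγ' (t - T) ⟨by linarith [ht.1], by linarith [ht.2]⟩
      have h4 : HasDerivWithinAt (fun t : ℝ => t - T) 1 (Icc T (T + T')) t :=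
        ((hasDerivAt_id t).sub_const T).hasDerivWithinAt
      have h5 := h3.scomp t h4 (show MapsTo (fun t => t - T) (Icc T (T + T')) (Icc 0 T') from
        fun s hs => ⟨by linarith [hs.1], by linarith [hs.2]⟩)
      rw [one_smul] at h5
      exact h5
    intro t ht
    rw [← Icc_union_Icc_eq_Icc hT.le (show T ≤ T + T' by linarith)]
    simp only
    rcases lt_trichotomy t T with h1 | h1 | h1
    · rw [if_pos h1.le]
      have h3 : HasDerivWithinAt (fun t => if t ≤ T then γ t else γ' (t - T)) (F (γ t))
          (Icc 0 T) t :=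
        (hγ t ⟨ht.1, h1.le⟩).congr (fun s hs => if_pos hs.2) (if_pos h1.le)
      refine h3.mono_of_mem_nhdsWithin ?_
      filter_upwards [self_mem_nhdsWithin, mem_nhdsWithin_of_mem_nhds (Iio_mem_nhds h1)]
        with s hs hs1
      rcases hs with hs | hs
      · exact hs
      · exact absurd hs.1 (not_le.2 hs1)
    · subst h1
      rw [if_pos le_rfl]
      refine HasDerivWithinAt.union ?_ ?_
      · exact (hγ t ⟨hT.le, le_rfl⟩).congr (fun s hs => if_pos hs.2) (if_pos le_rfl)
      · have h3 := h2 t ⟨le_rfl, by linarith⟩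
        rw [sub_self, hγ'0, ← hγT] at h3
        exact h3.congr (fun s hs => hright s hs.1) (hright t le_rfl)
    · rw [if_neg (not_le.2 h1)]
      have h3 := (h2 t ⟨h1.le, ht.2⟩).congr (fun s hs => hright s hs.1) (hright t h1.le)
      refine h3.mono_of_mem_nhdsWithin ?_
      filter_upwards [self_mem_nhdsWithin, mem_nhdsWithin_of_mem_nhds (Ioi_mem_nhds h1)]
        with s hs hs1
      rcases hs with hs | hs
      · exact absurd hs.2 (not_le.2 hs1)
      · exact hs
  · intro t ht
    simp only
    rcases lt_trichotomy t T with h1 | h1 | h1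
    · rw [if_pos h1.le]
      exact hγD t ⟨ht.1, h1⟩
    · rw [if_pos h1.le, h1, hγT]
      exact hq
    · rw [if_neg (not_le.2 h1)]
      exact hγ'D _ ⟨by linarith, by linarith [ht.2]⟩

/-- An end point outside D is the first exit from D, and integral curves with the same start
coincide. -/
theorem HasArc.unique {F : Plane → Plane} (hF : ContDiff ℝ 1 F) {D : Set Plane} {p q q' : Plane}
    (h : HasArc F D p q) (hq : q ∉ D) (h' : HasArc F D p q') (hq' : q' ∉ D) : q = q' := by
  obtain ⟨T, γ, hT, hγ, hγ0, hγT, hγD⟩ := h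
  obtain ⟨T', γ', hT', hγ', hγ'0, hγ'T, hγ'D⟩ := h'
  rcases lt_trichotomy T T' with h1 | h1 | h1
  · have := integralCurveOn_eqOn hF hγ (hγ'.mono (Icc_subset_Icc_right h1.le))
      (hγ0.trans hγ'0.symm) (right_mem_Icc.2 hT.le)
    exact absurd (hγT ▸ this ▸ hγ'D T ⟨hT, h1⟩) hq
  · subst h1
    rw [← hγT, ← hγ'T]
    exact integralCurveOn_eqOn hF hγ hγ' (hγ0.trans hγ'0.symm) (right_mem_Icc.2 hT.le)
  · have := integralCurveOn_eqOn hF (hγ.mono (Icc_subset_Icc_right h1.le)) hγ'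
      (hγ0.trans hγ'0.symm) (right_mem_Icc.2 hT'.le)
    exact absurd (hγ'T ▸ this ▸ hγD T' ⟨hT', h1⟩) hq'

theorem IsFirstReturn.unique {X Y : Plane → Plane} (hX : ContDiff ℝ 1 X) (hY : ContDiff ℝ 1 Y)
    {x x₁ x₂ : ℝ} (h₁ : IsFirstReturn X Y x x₁) (h₂ : IsFirstReturn X Y x x₂) : x₁ = x₂ := by
  obtain ⟨p, hp, -, hp'⟩ := h₁
  obtain ⟨q, hq, -, hq'⟩ := h₂
  have h1 : ((p, 0) : Plane) = (q, 0) :=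
    hp.unique hX (by simp [upperSide]) hq (by simp [upperSide])
  rw [h1] at hp'
  have h2 : ((x₁, 0) : Plane) = (x₂, 0) :=
    hp'.unique hY (by simp [lowerSide]) hq' (by simp [lowerSide])
  exact congrArg Prod.fst h2

theorem exists_cutoff {R : ℝ} (hR : 0 < R) : ∃ χ : Plane → ℝ, ContDiff ℝ 2 χ ∧
    (∀ q, χ q ∈ Icc (0 : ℝ) 1) ∧ (∀ q ∈ Metric.closedBall (0 : Plane) R, χ q = 1) ∧
    ∀ q ∉ Metric.closedBall (0 : Plane) (2 * R), χ q = 0 := by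
  let b : ContDiffBump (0 : Plane) := ⟨R, 2 * R, hR, by linarith⟩
  refine ⟨b, b.contDiff, fun q => ⟨b.nonneg, b.le_one⟩, fun q hq => b.one_of_mem_closedBall hq,
    fun q hq => b.zero_of_le_dist ?_⟩
  rw [Metric.mem_closedBall, not_le] at hq
  exact hq.le

theorem planeDiv_sub_le (F G : Plane → Plane) (p q : Plane) :
    |planeDiv F p - planeDiv G q| ≤ 2 * ‖fderiv ℝ F p - fderiv ℝ G q‖ := by
  have h1 := (fderiv ℝ F p - fderiv ℝ G q).le_opNorm (1, 0)
  have h2 := (fderiv ℝ F p - fderiv ℝ G q).le_opNorm (0, 1)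
  have h3 := (norm_fst_le _).trans h1
  have h4 := (norm_snd_le _).trans h2
  simp [Prod.norm_def, Real.norm_eq_abs] at h3 h4
  have h5 := abs_add_le ((fderiv ℝ F p (1, 0)).1 - (fderiv ℝ G q (1, 0)).1)
    ((fderiv ℝ F p (0, 1)).2 - (fderiv ℝ G q (0, 1)).2)
  have h6 : planeDiv F p - planeDiv G q = ((fderiv ℝ F p (1, 0)).1 - (fderiv ℝ G q (1, 0)).1) +
    ((fderiv ℝ F p (0, 1)).2 - (fderiv ℝ G q (0, 1)).2) := by simp only [planeDiv]; ring
  rw [h6]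
  linarith

theorem planeDiv_congr {F G : Plane → Plane} {q : Plane} (h : F =ᶠ[𝓝 q] G) :
    planeDiv F q = planeDiv G q := by
  simp only [planeDiv, h.fderiv_eq]

/-- Near a trajectory arc that ends transversally on `Σ`, the hitting map of `Σ` is `C²`, and its
differential is controlled uniformly in the field. -/
theorem exists_arc_family {X₀ : Plane → Plane} (hX₀ : ContDiff ℝ 2 X₀) {γ : ℝ → Plane} {T σ : ℝ}
    (hT : 0 < T) (hσ : |σ| = 1) (hγ : IsIntegralCurveOn γ (fun _ => X₀) (Icc 0 T))
    (hD : ∀ t ∈ Ioo 0 T, 0 < σ * (γ t).2) (hend : (γ T).2 = 0) (hcross : σ * (X₀ (γ T)).2 < 0)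
    (hstart : 0 < σ * (γ 0).2 ∨ 0 < σ * (X₀ (γ 0)).2) {r : ℝ} (hr : 0 < r) :
    ∃ R > 0, ∃ ε > 0, ∃ ρ > 0, ∃ K > 0, ∀ X, ContDiff ℝ 2 X → IsJetClose R ε X X₀ →
      ∃ Q : Plane → ℝ, ∀ q ∈ Metric.ball (γ 0) ρ,
        (0 ≤ σ * q.2 → HasArc X {p | 0 < σ * p.2} q (Q q, 0)) ∧ dist (Q q, 0) (γ T) < r ∧
        ContDiffAt ℝ 2 Q q ∧ K⁻¹ ≤ -(σ * (X (Q q, 0)).2) ∧ -(σ * (X (Q q, 0)).2) ≤ K ∧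
        ∃ J, K⁻¹ ≤ J ∧ J ≤ K ∧
          ∀ w, fderiv ℝ Q q w * (X (Q q, 0)).2 = J * areaForm w (X q) := by
  have h0T : (0 : ℝ) ∈ Icc 0 T := left_mem_Icc.2 hT.le
  obtain ⟨R₁, hR₁⟩ : ∃ R₁, ∀ t ∈ Icc 0 T, ‖γ t‖ ≤ R₁ :=
    isCompact_Icc.exists_bound_of_continuousOn hγ.continuousOn
  have hR₁0 : 0 ≤ R₁ := (norm_nonneg _).trans (hR₁ 0 h0T)
  -- The reference orbit, prolonged slightly past T, has norm at most R₁ + 1 and perturbed orbits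
  -- stay within 1 of it, so they never leave the ball on which the cutoff equals 1.
  set R := R₁ + 3 with hR
  have hR0 : 0 < R := by linarith
  obtain ⟨χ, hχ, hχI, hχ1, hχ0⟩ := exists_cutoff hR0
  have hcut : ∀ X : Plane → Plane, ContDiff ℝ 2 X → ∃ M φ, LipschitzWith M (fun q => χ q • X q) ∧
      IsFlow (fun q => χ q • X q) φ := by
    intro X hX
    have h1 : ContDiff ℝ 2 fun q => χ q • X q := hχ.smul hX
    have h2 : HasCompactSupport fun q => χ q • X q :=
      HasCompactSupport.intro (isCompact_closedBall (0 : Plane) (2 * R)) fun q hq => by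
        rw [hχ0 q hq, zero_smul]
    obtain ⟨M, h3⟩ := h1.lipschitzWith_of_hasCompactSupport h2 two_ne_zero
    obtain ⟨φ, hφ⟩ := exists_isFlow h1 h3
    exact ⟨M, φ, h3, hφ⟩
  have hcutX : ∀ X : Plane → Plane, ∀ q ∈ Metric.closedBall (0 : Plane) R, χ q • X q = X q :=
    fun X q hq => by rw [hχ1 q hq, one_smul]
  obtain ⟨M, φ₀, hM, hφ₀⟩ := hcut X₀ hX₀
  have hγ₀ : ∀ t ∈ Icc 0 T, φ₀ t (γ 0) = γ t := by
    have h1 : IsIntegralCurveOn γ (fun _ q => χ q • X₀ q) (Icc 0 T) := fun t ht => by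
      have h2 := hγ t ht
      simp only
      rwa [hcutX X₀ (γ t) (by simpa using (hR₁ t ht).trans (by linarith))]
    intro t ht
    have := hφ₀.eq_of_isIntegralCurveOn h1 ht
    rw [sub_zero] at this
    exact this.symm
  have hγT := hγ₀ T (right_mem_Icc.2 hT.le)
  have hmem : ∀ t ∈ Icc 0 T, γ t ∈ Metric.closedBall (0 : Plane) R := fun t ht => by
    simpa using (hR₁ t ht).trans (by linarith)
  obtain ⟨η, hη, hη'⟩ : ∃ η > 0, ∀ t ∈ Icc T (T + η), ‖φ₀ t (γ 0)‖ < R₁ + 1 := by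
    have h1 : ∀ᶠ t in 𝓝 T, ‖φ₀ t (γ 0)‖ < R₁ + 1 := by
      refine (hφ₀.continuous_orbit (γ 0)).norm.continuousAt.eventually (gt_mem_nhds ?_)
      simp only [hγT]
      linarith [hR₁ T (right_mem_Icc.2 hT.le)]
    obtain ⟨δ, hδ, h2⟩ := Metric.eventually_nhds_iff.1 h1
    refine ⟨δ / 2, half_pos hδ, fun t ht => h2 ?_⟩
    rw [Real.dist_eq, abs_of_nonneg (by linarith [ht.1])]
    linarith [ht.2]
  set r' := min r (min η 1) with hr'
  have hr'0 : 0 < r' := by positivity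
  have hr'r : r' ≤ r := min_le_left _ _
  have hr'η : r' ≤ η := (min_le_right _ _).trans (min_le_left _ _)
  have hr'1 : r' ≤ 1 := (min_le_right _ _).trans (min_le_right _ _)
  obtain ⟨ε, hε, ρ, hρ, htr⟩ := exists_transit hM (γ := fun t => φ₀ t (γ 0))
    (hφ₀.hasDerivAt (γ 0)) hT hσ (fun t ht => by
      rw [hγ₀ t (Ioo_subset_Icc_self ht)]; exact hD t ht)
    (by rw [hγT]; exact hend)
    (by rw [hγT, hcutX _ _ (hmem T (right_mem_Icc.2 hT.le))]; exact hcross)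
    (by rw [hφ₀.zero, hcutX _ _ (hmem 0 h0T)]; exact hstart) hr'0
  rw [hφ₀.zero] at htr
  obtain ⟨K₁, hK₁⟩ : ∃ K₁, ∀ q ∈ Metric.closedBall (0 : Plane) R, ‖X₀ q‖ ≤ K₁ :=
    (isCompact_closedBall _ _).exists_bound_of_continuousOn hX₀.continuous.continuousOn
  obtain ⟨K₂, hK₂⟩ : ∃ K₂, ∀ q ∈ Metric.closedBall (0 : Plane) R, |planeDiv X₀ q| ≤ K₂ := by
    refine (isCompact_closedBall _ _).exists_bound_of_continuousOn (f := planeDiv X₀) ?_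
    have := hX₀.continuous_fderiv two_ne_zero
    unfold planeDiv
    fun_prop
  have hK₂0 : 0 ≤ K₂ := (abs_nonneg _).trans (hK₂ 0 (by simpa using hR0.le))
  set m := -(σ * (X₀ (γ T)).2) with hm
  have hm0 : 0 < m := by linarith
  -- A bound for the integral of |div X| along a perturbed arc: C¹ closeness 1 changes the
  -- divergence by at most 2, and the arrival time is at most T + 1.
  set d := (K₂ + 2) * (T + 1) with hd
  set K := max (Real.exp d) (max (2 / m) (K₁ + 1)) with hK
  have hK0 : 0 < K := (Real.exp_pos d).trans_le (le_max_left _ _)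
  have hKd : Real.exp d ≤ K := le_max_left _ _
  have hKm : 2 / m ≤ K := (le_max_left _ _).trans (le_max_right _ _)
  have hK1 : K₁ + 1 ≤ K := (le_max_right _ _).trans (le_max_right _ _)
  refine ⟨2 * R, by positivity, min ε 1, by positivity, ρ, hρ, K, hK0, fun X hX hXX₀ => ?_⟩
  obtain ⟨-, φ, -, hφ⟩ := hcut X hX
  obtain ⟨τ, hτ⟩ := htr _ φ hφ fun q => by
    rw [dist_eq_norm, ← smul_sub, norm_smul]
    by_cases hq : q ∈ Metric.closedBall (0 : Plane) (2 * R)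
    · have h1 := hXX₀.dist_le q hq
      rw [dist_eq_norm] at h1
      have h2 : ‖χ q‖ ≤ 1 := by
        rw [Real.norm_eq_abs, abs_of_nonneg (hχI q).1]; exact (hχI q).2
      calc ‖χ q‖ * ‖X q - X₀ q‖ ≤ 1 * ‖X q - X₀ q‖ := by gcongr
        _ ≤ ε := by rw [one_mul]; exact h1.trans (min_le_left _ _)
    · rw [hχ0 q hq]; simpa using hε.le
  have hpath : ∀ q ∈ Metric.ball (γ 0) ρ, ∀ t ∈ Icc 0 (τ q), φ t q ∈ Metric.ball (0 : Plane) R := by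
    intro q hq t ht
    obtain ⟨⟨-, -, h1⟩, -, -, -, h2, -⟩ := hτ q hq
    have h3 := h2 t ht
    have h4 : ‖φ₀ t (γ 0)‖ ≤ R₁ + 1 := by
      rcases le_total t T with h5 | h5
      · rw [hγ₀ t ⟨ht.1, h5⟩]; linarith [hR₁ t ⟨ht.1, h5⟩]
      · exact (hη' t ⟨h5, by linarith [ht.2]⟩).le
    rw [mem_ball_zero_iff]
    have h5 := norm_le_norm_add_norm_sub' (φ t q) (φ₀ t (γ 0))
    rw [dist_eq_norm] at h3
    linarith
  have hcl : ∀ {q}, q ∈ Metric.ball (0 : Plane) R → q ∈ Metric.closedBall (0 : Plane) R :=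
    fun h => Metric.ball_subset_closedBall h
  have hRR : Metric.closedBall (0 : Plane) R ⊆ Metric.closedBall 0 (2 * R) :=
    Metric.closedBall_subset_closedBall (by linarith)
  refine ⟨fun q => (φ (τ q) q).1, fun q hq => ?_⟩
  obtain ⟨⟨hτ0, hτ1, -⟩, hz, hdist, hvel, -, hpos, hτc⟩ := hτ q hq
  have hQ : (((φ (τ q) q).1, 0) : Plane) = φ (τ q) q := Prod.ext rfl hz.symm
  have hz' : ∀ᶠ q' in 𝓝 q, (φ (τ q') q').2 = 0 := by
    filter_upwards [Metric.isOpen_ball.mem_nhds hq] with q' hq' using (hτ q' hq').2.1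
  obtain ⟨hQc, hQd⟩ := hφ.hasFDerivAt_hittingMap hτc hz'
  have hqR := hcl (hpath q hq 0 ⟨le_rfl, hτ0.le⟩)
  rw [hφ.zero] at hqR
  have hendR := hpath q hq (τ q) ⟨hτ0.le, le_rfl⟩
  rw [hcutX X _ (hcl hendR)] at hvel
  simp only [hγT, hcutX X₀ _ (hmem T (right_mem_Icc.2 hT.le))] at hvel hdist
  rw [hcutX X _ (hcl hendR), hcutX X _ hqR] at hQd
  simp only [hQ]
  have hJ := linear_ode_bounds (J := flowJacobian φ q) (Ψ := fun t => (K₂ + 2) * t) hτ0.le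
    (fun t _ => hφ.hasDerivAt_flowJacobian q t)
    (fun t _ => by simpa using (hasDerivAt_id t).const_mul (K₂ + 2)) (fun t ht => by
      have h1 := hpath q hq t ht
      rw [planeDiv_congr (G := X) (by
        filter_upwards [Metric.isOpen_ball.mem_nhds h1] with p hp using hcutX X p (hcl hp))]
      have h2 := planeDiv_sub_le X X₀ (φ t q) (φ t q)
      have h3 := (hXX₀.fderiv_le (φ t q) (hRR (hcl h1))).trans (min_le_right _ _)
      have h4 := hK₂ (φ t q) (hcl h1)
      have h5 := abs_sub_abs_le_abs_sub (planeDiv X (φ t q)) (planeDiv X₀ (φ t q))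
      linarith) (by rw [hφ.flowJacobian_zero]; norm_num)
  rw [hφ.flowJacobian_zero, one_mul, one_mul, mul_zero, sub_zero] at hJ
  have hdle : (K₂ + 2) * τ q ≤ d := by
    rw [hd]; gcongr
  have hKinv : K⁻¹ ≤ Real.exp (-d) := by
    rw [Real.exp_neg]; exact inv_anti₀ (Real.exp_pos d) hKd
  refine ⟨fun hq0 => ⟨τ q, fun t => φ t q, hτ0, fun t ht => ?_, hφ.zero q, rfl, hpos hq0⟩,
    hdist.trans_le hr'r, hQc, ?_, ?_, flowJacobian φ q (τ q),
    hKinv.trans ((Real.exp_le_exp.2 (by linarith)).trans hJ.1),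
    hJ.2.trans ((Real.exp_le_exp.2 hdle).trans hKd), hQd⟩
  · have := hφ.isIntegralCurveOn q (Icc 0 (τ q)) t ht
    simp only at this
    rwa [hcutX X _ (hcl (hpath q hq t ht))] at this
  · have h1 : K⁻¹ ≤ m / 2 := by
      rw [← inv_div]; exact inv_anti₀ (by positivity) hKm
    linarith
  · have h1 : |σ * (X (φ (τ q) q)).2| ≤ ‖X (φ (τ q) q)‖ := by
      rw [abs_mul, hσ, one_mul]; exact norm_snd_le (X (φ (τ q) q))
    have h2 := hXX₀.dist_le _ (hRR (hcl hendR))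
    rw [dist_eq_norm] at h2
    have h3 := norm_le_norm_add_norm_sub' (X (φ (τ q) q)) (X₀ (φ (τ q) q))
    have h4 := hK₁ _ (hcl hendR)
    have h5 := neg_abs_le (σ * (X (φ (τ q) q)).2)
    linarith [min_le_right ε 1]

/-! ### Linear algebra of saddles, cutoffs, and persistence of the equilibrium. -/

/-- The determinant of a linear map of the plane. -/
noncomputable def planeDet (L : Plane →L[ℝ] Plane) : ℝ := areaForm (L (1, 0)) (L (0, 1))

theorem IsHyperbolicSaddle.planeDet_neg {X : Plane → Plane} {S : Plane}
    (h : IsHyperbolicSaddle X S) : planeDet (fderiv ℝ X S) < 0 := by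
  obtain ⟨-, lam, mu, hl, hm, h1, h2⟩ := h
  obtain ⟨e, he⟩ := h1.exists_hasEigenvector
  obtain ⟨f, hf⟩ := h2.exists_hasEigenvector
  have he' : fderiv ℝ X S e = lam • e := he.apply_eq_smul
  have hf' : fderiv ℝ X S f = mu • f := hf.apply_eq_smul
  have hdep : ∀ s t : ℝ, s • f = t • e → s = 0 := by
    intro s t hst
    have h3 := congrArg (fderiv ℝ X S) hst
    rw [map_smul, map_smul, he', hf', smul_comm, smul_comm t lam, ← hst, ← sub_eq_zero,
      ← sub_smul, smul_smul] at h3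
    have h4 := (smul_eq_zero.1 h3).resolve_right hf.2
    exact (mul_eq_zero.1 h4).resolve_left (by linarith)
  have hne : areaForm e f ≠ 0 := by
    intro h0
    rw [areaForm] at h0
    have h3 := hdep e.1 f.1 (by ext <;> simp <;> linarith)
    have h4 := hdep e.2 f.2 (by ext <;> simp <;> linarith)
    exact he.2 (Prod.ext h3 h4)
  have h5 := areaForm_map (fderiv ℝ X S) e f
  rw [he', hf'] at h5
  have h6 : areaForm (lam • e) (mu • f) = lam * mu * areaForm e f := by
    simp [areaForm]; ring
  rw [h6] at h5
  rw [planeDet, ← mul_right_cancel₀ hne h5]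
  exact mul_neg_of_neg_of_pos hl hm

/-- Each row of L - k gives a candidate kernel vector, and the other row kills it by the
characteristic equation. Both candidates vanish only for L = k · id, whose determinant is not
negative. -/
theorem hasEigenvalue_of_charpoly {L : Plane →L[ℝ] Plane} {k : ℝ}
    (hk : k ^ 2 - ((L (1, 0)).1 + (L (0, 1)).2) * k + planeDet L = 0) (hL : planeDet L < 0) :
    Module.End.HasEigenvalue (L : Plane →ₗ[ℝ] Plane) k := by
  rw [planeDet, areaForm] at hk hL
  have key : ∀ e : Plane, e ≠ 0 → L e = k • e →
      Module.End.HasEigenvalue (L : Plane →ₗ[ℝ] Plane) k := fun e he h =>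
    Module.End.hasEigenvalue_of_hasEigenvector ⟨Module.End.mem_eigenspace_iff.2 h, he⟩
  by_cases h1 : (((L (0, 1)).1, k - (L (1, 0)).1) : Plane) = 0
  · by_cases h2 : ((k - (L (0, 1)).2, (L (1, 0)).2) : Plane) = 0
    · simp only [Prod.mk_eq_zero] at h1 h2
      rw [h1.1, h2.2, ← sub_eq_zero.1 h1.2, ← sub_eq_zero.1 h2.1] at hL
      nlinarith [sq_nonneg k]
    · refine key _ h2 ?_
      rw [plane_clm_apply]
      ext
      · simp; linarith
      · simp; ring
  · refine key _ h1 ?_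
    rw [plane_clm_apply]
    ext
    · simp; ring
    · simp; linarith

theorem isHyperbolicSaddle_of_planeDet_neg {X : Plane → Plane} {S : Plane} (hS : X S = 0)
    (h : planeDet (fderiv ℝ X S) < 0) : IsHyperbolicSaddle X S := by
  set L := fderiv ℝ X S
  set t := (L (1, 0)).1 + (L (0, 1)).2 with ht
  have hd : 0 ≤ t ^ 2 - 4 * planeDet L := by nlinarith [sq_nonneg t]
  set s := √(t ^ 2 - 4 * planeDet L) with hs
  have hs2 : s ^ 2 = t ^ 2 - 4 * planeDet L := Real.sq_sqrt hd
  have hts : |t| < s := Real.lt_sqrt_of_sq_lt (by rw [sq_abs]; linarith)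
  have h1 := abs_lt.1 hts
  refine ⟨hS, (t - s) / 2, (t + s) / 2, by linarith, by linarith, hasEigenvalue_of_charpoly ?_ h,
    hasEigenvalue_of_charpoly ?_ h⟩ <;> rw [← ht] <;> nlinarith

/-- Trace zero makes the eigenvalues ∓ lam with lam² = -det L. The functionals u and v are the
corresponding left eigenvectors, scaled so that their sum is the height. -/
theorem exists_saddle_coordinates {L : Plane →L[ℝ] Plane} (hL : planeDet L < 0)
    (ht : (L (1, 0)).1 + (L (0, 1)).2 = 0) (hc : 0 < (L (1, 0)).2) :
    ∃ (u v : Plane →L[ℝ] ℝ) (lam : ℝ), 0 < lam ∧ (∀ q, u q + v q = q.2) ∧ 0 < v (1, 0) ∧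
      (∀ q, u (L q) = -(lam * u q)) ∧ ∀ q, v (L q) = lam * v q := by
  set p := (L (1, 0)).1
  set c := (L (1, 0)).2
  set b := (L (0, 1)).1
  have hd : (L (0, 1)).2 = -p := by linarith
  have hdet : 0 < p ^ 2 + b * c := by
    rw [planeDet, areaForm, hd] at hL; linarith
  set lam := √(p ^ 2 + b * c) with hlam
  have hlam0 : 0 < lam := Real.sqrt_pos.2 hdet
  have hlam2 : lam * lam = p ^ 2 + b * c := Real.mul_self_sqrt hdet.le
  refine ⟨((lam + p) / (2 * lam)) • .snd ℝ ℝ ℝ - (c / (2 * lam)) • .fst ℝ ℝ ℝ,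
    ((lam - p) / (2 * lam)) • .snd ℝ ℝ ℝ + (c / (2 * lam)) • .fst ℝ ℝ ℝ, lam, hlam0, fun q => ?_,
    ?_, fun q => ?_, fun q => ?_⟩
  · simp; field_simp; ring
  · simp; positivity
  · rw [plane_clm_apply, hd]
    simp
    field_simp
    linear_combination q.2 * hlam2
  · rw [plane_clm_apply, hd]
    simp
    field_simp
    linear_combination -q.2 * hlam2

/-- Sliding on the left gives Yh > 0, so crossing on the right gives Xh > 0 there and the slope of
Xh along Σ is nonnegative. A zero slope would make (1, 0) an eigenvector, against transversality of
the invariant manifolds. -/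
theorem HasDegenerateCycle.deriv_height_pos {X Y : Plane → Plane} (h : HasDegenerateCycle X Y)
    (hXY : SlidingLeftCrossingRight X Y) (hX : DifferentiableAt ℝ X 0) (hY : Continuous Y) :
    0 < (Y 0).2 ∧ 0 < (fderiv ℝ X 0 (1, 0)).2 := by
  have hYc : ContinuousAt (fun x : ℝ => (Y (x, 0)).2) 0 := by fun_prop
  have hY0 : 0 < (Y 0).2 := by
    refine lt_of_le_of_ne ?_ h.regular.symm
    refine ge_of_tendsto (hYc.tendsto.mono_left (nhdsWithin_le_nhds (s := Iio 0))) ?_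
    filter_upwards [hXY.1] with x hx using hx.2.2.le
  refine ⟨hY0, lt_of_le_of_ne ?_ fun h0 => ?_⟩
  · have hline : HasDerivAt (fun x : ℝ => ((x, 0) : Plane)) (1, 0) 0 :=
      (hasDerivAt_id (0 : ℝ)).prodMk (hasDerivAt_const 0 0)
    have h1 : HasDerivAt (fun x : ℝ => (X (x, 0)).2) (fderiv ℝ X 0 (1, 0)).2 0 :=
      hasDerivAt_clm_comp (.snd ℝ ℝ ℝ) (HasFDerivAt.comp_hasDerivAt (0 : ℝ) (f := fun x : ℝ =>
        ((x, 0) : Plane)) (l := X) hX.hasFDerivAt hline)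
    have h2 := h1.tendsto_slope_zero_right
    refine ge_of_tendsto h2 ?_
    filter_upwards [hXY.2, self_mem_nhdsWithin,
      nhdsWithin_le_nhds (hYc.eventually (lt_mem_nhds hY0))] with x hx hx0 hYx
    have h3 : (X ((0 : ℝ), (0 : ℝ))).2 = 0 := by
      have : X ((0 : ℝ), (0 : ℝ)) = 0 := h.saddle.1
      rw [this]; rfl
    have h4 : 0 < (X (x, 0)).2 := pos_of_mul_pos_left hx.2 hYx.le
    have hx0' : 0 < x := hx0
    rw [zero_add, h3, sub_zero, smul_eq_mul]
    positivity
  · refine h.manifolds_transversal (fderiv ℝ X 0 (1, 0)).1 (1, 0)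
      ⟨Module.End.mem_eigenspace_iff.2 ?_, by simp⟩ rfl
    ext
    · simp
    · simpa using h0.symm

theorem continuous_planeDet : Continuous planeDet := by
  unfold planeDet areaForm
  fun_prop

theorem exists_right_inverse {L : Plane →L[ℝ] Plane} (hL : planeDet L ≠ 0) :
    ∃ N : Plane →L[ℝ] Plane, (∀ q, L (N q) = q) ∧ ∀ q, N (L q) = q := by
  rw [planeDet, areaForm] at hL
  set δ := (L (1, 0)).1 * (L (0, 1)).2 - (L (1, 0)).2 * (L (0, 1)).1
  refine ⟨δ⁻¹ • (((L (0, 1)).2 • ContinuousLinearMap.fst ℝ ℝ ℝ -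
    (L (0, 1)).1 • ContinuousLinearMap.snd ℝ ℝ ℝ).prod ((L (1, 0)).1 •
      ContinuousLinearMap.snd ℝ ℝ ℝ - (L (1, 0)).2 • ContinuousLinearMap.fst ℝ ℝ ℝ)),
    fun q => ?_, fun q => ?_⟩
  · rw [plane_clm_apply]
    ext <;> simp <;> field_simp <;> ring
  · rw [plane_clm_apply L q]
    ext <;> simp <;> field_simp <;> ring

/-- Interpolation between `X`, where `χ = 1`, and the linear field `D`, where `χ = 0`. -/
def cutoffField (χ : Plane → ℝ) (D : Plane →L[ℝ] Plane) (X : Plane → Plane) (q : Plane) : Plane :=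
  D q + χ q • (X q - D q)

/-- `χ` is a `C²` bump function on the ball of radius `2 r` that is `1` on the ball of radius `r`. -/
structure IsCutoff (χ : Plane → ℝ) (r : ℝ) : Prop where
  contDiff : ContDiff ℝ 2 χ
  mem_Icc : ∀ q, χ q ∈ Icc (0 : ℝ) 1
  eq_one : ∀ q ∈ Metric.closedBall (0 : Plane) r, χ q = 1
  eq_zero : ∀ q ∉ Metric.closedBall (0 : Plane) (2 * r), χ q = 0

namespace IsCutoff

variable {χ : Plane → ℝ} {r : ℝ} {D : Plane →L[ℝ] Plane} {X X₀ : Plane → Plane}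

theorem cutoffField_eq (h : IsCutoff χ r) {q : Plane} (hq : q ∈ Metric.closedBall (0 : Plane) r) :
    cutoffField χ D X q = X q := by
  rw [cutoffField, h.eq_one q hq, one_smul, add_sub_cancel]

theorem contDiff_cutoffField (h : IsCutoff χ r) (hX : ContDiff ℝ 2 X) :
    ContDiff ℝ 2 (cutoffField χ D X) :=
  D.contDiff.add (h.contDiff.smul (hX.sub D.contDiff))

theorem dist_cutoffField_le (h : IsCutoff χ r) {ε : ℝ} (hε : 0 ≤ ε)
    (hX : IsJetClose (2 * r) ε X X₀) (q : Plane) :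
    dist (cutoffField χ D X q) (cutoffField χ D X₀ q) ≤ ε := by
  rw [cutoffField, cutoffField, dist_add_left, dist_eq_norm, ← smul_sub, sub_sub_sub_cancel_right,
    norm_smul]
  by_cases hq : q ∈ Metric.closedBall (0 : Plane) (2 * r)
  · have h1 := hX.dist_le q hq
    rw [dist_eq_norm] at h1
    have h2 : ‖χ q‖ ≤ 1 := by
      rw [Real.norm_eq_abs, abs_of_nonneg (h.mem_Icc q).1]; exact (h.mem_Icc q).2
    calc ‖χ q‖ * ‖X q - X₀ q‖ ≤ 1 * ‖X q - X₀ q‖ := by gcongr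
      _ ≤ ε := by rw [one_mul]; exact h1
  · rw [h.eq_zero q hq]; simpa using hε

end IsCutoff

/-- A `C²` field that is close to `X₀` near its equilibrium `0` differs little, after a cutoff, from
the linearization of `X₀` there. -/
theorem exists_cutoffField {X₀ : Plane → Plane} (hX₀ : ContDiff ℝ 2 X₀) (h0 : X₀ 0 = 0)
    {κ : NNReal} (hκ : 0 < κ) : ∃ r > 0, ∃ χ, IsCutoff χ r ∧ ∃ ε > 0, ∀ X, ContDiff ℝ 2 X →
      IsJetClose (2 * r) ε X X₀ →
      LipschitzWith κ fun q => χ q • (X q - fderiv ℝ X₀ 0 q) := by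
  obtain ⟨b, hb, hbI, hb1, hb0⟩ := exists_cutoff one_pos
  obtain ⟨K, hK0, hK⟩ : ∃ K ≥ 0, ∀ q, ‖fderiv ℝ b q‖ ≤ K := by
    have h1 : HasCompactSupport b :=
      HasCompactSupport.intro (isCompact_closedBall (0 : Plane) (2 * 1)) hb0
    obtain ⟨K, hK⟩ := (hb.continuous_fderiv two_ne_zero).bounded_above_of_compact_support
      (h1.fderiv ℝ)
    exact ⟨K, (norm_nonneg _).trans (hK 0), hK⟩
  set D := fderiv ℝ X₀ 0
  -- In the derivative of χ g, the term with Dg costs 2η. The term with Dχ costs (K/r)(5ηr), in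
  -- which r cancels since g is of order r on the support. The total is κ.
  set η : ℝ := κ / (2 + 5 * K) with hη
  have hη0 : 0 < η := by positivity
  obtain ⟨r, hr, hrD⟩ : ∃ r > 0, ∀ q ∈ Metric.closedBall (0 : Plane) (2 * r),
      ‖fderiv ℝ X₀ q - D‖ ≤ η := by
    have h1 : ∀ᶠ q in 𝓝 (0 : Plane), ‖fderiv ℝ X₀ q - D‖ < η := by
      have h2 : Continuous fun q => ‖fderiv ℝ X₀ q - D‖ :=
        ((hX₀.continuous_fderiv two_ne_zero).sub continuous_const).norm
      exact h2.continuousAt.eventually (gt_mem_nhds (by simpa [D] using hη0))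
    obtain ⟨δ, hδ, h2⟩ := Metric.eventually_nhds_iff.1 h1
    refine ⟨δ / 4, by positivity, fun q hq => (h2 ?_).le⟩
    rw [Metric.mem_closedBall] at hq
    linarith
  refine ⟨r, hr, fun q => b (r⁻¹ • q), ⟨hb.comp (contDiff_const_smul r⁻¹), fun q => hbI _,
    fun q hq => hb1 _ ?_, fun q hq => hb0 _ ?_⟩, min η (η * r), by positivity, fun X hX hXX => ?_⟩
  · rw [mem_closedBall_zero_iff] at hq ⊢
    rw [norm_smul, norm_inv, Real.norm_of_nonneg hr.le, inv_mul_le_iff₀ hr]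
    linarith
  · rw [mem_closedBall_zero_iff] at hq ⊢
    rw [norm_smul, norm_inv, Real.norm_of_nonneg hr.le, inv_mul_le_iff₀ hr]
    linarith
  set χ : Plane → ℝ := fun q => b (r⁻¹ • q)
  have hχc : ContDiff ℝ 2 χ := hb.comp (contDiff_const_smul r⁻¹)
  have hχd : ∀ q, ‖fderiv ℝ χ q‖ ≤ K / r := by
    intro q
    have h1 : HasFDerivAt χ (fderiv ℝ b (r⁻¹ • q) ∘L (r⁻¹ • .id ℝ Plane)) q :=
      (hb.differentiable two_ne_zero (r⁻¹ • q)).hasFDerivAt.comp q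
        ((hasFDerivAt_id q).const_smul r⁻¹)
    rw [h1.fderiv, ContinuousLinearMap.comp_smul, ContinuousLinearMap.comp_id, norm_smul, norm_inv,
      Real.norm_of_nonneg hr.le, div_eq_inv_mul]
    gcongr
    exact hK _
  set g : Plane → Plane := fun q => X q - D q
  have hg : ContDiff ℝ 2 g := hX.sub D.contDiff
  have hgd : ∀ q ∈ Metric.closedBall (0 : Plane) (2 * r), ‖fderiv ℝ g q‖ ≤ 2 * η := by
    intro q hq
    have h1 : fderiv ℝ g q = fderiv ℝ X q - D :=
      ((hX.differentiable two_ne_zero q).hasFDerivAt.sub D.hasFDerivAt).fderiv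
    have h2 := (hXX.fderiv_le q hq).trans (min_le_left _ _)
    have h3 := norm_add_le (fderiv ℝ X q - fderiv ℝ X₀ q) (fderiv ℝ X₀ q - D)
    rw [sub_add_sub_cancel] at h3
    rw [h1]
    linarith [hrD q hq]
  have h0r : (0 : Plane) ∈ Metric.closedBall (0 : Plane) (2 * r) :=
    Metric.mem_closedBall_self (by positivity)
  have hg0 : ∀ q ∈ Metric.closedBall (0 : Plane) (2 * r), ‖g q‖ ≤ 5 * η * r := by
    intro q hq
    have h1 := (convex_closedBall (0 : Plane) (2 * r)).norm_image_sub_le_of_norm_fderiv_le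
      (f := g) (𝕜 := ℝ) (fun x _ => hg.differentiable two_ne_zero x) hgd h0r hq
    rw [sub_zero] at h1
    have h2 := (hXX.dist_le 0 h0r).trans (min_le_right _ _)
    rw [h0, dist_zero_right] at h2
    have h3 : g 0 = X 0 := by simp [g]
    rw [h3] at h1
    have h4 := norm_le_norm_add_norm_sub' (g q) (X 0)
    rw [mem_closedBall_zero_iff] at hq
    have h5 : 2 * η * ‖q‖ ≤ 2 * η * (2 * r) := by gcongr
    linarith
  refine lipschitzWith_of_nnnorm_fderiv_le (𝕜 := ℝ) ((hχc.smul hg).differentiable two_ne_zero)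
    fun q => ?_
  rw [← NNReal.coe_le_coe, coe_nnnorm]
  by_cases hq : q ∈ Metric.closedBall (0 : Plane) (2 * r)
  · have h1 := ((hχc.differentiable two_ne_zero q).hasFDerivAt.smul
      (hg.differentiable two_ne_zero q).hasFDerivAt).fderiv
    have h2 : fderiv ℝ (fun q => χ q • g q) q =
      χ q • fderiv ℝ g q + (fderiv ℝ χ q).smulRight (g q) := h1
    rw [h2]
    refine (norm_add_le _ _).trans ?_
    rw [norm_smul, ContinuousLinearMap.norm_smulRight_apply]
    have h3 : ‖χ q‖ ≤ 1 := by
      rw [Real.norm_eq_abs, abs_of_nonneg (hbI _).1]; exact (hbI _).2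
    have h4 : ‖χ q‖ * ‖fderiv ℝ g q‖ ≤ 1 * (2 * η) := by
      gcongr
      exact hgd q hq
    have h5 : ‖fderiv ℝ χ q‖ * ‖g q‖ ≤ K / r * (5 * η * r) := by
      gcongr
      · exact hχd q
      · exact hg0 q hq
    have h6 : 1 * (2 * η) + K / r * (5 * η * r) = κ := by
      rw [hη]; field_simp
    linarith
  · have h1 : (fun q => χ q • g q) =ᶠ[𝓝 q] fun _ => 0 := by
      filter_upwards [Metric.isClosed_closedBall.isOpen_compl.mem_nhds hq] with p hp
      have : χ p = 0 := by
        refine hb0 _ ?_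
        have hp' : p ∉ Metric.closedBall (0 : Plane) (2 * r) := hp
        rw [mem_closedBall_zero_iff] at hp' ⊢
        rw [norm_smul, norm_inv, Real.norm_of_nonneg hr.le, inv_mul_le_iff₀ hr]
        linarith
      rw [this, zero_smul]
    have h2 : fderiv ℝ (fun q => χ q • g q) q = 0 := by
      rw [h1.fderiv_eq]; simp
    rw [h2, norm_zero]
    exact κ.2

/-- A field `C²`-close to `X₀` has exactly one equilibrium near a saddle of `X₀`, a saddle. -/
theorem exists_saddle {X₀ : Plane → Plane} (hX₀ : ContDiff ℝ 2 X₀)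
    (h0 : IsHyperbolicSaddle X₀ 0) : ∃ b > 0, ∀ s > 0, ∃ R > 0, ∃ ε > 0, ∀ X, ContDiff ℝ 2 X →
      IsJetClose R ε X X₀ → ∃ S : Plane, ‖S‖ < s ∧ IsHyperbolicSaddle X S ∧
        ∀ q ∈ Metric.ball (0 : Plane) b, X q = 0 → q = S := by
  have hdet := h0.planeDet_neg
  set D := fderiv ℝ X₀ 0 with hD
  obtain ⟨N, hDN, hND⟩ := exists_right_inverse hdet.ne
  set κ : NNReal := 1 / 2 / (‖N‖₊ + 1) with hκ
  have hκN : ‖N‖₊ * κ ≤ 1 / 2 := by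
    rw [hκ, mul_div_assoc', div_le_iff₀ (by positivity), mul_comm]
    gcongr
    simp
  obtain ⟨r, hr, χ, hχ, ε₁, hε₁, hlip⟩ := exists_cutoffField hX₀ h0.1 (κ := κ) (by positivity)
  obtain ⟨η, hη, hηdet⟩ : ∃ η > 0, ∀ L : Plane →L[ℝ] Plane, ‖L - D‖ < η → planeDet L < 0 := by
    obtain ⟨η, hη, h1⟩ := Metric.eventually_nhds_iff.1
      (continuous_planeDet.continuousAt.eventually (gt_mem_nhds hdet))
    exact ⟨η, hη, fun L hL => h1 (by rwa [dist_eq_norm])⟩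
  obtain ⟨s₁, hs₁, hs₁D⟩ : ∃ s₁ > 0, ∀ q, ‖q‖ < s₁ → ‖fderiv ℝ X₀ q - D‖ < η / 2 := by
    have h1 : Continuous fun q => ‖fderiv ℝ X₀ q - D‖ :=
      ((hX₀.continuous_fderiv two_ne_zero).sub continuous_const).norm
    obtain ⟨s₁, hs₁, h2⟩ := Metric.eventually_nhds_iff.1
      (h1.continuousAt.eventually (gt_mem_nhds (show ‖fderiv ℝ X₀ 0 - D‖ < η / 2 by
        simpa [hD] using half_pos hη)))
    exact ⟨s₁, hs₁, fun q hq => h2 (by rwa [dist_zero_right])⟩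
  refine ⟨r, hr, fun s hs => ⟨2 * r, by positivity, ?_⟩⟩
  set s' := min s (min s₁ r) with hs'
  have hs'0 : 0 < s' := by positivity
  refine ⟨min ε₁ (min (η / 2) (s' / (2 * (‖N‖ + 1)) / 2)), by positivity, fun X hX hXX => ?_⟩
  have hg := hlip X hX (hXX.mono le_rfl (min_le_left _ _))
  set g : Plane → Plane := fun q => χ q • (X q - D q)
  have hcon : ContractingWith (1 / 2) fun q => -N (g q) := by
    refine ⟨by rw [← NNReal.coe_lt_coe]; norm_num, ?_⟩
    have h1 : LipschitzWith (‖N‖₊ * κ) fun q => N (g q) := N.lipschitz.comp hg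
    exact (h1.weaken hκN).neg
  set S := ContractingWith.fixedPoint _ hcon with hSdef
  have hSfix : -N (g S) = S := hcon.fixedPoint_isFixedPt
  have hiff : ∀ q ∈ Metric.closedBall (0 : Plane) r, X q = 0 ↔ -N (g q) = q := by
    intro q hq
    have h1 : g q = X q - D q := by simp only [g, hχ.eq_one q hq, one_smul]
    rw [h1, map_sub, hND, neg_sub, sub_eq_self]
    refine ⟨fun h => by rw [h, map_zero], fun h => ?_⟩
    rw [← hDN (X q), h, map_zero]
  have hS : ‖S‖ < s' := by
    have h1 : ‖N (g 0)‖ ≤ ‖N‖ * (s' / (2 * (‖N‖ + 1)) / 2) := by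
      refine (N.le_opNorm _).trans ?_
      gcongr
      have h2 : g 0 = X 0 := by simp [g, hχ.eq_one 0 (Metric.mem_closedBall_self hr.le)]
      have h3 := hXX.dist_le 0 (Metric.mem_closedBall_self (by positivity))
      rw [h0.1, dist_zero_right] at h3
      rw [h2]
      exact h3.trans ((min_le_right _ _).trans (min_le_right _ _))
    have h2 := hcon.2.dist_le_mul S 0
    simp only [hSfix] at h2
    rw [dist_eq_norm, dist_zero_right, sub_neg_eq_add] at h2
    have h3 := norm_sub_le (S + N (g 0)) (N (g 0))
    rw [add_sub_cancel_right] at h3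
    have h4 : ‖N‖ * (s' / (2 * (‖N‖ + 1)) / 2) < s' / 4 * 1 := by
      have h5 : ‖N‖ * (s' / (2 * (‖N‖ + 1)) / 2) = s' / 4 * (‖N‖ / (‖N‖ + 1)) := by
        field_simp; ring
      rw [h5]
      have h6 : ‖N‖ / (‖N‖ + 1) < 1 := by rw [div_lt_one (by positivity)]; linarith
      exact mul_lt_mul_of_pos_left h6 (by positivity)
    push_cast at h2
    linarith
  have hSs : ‖S‖ < s := hS.trans_le (min_le_left _ _)
  have hSs₁ : ‖S‖ < s₁ := hS.trans_le ((min_le_right _ _).trans (min_le_left _ _))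
  have hSr : ‖S‖ < r := hS.trans_le ((min_le_right _ _).trans (min_le_right _ _))
  have hXS : X S = 0 := (hiff S (by simpa using hSr.le)).2 hSfix
  refine ⟨S, hSs, isHyperbolicSaddle_of_planeDet_neg hXS (hηdet _ ?_), fun q hq hq0 => ?_⟩
  · have h1 := hXX.fderiv_le S (by simpa using hSr.le.trans (by linarith))
    have h2 := h1.trans ((min_le_right _ _).trans (min_le_left _ _))
    have h3 := norm_add_le (fderiv ℝ X S - fderiv ℝ X₀ S) (fderiv ℝ X₀ S - D)
    rw [sub_add_sub_cancel] at h3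
    linarith [hs₁D S hSs₁]
  · exact hcon.fixedPoint_unique ((hiff q (Metric.ball_subset_closedBall hq)).1 hq0)

/-! ### Second-order expansion from one-sided bounds on the derivative. -/

theorem ContDiffAt.deriv_one {R : ℝ → ℝ} {a : ℝ} (hR : ContDiffAt ℝ 2 R a) :
    ContDiffAt ℝ 1 (deriv R) a := by
  have h1 : ContDiffAt ℝ 1 (fun x => fderiv ℝ R x 1) a :=
    (hR.fderiv_right (m := 1) (by norm_num)).clm_apply contDiffAt_const
  exact h1

theorem isLittleO_taylor_two {R : ℝ → ℝ} {a : ℝ} (hR : ContDiffAt ℝ 2 R a) :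
    (fun x : ℝ => R (a + x) - (R a + deriv R a * x + deriv (deriv R) a / 2 * x ^ 2))
      =o[𝓝 0] fun x : ℝ => x ^ 2 := by
  obtain ⟨δ, hδ, hδR⟩ := Metric.eventually_nhds_iff_ball.1
    (hR.eventually (by decide : (2 : WithTop ℕ∞) ≠ _))
  set f : ℝ → ℝ := fun x => R (a + x) - (R a + deriv R a * x + deriv (deriv R) a / 2 * x ^ 2)
  set f' : ℝ → ℝ := fun x => deriv R (a + x) - deriv R a - deriv (deriv R) a * x
  have hf : ∀ x ∈ Metric.ball (0 : ℝ) δ, HasDerivAt f (f' x) x := by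
    intro x hx
    have h1 : a + x ∈ Metric.ball a δ := by simpa using hx
    have h2 : HasDerivAt (fun x => R (a + x)) (deriv R (a + x)) x := by
      have := ((hδR _ h1).differentiableAt two_ne_zero).hasDerivAt.comp_const_add a x
      exact this
    refine (h2.sub ((((hasDerivAt_id x).const_mul (deriv R a)).const_add (R a)).add
      (((hasDerivAt_id x).pow 2).const_mul (deriv (deriv R) a / 2)))).congr_deriv ?_
    simp [f']
    ring
  have hf' : f' =o[𝓝[Metric.ball 0 δ] 0] fun x : ℝ => (x - 0) ^ 1 := by
    rw [nhdsWithin_eq_nhds.2 (Metric.ball_mem_nhds _ hδ)]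
    have h1 := (hasDerivAt_iff_isLittleO_nhds_zero.1
      (hR.deriv_one.differentiableAt one_ne_zero).hasDerivAt)
    simp only [sub_zero, pow_one]
    refine h1.congr_left fun x => ?_
    simp [f']; ring
  have h1 := (convex_ball (0 : ℝ) δ).isLittleO_pow_succ_real (Metric.mem_ball_self hδ)
    (fun x hx => (hf x hx).hasDerivWithinAt) hf'
  rw [nhdsWithin_eq_nhds.2 (Metric.ball_mem_nhds _ hδ)] at h1
  refine (h1.congr_left fun x => ?_).congr_right fun x => ?_
  · simp [f]
  · simp

/-- Here g stands for the normal speed Xh(x, 0). In the limit x → a the comparison of R' with g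
fixes k₁ = R'(a). When g(a) = 0, the difference quotients of R' at a are at least c/C, so R''(a) >
0. -/
theorem exists_expansion {R g : ℝ → ℝ} {a c C : ℝ} (hR : ContDiffAt ℝ 2 R a) (hc : 0 < c)
    (hC : 0 < C) (hd : ∀ᶠ x in 𝓝[>] a, C⁻¹ * g x ≤ deriv R x ∧ deriv R x ≤ C * g x)
    (hg : ContinuousAt g a) (hgc : ∀ x, a < x → c * (x - a) ≤ g x - g a) :
    ∃ k₁ k₂ : ℝ, ((fun x : ℝ => R (a + x) - (R a + k₁ * x + k₂ * x ^ 2))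
        =o[𝓝 0] fun x : ℝ => x ^ 2) ∧
      (0 < g a → C * g a < 1 → 0 < |k₁| ∧ |k₁| < 1) ∧ (g a = 0 → k₁ = 0 ∧ 0 < k₂) := by
  have hR1 := hR.deriv_one
  have hcont := (hR1.continuousAt.tendsto).mono_left (nhdsWithin_le_nhds (s := Ioi a))
  have hgr := hg.tendsto.mono_left (nhdsWithin_le_nhds (s := Ioi a))
  have h1 : C⁻¹ * g a ≤ deriv R a :=
    le_of_tendsto_of_tendsto (hgr.const_mul _) hcont (hd.mono fun x hx => hx.1)
  have h2 : deriv R a ≤ C * g a :=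
    le_of_tendsto_of_tendsto hcont (hgr.const_mul _) (hd.mono fun x hx => hx.2)
  refine ⟨_, _, isLittleO_taylor_two hR, fun h3 h4 => ?_, fun h3 => ?_⟩
  · have h5 : 0 < deriv R a := lt_of_lt_of_le (by positivity) h1
    rw [abs_of_pos h5]
    exact ⟨h5, by linarith⟩
  · rw [h3, mul_zero] at h1 h2
    have h0 : deriv R a = 0 := le_antisymm h2 h1
    refine ⟨h0, half_pos (lt_of_lt_of_le (by positivity : 0 < C⁻¹ * c) ?_)⟩
    have h5 := (hR1.differentiableAt one_ne_zero).hasDerivAt.tendsto_slope.mono_left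
      (nhdsWithin_mono a (show Ioi a ⊆ {a}ᶜ from fun x hx => ne_of_gt hx))
    refine ge_of_tendsto h5 ?_
    filter_upwards [hd, self_mem_nhdsWithin] with x hx hax
    have hax' : 0 < x - a := sub_pos.2 hax
    rw [slope_def_field, h0, sub_zero, le_div_iff₀ hax', mul_assoc]
    refine le_trans ?_ hx.1
    gcongr
    have := hgc x hax
    linarith

/-- A horizontal step has u = -δ and v = δ, so the linear part adds 2 lam δ to the vertical speed.
The two errors, lam δ/8 each, leave the factor 7/4. -/
theorem IsSaddleField.horizontal_le {u v : Plane →L[ℝ] ℝ} {lam : ℝ} {F : Plane → Plane}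
    (h : IsSaddleField u v lam F) {x x' : ℝ} (hx : x' ≤ x) :
    7 / 4 * lam * v (1, 0) * (x - x') ≤ (F (x, 0)).2 - (F (x', 0)).2 := by
  have h1 : ((x, 0) : Plane) - (x', 0) = (x - x', 0) := by simp
  have h2 := h.fst_le (x, 0) (x', 0)
  have h3 := h.snd_le (x, 0) (x', 0)
  have h4 := h.add (F (x, 0) - F (x', 0))
  have hd : 0 ≤ (x - x') * v (1, 0) := mul_nonneg (by linarith) h.dir_pos.le
  rw [h1, h.fst_horizontal (x - x'), h.snd_horizontal (x - x'), abs_neg, abs_of_nonneg hd] at h2 h3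
  have h5 := (abs_le.1 h2).1
  have h6 := (abs_le.1 h3).1
  rw [Prod.snd_sub] at h4
  nlinarith

/-! ### The first return map of a field with a return setup, and its end point. -/

/-- The field `Z = (X, Y)` near a cycle through the saddle `S` of `X`. Near `S`, on `G`, the field `X`
agrees with a global saddle field `F`. The orbits of `F` which start near `S` leave the box of radius
`r` on its right side `v = r` through the set `N`, whose points return to `Σ` at `Q`. -/
structure IsReturnSetup (X Y : Plane → Plane) (u v : Plane →L[ℝ] ℝ) (lam : ℝ) (F : Plane → Plane)
    (φ : ℝ → Plane → Plane) (S : Plane) (r T L C : ℝ) (B N G : Set Plane) (Q : Plane → ℝ) :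
    Prop where
  contDiff_fst : ContDiff ℝ 1 X
  contDiff_snd : ContDiff ℝ 1 Y
  saddle : IsSaddleField u v lam F
  flow : IsFlow F φ
  zero : F S = 0
  pos : 0 < r
  eqOn : EqOn X F G
  isOpen_G : IsOpen G
  box : ∀ q, |u (q - S)| ≤ 2 * r → |v (q - S)| ≤ 2 * r → q ∈ G
  time_nonneg : 0 ≤ T
  passage : ∀ q, |u (q - S)| ≤ r → v (φ T q - S) = r → φ T q ∈ N
  isOpen_N : IsOpen N
  upper : N ⊆ upperSide
  mem_N_le : ∀ q ∈ N, v (q - S) ≤ 2 * r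
  arc : ∀ q ∈ N, ∃ p : ℝ, HasArc X upperSide q (p, 0) ∧ (p, 0) ∈ crossingRegion X Y ∧
    HasArc Y lowerSide (p, 0) (Q q, 0)
  contDiffAt : ∀ q ∈ N, ContDiffAt ℝ 2 Q q
  C_pos : 0 < C
  fderiv_eq : ∀ q ∈ N, ∃ k, C⁻¹ ≤ k ∧ k ≤ C ∧ ∀ w, fderiv ℝ Q q w = k * areaForm w (X q)
  L_nonneg : 0 ≤ L
  div : ∀ q, |u (q - S)| ≤ 2 * r → |v (q - S)| ≤ 2 * r →
    |planeDiv F q - planeDiv F S| ≤ L * (|u (q - S)| + |v (q - S)|)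
  isOpen_B : IsOpen B
  small : ∀ q ∈ B, ∀ t ∈ Icc 0 T, |u (φ t q - S)| ≤ r / 4 ∧ |v (φ t q - S)| < r
  mem_B : ∀ q, |u (q - S)| ≤ 2 * |S.2| → |v (q - S)| ≤ 2 * |S.2| → q ∈ B
  height : |S.2| ≤ r / 4
  slope : ∀ x : ℝ, (x, 0) ∈ B → C * Real.exp (16 * L * (2 * r) / lam) * (F (x, 0)).2 < 1

namespace IsReturnSetup

variable {X Y : Plane → Plane} {u v : Plane →L[ℝ] ℝ} {lam : ℝ} {F : Plane → Plane}
  {φ : ℝ → Plane → Plane} {S : Plane} {r T L C : ℝ} {B N G : Set Plane} {Q : Plane → ℝ}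

/-- While it stays in `G`, an orbit of `F` is a trajectory of `X`. -/
theorem isIntegralCurveOn (h : IsReturnSetup X Y u v lam F φ S r T L C B N G Q) {q : Plane}
    {s : Set ℝ} (hG : ∀ t ∈ s, φ t q ∈ G) : IsIntegralCurveOn (fun t => φ t q) (fun _ => X) s :=
  fun t ht => by
    have h1 := h.flow.isIntegralCurveOn q s t ht
    simp only at h1 ⊢
    rwa [h.eqOn (hG t ht)]

/-- Orbits starting to the right of `(a, 0)`, with `(a, 0)` as here, return. -/
structure IsLeftBound (u v : Plane →L[ℝ] ℝ) (φ : ℝ → Plane → Plane) (S : Plane) (r : ℝ)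
    (B : Set Plane) (a : ℝ) : Prop where
  nonneg : ∀ t, 0 ≤ t → 0 ≤ (φ t (a, 0)).2
  le : ∀ t, 0 ≤ t → -r ≤ v (φ t (a, 0) - S)
  mem : (a, 0) ∈ B

variable {a x : ℝ}

theorem start_le (h : IsReturnSetup X Y u v lam F φ S r T L C B N G Q) {q : Plane} (hq : q ∈ B) :
    |u (q - S)| ≤ r / 4 ∧ |v (q - S)| < r := by
  simpa [h.flow.zero] using h.small q hq 0 ⟨le_rfl, h.time_nonneg⟩

theorem right_of (h : IsReturnSetup X Y u v lam F φ S r T L C B N G Q)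
    (ha : IsLeftBound u v φ S r B a) (hax : a < x) (hx : (x, 0) ∈ B) :
    (∀ t > 0, 0 < (φ t (x, 0)).2) ∧ (∀ t, 0 ≤ t → -r ≤ v (φ t (x, 0) - S)) ∧
      (∃ s > 0, v (φ s (x, 0) - S) = r ∧
        ∀ t ∈ Icc 0 s, |u (φ t (x, 0) - S)| ≤ r ∧ |v (φ t (x, 0) - S)| ≤ r) ∧
      ∀ t, 0 ≤ t → v (φ t (x, 0) - S) ≤ 2 * r →
        ∀ s ∈ Icc 0 t, |u (φ s (x, 0) - S)| ≤ 2 * r ∧ |v (φ s (x, 0) - S)| ≤ 2 * r := by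
  have hs := h.start_le hx
  have hr := h.pos
  obtain ⟨h1, h2, h3, h4⟩ := h.saddle.orbit_right_of h.flow h.zero hax
    (show r ≤ 2 * r by linarith) ha.nonneg ha.le (by linarith) (lt_of_abs_lt hs.2)
  exact ⟨h1, fun t ht => (ha.le t ht).trans (h2 t ht), h3, h4⟩

theorem isFirstReturn (h : IsReturnSetup X Y u v lam F φ S r T L C B N G Q)
    (ha : IsLeftBound u v φ S r B a) (hax : a < x) (hx : (x, 0) ∈ B) {t : ℝ} (ht : 0 ≤ t)
    (hN : φ t (x, 0) ∈ N) : IsFirstReturn X Y x (Q (φ t (x, 0))) := by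
  obtain ⟨h1, -, -, h2⟩ := h.right_of ha hax hx
  have ht0 : 0 < t := by
    refine lt_of_le_of_ne ht fun h0 => ?_
    have := h.upper hN
    rw [← h0, h.flow.zero] at this
    exact lt_irrefl (0 : ℝ) this
  obtain ⟨p, hp, hpc, hp'⟩ := h.arc _ hN
  refine ⟨p, HasArc.trans ⟨t, fun t => φ t (x, 0), ht0, h.isIntegralCurveOn fun s hs => ?_,
    h.flow.zero _, rfl, fun s hs => h1 s hs.1⟩ (h.upper hN) hp, hpc, hp'⟩
  obtain ⟨h3, h4⟩ := h2 t ht (h.mem_N_le _ hN) s hs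
  exact h.box _ h3 h4

/-- By the chain rule the derivative is k · J · Xh(x, 0): k comes from the return after the exit and
J is the Jacobian of the passage. Zero divergence at S bounds J independently of t, however close x
is to a. -/
theorem deriv_bounds (h : IsReturnSetup X Y u v lam F φ S r T L C B N G Q)
    (ha : IsLeftBound u v φ S r B a) (hdiv : planeDiv F S = 0) {R : ℝ → ℝ} {t : ℝ} (hax : a < x)
    (hx : (x, 0) ∈ B) (ht : 0 ≤ t) (hN : φ t (x, 0) ∈ N)
    (hR : ∀ᶠ x' in 𝓝 x, IsFirstReturn X Y x' (R x')) :
    (C * Real.exp (16 * L * (2 * r) / lam))⁻¹ * (F (x, 0)).2 ≤ deriv R x ∧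
      deriv R x ≤ C * Real.exp (16 * L * (2 * r) / lam) * (F (x, 0)).2 := by
  have hline : Continuous fun x : ℝ => ((x, 0) : Plane) := by fun_prop
  -- First returns are unique, so near x the map can be computed with the passage time frozen at t.
  have h1 : R =ᶠ[𝓝 x] fun x' => Q (φ t (x', 0)) := by
    filter_upwards [hR, Ioi_mem_nhds hax,
      (h.isOpen_B.preimage hline).mem_nhds hx,
      (h.isOpen_N.preimage ((h.flow.continuous_map t).comp hline)).mem_nhds hN] with x' h1 h2 h3 h4
    exact h1.unique h.contDiff_fst h.contDiff_snd (h.isFirstReturn ha h2 h3 ht h4)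
  obtain ⟨k, hk1, hk2, hk⟩ := h.fderiv_eq _ hN
  obtain ⟨hy, -, -, hbox⟩ := h.right_of ha hax hx
  have hbox' := hbox t ht (h.mem_N_le _ hN)
  have hG : φ t (x, 0) ∈ G := h.box _ (hbox' t ⟨ht, le_rfl⟩).1 (hbox' t ⟨ht, le_rfl⟩).2
  have h2 : HasDerivAt (fun x' : ℝ => ((x', 0) : Plane)) (1, 0) x :=
    (hasDerivAt_id x).prodMk (hasDerivAt_const x 0)
  have h3 : HasDerivAt (fun x' : ℝ => φ t (x', 0)) (fderiv ℝ (φ t) (x, 0) (1, 0)) x :=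
    HasFDerivAt.comp_hasDerivAt x (f := fun x' : ℝ => ((x', 0) : Plane)) (l := φ t)
      ((h.flow.contDiff_map t).differentiable two_ne_zero (x, 0)).hasFDerivAt h2
  have h4 : HasDerivAt (fun x' : ℝ => Q (φ t (x', 0)))
      (fderiv ℝ Q (φ t (x, 0)) (fderiv ℝ (φ t) (x, 0) (1, 0))) x :=
    HasFDerivAt.comp_hasDerivAt x (f := fun x' : ℝ => φ t (x', 0)) (l := Q)
      ((h.contDiffAt _ hN).differentiableAt two_ne_zero).hasFDerivAt h3
  have h5 : areaForm (1, 0) (F (x, 0)) = (F (x, 0)).2 := by simp [areaForm]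
  rw [h1.deriv_eq, h4.deriv, hk, h.eqOn hG, h.flow.areaForm_fderiv, h5]
  have hqS : ((x, 0) : Plane) ≠ S := by
    intro h0
    obtain ⟨s, hs, hs', -⟩ := (h.right_of ha hax hx).2.2.1
    rw [h0, h.flow.orbit_of_zero h.zero, sub_self, map_zero] at hs'
    exact h.pos.ne hs'
  obtain ⟨hJ1, hJ2⟩ := h.saddle.flowJacobian_bounds h.flow h.zero hqS ht h.L_nonneg hbox'
    fun s hs => by
      have := h.div _ (hbox' s hs).1 (hbox' s hs).2
      rwa [hdiv, sub_zero] at this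
  set E := Real.exp (16 * L * (2 * r) / lam) with hE
  have hE0 : 0 < E := Real.exp_pos _
  rw [Real.exp_neg, ← hE] at hJ1
  have hC := h.C_pos
  have hF : 0 ≤ (F (x, 0)).2 := by
    have h6 : HasDerivAt (fun t => (φ t (x, 0)).2) (F (φ 0 (x, 0))).2 0 :=
      IsSaddleField.hasDerivAt_height h.flow (x, 0) 0
    have h7 := h6.tendsto_slope_zero_right
    rw [h.flow.zero] at h7
    refine ge_of_tendsto h7 ?_
    filter_upwards [self_mem_nhdsWithin] with s hs
    have hs' : 0 < s := hs
    have h8 := hy s hs'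
    rw [zero_add, sub_zero, smul_eq_mul]
    positivity
  set J := flowJacobian φ (x, 0) t
  have hJ0 : 0 ≤ J := (inv_pos.2 hE0).le.trans hJ1
  have hk0 : 0 ≤ k := (inv_pos.2 hC).le.trans hk1
  constructor
  · rw [mul_inv, mul_assoc]
    gcongr
  · rw [mul_assoc]
    gcongr

/-- A `C²` curve of points of the orbits of `(x, 0)` determines the first return map. -/
theorem eventually_isFirstReturn (h : IsReturnSetup X Y u v lam F φ S r T L C B N G Q)
    (ha : IsLeftBound u v φ S r B a) (hdiv : planeDiv F S = 0) {m : ℝ → Plane}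
    (hm : ContDiffAt ℝ 2 m a) (hmN : m a ∈ N)
    (hφm : ∀ᶠ x in 𝓝[>] a, ∃ t, 0 ≤ t ∧ φ t (x, 0) = m x) :
    ContDiffAt ℝ 2 (fun x => Q (m x)) a ∧ ∀ᶠ x in 𝓝[>] a, IsFirstReturn X Y x (Q (m x)) ∧
      (C * Real.exp (16 * L * (2 * r) / lam))⁻¹ * (F (x, 0)).2 ≤ deriv (fun x => Q (m x)) x ∧
      deriv (fun x => Q (m x)) x ≤ C * Real.exp (16 * L * (2 * r) / lam) * (F (x, 0)).2 := by
  have hline : Continuous fun x : ℝ => ((x, 0) : Plane) := by fun_prop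
  refine ⟨ContDiffAt.comp a (g := Q) (h.contDiffAt _ hmN) hm, ?_⟩
  have h1 : ∀ᶠ x in 𝓝[>] a, (x, 0) ∈ B ∧ m x ∈ N ∧ ∃ t, 0 ≤ t ∧ φ t (x, 0) = m x := by
    filter_upwards [hφm, nhdsWithin_le_nhds ((h.isOpen_B.preimage hline).mem_nhds ha.mem),
      nhdsWithin_le_nhds (hm.continuousAt.preimage_mem_nhds (h.isOpen_N.mem_nhds hmN))]
      with x h1 h2 h3 using ⟨h2, h3, h1⟩
  obtain ⟨δ, hδ, h2⟩ := (mem_nhdsGT_iff_exists_Ioo_subset).1 h1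
  have h3 : ∀ x ∈ Ioo a δ, IsFirstReturn X Y x (Q (m x)) := by
    intro x hx
    obtain ⟨hxB, hxN, t, ht, hxt⟩ := h2 hx
    rw [← hxt] at hxN ⊢
    exact h.isFirstReturn ha hx.1 hxB ht hxN
  filter_upwards [Ioo_mem_nhdsGT hδ] with x hx
  obtain ⟨hxB, hxN, t, ht, hxt⟩ := h2 hx
  refine ⟨h3 x hx, h.deriv_bounds ha hdiv hx.1 hxB ht (hxt ▸ hxN) ?_⟩
  filter_upwards [Ioo_mem_nhds hx.1 hx.2] with x' hx' using h3 x' hx'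

/-- Any first return map agrees with Q ∘ m just right of a by uniqueness of returns, and at a by
continuity, so it inherits the expansion of this C² function. -/
theorem exists_firstReturnMap (h : IsReturnSetup X Y u v lam F φ S r T L C B N G Q)
    (ha : IsLeftBound u v φ S r B a) (hdiv : planeDiv F S = 0) {m : ℝ → Plane}
    (hm : ContDiffAt ℝ 2 m a) (hmN : m a ∈ N)
    (hφm : ∀ᶠ x in 𝓝[>] a, ∃ t, 0 ≤ t ∧ φ t (x, 0) = m x) (hpos : 0 < S.2 → 0 < (F (a, 0)).2)
    (hzero : S.2 ≤ 0 → (F (a, 0)).2 = 0) :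
    (∃ (δ : ℝ) (π : ℝ → ℝ), IsFirstReturnMap X Y a δ π) ∧
      ∀ (δ : ℝ) (π : ℝ → ℝ), IsFirstReturnMap X Y a δ π → ∃ k₁ k₂ : ℝ,
        ((fun x : ℝ => (π (a + x) - a) - ((π a - a) + k₁ * x + k₂ * x ^ 2))
          =o[𝓝[≥] 0] fun x : ℝ => x ^ 2) ∧
        (0 < S.2 → 0 < |k₁| ∧ |k₁| < 1) ∧ (S.2 ≤ 0 → k₁ = 0 ∧ 0 < k₂) := by
  obtain ⟨hR, hev⟩ := h.eventually_isFirstReturn ha hdiv hm hmN hφm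
  set R : ℝ → ℝ := fun x => Q (m x)
  obtain ⟨b, hb, hIoo⟩ := (mem_nhdsGT_iff_exists_Ioo_subset).1 hev
  have hb' : a < b := hb
  refine ⟨⟨b - a, R, sub_pos.2 hb', fun x hx => (hIoo ⟨hx.1, by linarith [hx.2]⟩).1,
    hR.continuousAt.continuousWithinAt⟩, fun δ π hπ => ?_⟩
  obtain ⟨hδ, hret, hcont⟩ := hπ
  have heq : ∀ x ∈ Ioo a (min b (a + δ)), π x = R x := fun x hx =>
    (hret x ⟨hx.1, hx.2.trans_le (min_le_right _ _)⟩).unique h.contDiff_fst h.contDiff_snd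
      (hIoo ⟨hx.1, hx.2.trans_le (min_le_left _ _)⟩).1
  have hmin : a < min b (a + δ) := lt_min hb' (by linarith)
  have heqa : π a = R a := by
    have h1 : Tendsto π (𝓝[>] a) (𝓝 (π a)) :=
      hcont.tendsto.mono_left (nhdsWithin_mono _ Ioi_subset_Ici_self)
    have h2 : Tendsto R (𝓝[>] a) (𝓝 (R a)) := hR.continuousAt.tendsto.mono_left nhdsWithin_le_nhds
    refine tendsto_nhds_unique (h1.congr' ?_) h2
    filter_upwards [Ioo_mem_nhdsGT hmin] with x hx using heq x hx
  have hFc : Continuous F := h.flow.field_contDiff.continuous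
  have hl := h.saddle.pos
  have hv := h.saddle.dir_pos
  have hC := h.C_pos
  obtain ⟨k₁, k₂, hexp, hk1, hk2⟩ := exists_expansion (g := fun x => (F (x, 0)).2)
    (c := 7 / 4 * lam * v (1, 0)) (C := C * Real.exp (16 * L * (2 * r) / lam)) hR (by positivity)
    (by positivity) (hev.mono fun x hx => hx.2) (by fun_prop)
    (fun x hx => h.saddle.horizontal_le hx.le)
  refine ⟨k₁, k₂, ?_, fun hS => hk1 (hpos hS) (h.slope a ha.mem), fun hS => hk2 (hzero hS)⟩
  refine (hexp.mono nhdsWithin_le_nhds).congr' ?_ EventuallyEq.rfl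
  have h1 : Iio (min b (a + δ) - a) ∈ 𝓝[≥] (0 : ℝ) :=
    nhdsWithin_le_nhds (Iio_mem_nhds (by linarith))
  filter_upwards [h1, self_mem_nhdsWithin] with x hx hx0
  have hx0' : 0 ≤ x := hx0
  have hx' : x < min b (a + δ) - a := hx
  have h2 : π (a + x) = R (a + x) := by
    rcases hx0'.eq_or_lt with h3 | h3
    · rw [← h3, add_zero, heqa]
    · exact heq _ ⟨by linarith, by linarith⟩
  rw [h2, heqa]
  ring

end IsReturnSetup

namespace IsReturnSetup

variable {X Y : Plane → Plane} {u v : Plane →L[ℝ] ℝ} {lam : ℝ} {F : Plane → Plane}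
  {φ : ℝ → Plane → Plane} {S : Plane} {r T L C : ℝ} {B N G : Set Plane} {Q : Plane → ℝ} {a : ℝ}

/-- Points of B keep |v| < r up to time T, so an orbit reaches v = r only later. The passage
property is applied to its last stretch of duration T. -/
theorem mem_N_of_le (h : IsReturnSetup X Y u v lam F φ S r T L C B N G Q) {q : Plane} (hq : q ∈ B)
    {s : ℝ} (hs : 0 ≤ s) (hv : v (φ s q - S) = r)
    (hu : ∀ t ∈ Icc 0 s, |u (φ t q - S)| ≤ r) : φ s q ∈ N := by
  have hTs : T ≤ s := by
    by_contra hc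
    have := (h.small q hq s ⟨hs, (not_le.1 hc).le⟩).2
    rw [hv] at this
    exact absurd (le_abs_self r) (not_le.2 this)
  have h1 : φ s q = φ T (φ (s - T) q) := by rw [← h.flow.add, add_sub_cancel]
  rw [h1] at hv ⊢
  exact h.passage _ (hu _ ⟨by linarith, by linarith [h.time_nonneg]⟩) hv

theorem mem_G_of_mem_B (h : IsReturnSetup X Y u v lam F φ S r T L C B N G Q) {q : Plane}
    (hq : q ∈ B) : q ∈ G := by
  have h1 := h.start_le hq
  have h2 := h.pos
  exact h.box q (by linarith) (by linarith)

/-- The vertical speed along the axis grows at least linearly, so it vanishes somewhere. The orbit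
of this fold exits in finite time, hence m is a fixed-time map of the flow and no linearization is
needed. -/
theorem exists_fold_endpoint (h : IsReturnSetup X Y u v lam F φ S r T L C B N G Q)
    (hS : S.2 < 0) : ∃ a m, IsLeftBound u v φ S r B a ∧ (F (a, 0)).2 = 0 ∧
      ContDiffAt ℝ 2 m a ∧ m a ∈ N ∧ ∀ᶠ x in 𝓝[>] a, ∃ t, 0 ≤ t ∧ φ t (x, 0) = m x := by
  have hFc : Continuous F := h.flow.field_contDiff.continuous
  have hk : 0 < 7 / 4 * lam * v (1, 0) := by
    have := h.saddle.pos
    have := h.saddle.dir_pos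
    positivity
  set k := 7 / 4 * lam * v (1, 0)
  obtain ⟨a, ha⟩ : ∃ a : ℝ, (F (a, 0)).2 = 0 := by
    have hc : Continuous fun x : ℝ => (F (x, 0)).2 := by fun_prop
    set y := |(F (0, 0)).2| / k with hy
    have hy0 : 0 ≤ y := by positivity
    have hky : k * y = |(F (0, 0)).2| := mul_div_cancel₀ _ hk.ne'
    refine mem_range_of_exists_le_of_exists_ge hc ⟨-y, ?_⟩ ⟨y, ?_⟩
    · have h1 : k * (0 - -y) ≤ _ := h.saddle.horizontal_le (show -y ≤ 0 by linarith)
      have h2 : k * (0 - -y) = k * y := by ring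
      linarith [le_abs_self (F (0, 0)).2]
    · have h1 : k * (y - 0) ≤ _ := h.saddle.horizontal_le hy0
      have h2 : k * (y - 0) = k * y := by ring
      linarith [neg_abs_le (F (0, 0)).2]
  obtain ⟨h1, h2, h3, h4, h5⟩ := h.saddle.fold_orbit h.flow h.zero hS ha
  have habs : |S.2| = -S.2 := abs_of_neg hS
  have hr := h.pos
  have hB : ((a, 0) : Plane) ∈ B := h.mem_B _ (by rw [habs]; linarith) (by rw [habs]; linarith)
  have hB' := h.start_le hB
  have hc : Continuous fun t => v (φ t (a, 0) - S) := by
    have := h.flow.continuous_orbit (a, 0)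
    fun_prop
  obtain ⟨s, hs, hvs, hvs'⟩ := exists_first_hit hc (r := r)
    (by simpa only [h.flow.zero] using lt_of_abs_lt hB'.2) (by
      obtain ⟨t, ht⟩ := ((h5.eventually (eventually_ge_atTop r)).and (eventually_ge_atTop 0)).exists
      exact ⟨t, ht.2, ht.1⟩)
  refine ⟨a, φ s ∘ fun x => (x, 0), ⟨fun t ht => ?_, fun t ht => by linarith [h4 t ht], hB⟩, ha, ?_,
    ?_, Eventually.of_forall fun x => ⟨s, hs.le, rfl⟩⟩
  · rcases ht.eq_or_lt with h0 | h0
    · rw [← h0, h.flow.zero]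
    · exact (h3 t h0).le
  · exact ((h.flow.contDiff_map s).comp (contDiff_id.prodMk contDiff_const)).contDiffAt
  · refine h.mem_N_of_le hB hs.le hvs fun t ht => ?_
    refine (h.saddle.conePair_zero h.flow h.zero (a, 0)).fst_le_of_snd_le ht.1 (fun w hw => ?_) ?_
    · rw [abs_of_nonneg (h4 w hw.1)]
      linarith [hvs' w ⟨hw.1, hw.2.trans ht.2⟩]
    · simp only [h.flow.zero]
      linarith [hB'.1]

/-- The exit curve starts on the unstable manifold. A time T earlier its base point was in the
unstable cone with 0 < v ≤ r, so |u| ≤ r and the passage property places m a in N. -/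
theorem exists_exit (h : IsReturnSetup X Y u v lam F φ S r T L C B N G Q)
    (ha : IsLeftBound u v φ S r B a) {κ ρ : ℝ} {Θ Ξ : Plane → Plane} {W : Set Plane}
    (hn : IsNormalForm F S κ ρ Θ Ξ W) (hW : ∀ q ∈ W, |v (q - S)| < r) {s ξ : ℝ} (hξ : |ξ| < ρ)
    (hs : φ s (a, 0) = Θ (ξ, 0)) : ∃ m : ℝ → Plane, ContDiffAt ℝ 2 m a ∧ m a ∈ N ∧
      ∀ᶠ x in 𝓝[>] a, ∃ t, 0 ≤ t ∧ φ t (x, 0) = m x := by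
  -- For s < 0, flowing Θ(ξ, 0) forward along the stable axis reaches (a, 0) itself, so s = 0 serves
  -- with a smaller ξ.
  wlog hs0 : 0 ≤ s generalizing s ξ
  · have hs' : 0 ≤ -s := by linarith [not_le.1 hs0]
    have hexp : Real.exp (-(κ * -s)) ≤ 1 := by
      rw [Real.exp_le_one_iff]
      have := mul_nonneg hn.κ_pos.le hs'
      linarith
    refine this (s := 0) (ξ := ξ * Real.exp (-(κ * -s))) ?_ ?_ le_rfl
    · rw [abs_mul, abs_of_pos (Real.exp_pos _)]
      exact (mul_le_of_le_one_right (abs_nonneg _) hexp).trans_lt hξ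
    · have h1 := hn.flow_eq h.flow (z := (ξ, 0)) hs' hξ (by simpa using hn.ρ_pos)
      simp only [zero_mul] at h1
      rw [← h1, ← hs, ← h.flow.add, neg_add_cancel]
  have hline : Continuous fun x : ℝ => ((x, 0) : Plane) := by fun_prop
  have hright : ∀ᶠ x in 𝓝[>] a, ∀ t, 0 ≤ t → -r ≤ v (φ t (x, 0) - S) := by
    filter_upwards [self_mem_nhdsWithin,
      nhdsWithin_le_nhds ((h.isOpen_B.preimage hline).mem_nhds ha.mem)] with x hx hxB
    exact (h.right_of ha hx hxB).2.1
  obtain ⟨m, hm, hlim, hmr, hev⟩ :=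
    h.saddle.exists_exit_curve h.flow h.zero hn hs0 hξ hs hW hright
  refine ⟨m, hm, ?_, hev⟩
  have hr := h.pos
  have hcone := h.saddle.unstable_cone h.flow h.zero hlim
  have hp := h.saddle.conePair_zero h.flow h.zero (m a)
  have h1 : φ T (φ (-T) (m a)) = m a := by rw [← h.flow.add, add_neg_cancel, h.flow.zero]
  rw [← h1]
  refine h.passage _ ?_ (by rw [h1, hmr])
  have hmr0 : v (φ 0 (m a) - S) = r := by rw [h.flow.zero, hmr]
  have hT : -T ≤ 0 := by linarith [h.time_nonneg]
  have hc := hcone (-T)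
  have hc' : |u (φ (-T) (m a) - S)| ≤ |v (φ (-T) (m a) - S)| := hc.trans (by
    linarith [abs_nonneg (v (φ (-T) (m a) - S))])
  rcases lt_trichotomy (v (φ (-T) (m a) - S)) 0 with h2 | h2 | h2
  · have h3 := (hp.neg.cone_le hT (neg_pos.2 h2) (by
      rw [abs_neg]; rwa [abs_of_neg h2] at hc')).2
    have h4 : 0 < -v (φ (-T) (m a) - S) * Real.exp (lam / 2 * (0 - -T)) :=
      mul_pos (neg_pos.2 h2) (Real.exp_pos _)
    rw [hmr0] at h3
    linarith
  · rw [h2, abs_zero] at hc'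
    linarith
  · have h3 := (hp.cone_le hT h2 (by rwa [abs_of_pos h2] at hc')).2
    have h4 : 1 ≤ Real.exp (lam / 2 * (0 - -T)) := by
      rw [Real.one_le_exp_iff]
      have := h.saddle.pos
      have := h.time_nonneg
      rw [zero_sub, neg_neg]
      positivity
    rw [hmr0] at h3
    rw [abs_of_pos h2] at hc'
    exact hc'.trans ((le_mul_of_one_le_right h2.le h4).trans h3)

/-- The end point of the domain of the return map, with a `C²` curve that describes the returns. -/
theorem exists_endpoint (h : IsReturnSetup X Y u v lam F φ S r T L C B N G Q)
    (hX : IsResonantLinearizableAt X S) : ∃ a m, IsLeftBound u v φ S r B a ∧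
      (0 < S.2 → 0 < (F (a, 0)).2) ∧ (S.2 ≤ 0 → (F (a, 0)).2 = 0) ∧ (S.2 = 0 → (a, 0) = S) ∧
      (0 < S.2 → (∀ t > 0, 0 < (φ t (a, 0)).2) ∧ Tendsto (fun t => φ t (a, 0)) atTop (𝓝 S) ∧
        ∀ t, 0 ≤ t → |u (φ t (a, 0) - S)| ≤ r ∧ |v (φ t (a, 0) - S)| ≤ r / 4) ∧
      ContDiffAt ℝ 2 m a ∧ m a ∈ N ∧ ∀ᶠ x in 𝓝[>] a, ∃ t, 0 ≤ t ∧ φ t (x, 0) = m x := by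
  have hr := h.pos
  rcases lt_or_ge S.2 0 with hS | hS
  · obtain ⟨a, m, h1, h2, h3, h4, h5⟩ := h.exists_fold_endpoint hS
    exact ⟨a, m, h1, fun h0 => absurd h0 (not_lt.2 hS.le), fun _ => h2, fun h0 => absurd h0 hS.ne,
      fun h0 => absurd h0 (not_lt.2 hS.le), h3, h4, h5⟩
  have hSG : S ∈ G := h.box S (by simpa using hr.le) (by simpa using hr.le)
  have hG : G ∩ {q | |v (q - S)| < r} ∈ 𝓝 S := by
    refine inter_mem (h.isOpen_G.mem_nhds hSG)
      ((isOpen_lt (by fun_prop) continuous_const).mem_nhds ?_)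
    simpa using hr
  obtain ⟨κ, ρ, Θ, Ξ, W, hn, hWG⟩ :=
    hX.exists_isNormalForm hG (h.eqOn.mono inter_subset_left)
  have hW : ∀ q ∈ W, |v (q - S)| < r := fun q hq => (hWG hq).2
  rcases hS.eq_or_lt with hS0 | hS0
  · have hSa : ((S.1, 0) : Plane) = S := Prod.ext rfl hS0
    have horb := h.flow.orbit_of_zero h.zero
    have ha : IsLeftBound u v φ S r B S.1 := by
      refine ⟨fun t _ => ?_, fun t _ => ?_, ?_⟩ <;> rw [hSa]
      · rw [horb]; exact hS
      · rw [horb]; simpa using hr.le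
      · exact h.mem_B S (by simp) (by simp)
    obtain ⟨m, hm⟩ := h.exists_exit ha hn hW (s := 0) (ξ := 0) (by simpa using hn.ρ_pos) (by
      rw [h.flow.zero, hSa]; exact hn.map_zero.symm)
    refine ⟨S.1, m, ha, fun h0 => absurd hS0 h0.ne, fun _ => ?_, fun _ => hSa,
      fun h0 => absurd hS0 h0.ne, hm⟩
    rw [hSa, h.zero]; rfl
  · obtain ⟨ξ, hξ, huξ⟩ := h.saddle.exists_lower_stable h.flow hn
    obtain ⟨a, s, hs, hlim, hy, hu, hv, hF⟩ := h.saddle.exists_stable_point h.flow h.zero hS0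
      (hn.tendsto_stable h.flow hξ) huξ
    have habs : |S.2| = S.2 := abs_of_pos hS0
    have hh := h.height
    rw [habs] at hh
    have ha : IsLeftBound u v φ S r B a := by
      refine ⟨fun t ht => ?_, fun t ht => ?_, h.mem_B _ ?_ ?_⟩
      · rcases ht.eq_or_lt with h0 | h0
        · rw [← h0, h.flow.zero]
        · exact (hy t h0).le
      · linarith [(abs_le.1 (hv t ht)).1]
      · have := hu 0 le_rfl
        rwa [h.flow.zero, ← habs] at this
      · have := hv 0 le_rfl
        rw [h.flow.zero] at this
        rw [habs]; linarith
    obtain ⟨m, hm⟩ := h.exists_exit ha hn hW hξ hs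
    exact ⟨a, m, ha, fun _ => hF, fun h0 => absurd hS0 (not_lt.2 h0), fun h0 => absurd h0 hS0.ne',
      fun _ => ⟨hy, hlim, fun t ht => ⟨by linarith [hu t ht], by linarith [hv t ht]⟩⟩, hm⟩

/-- To the right of a the trajectory follows the cycle back to Σ, so it cannot remain in Σ⁺. -/
theorem not_stable_right (h : IsReturnSetup X Y u v lam F φ S r T L C B N G Q)
    (ha : IsLeftBound u v φ S r B a) {x : ℝ} (hax : a < x) (hx : (x, 0) ∈ B) {γ : ℝ → Plane}
    (hγ : IsIntegralCurveOn γ (fun _ => X) (Ici 0)) (hγ0 : γ 0 = (x, 0)) :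
    ∃ t > 0, (γ t).2 = 0 := by
  obtain ⟨-, -, ⟨s, hs, hvs, hbox⟩, -⟩ := h.right_of ha hax hx
  have hr := h.pos
  have h1 : γ s = φ s (x, 0) := by
    refine integralCurveOn_eqOn h.contDiff_fst (hγ.mono Icc_subset_Ici_self)
      (h.isIntegralCurveOn (q := (x, 0)) (s := Icc 0 s) fun t ht => h.box _ ?_ ?_) (by
        rw [hγ0, h.flow.zero]) (right_mem_Icc.2 hs.le)
    · linarith [(hbox t ht).1]
    · linarith [(hbox t ht).2]
  have hN := h.mem_N_of_le hx hs.le hvs fun t ht => (hbox t ht).1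
  obtain ⟨p, ⟨t, η, ht, hη, hη0, hηt, -⟩, -, -⟩ := h.arc _ hN
  refine ⟨t + s, by positivity, ?_⟩
  have h2 : IsIntegralCurveOn (fun t => γ (t + s)) (fun _ => X) (Icc 0 t) := by
    refine (hγ.comp_add s).mono fun w hw => ?_
    rw [mem_vadd_set_iff_neg_vadd_mem, neg_neg, vadd_eq_add]
    exact add_nonneg hs.le hw.1
  have h3 := integralCurveOn_eqOn h.contDiff_fst h2 hη (by
    simp only [zero_add]; rw [h1, hη0]) (right_mem_Icc.2 ht.le)
  simp only at h3
  rw [h3, hηt]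

/-- To the left of a the difference with the stable orbit drives v down to -r while |u| ≤ r/4. As
|β| ≤ r/4, the height β + u + v is then negative. -/
theorem not_stable_left (h : IsReturnSetup X Y u v lam F φ S r T L C B N G Q)
    (hv : ∀ t, 0 ≤ t → |v (φ t (a, 0) - S)| ≤ r / 4) {x : ℝ} (hxa : x < a)
    (hx : (x, 0) ∈ B) {γ : ℝ → Plane} (hγ : IsIntegralCurveOn γ (fun _ => X) (Ici 0))
    (hγ0 : γ 0 = (x, 0)) : ∃ t > 0, (γ t).2 < 0 := by
  have hr := h.pos
  have hl := h.saddle.pos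
  have hd := h.saddle.conePair_sub h.flow (a, 0) (x, 0)
  set δ := (a - x) * v (1, 0) with hδ
  have hδ0 : 0 < δ := mul_pos (by linarith) h.saddle.dir_pos
  have hsub : ((a, 0) : Plane) - (x, 0) = (a - x, 0) := by simp
  have hg0 : v (φ 0 (a, 0) - φ 0 (x, 0)) = δ := by
    rw [h.flow.zero, h.flow.zero, hsub, h.saddle.snd_horizontal (a - x)]
  have hf0 : |u (φ 0 (a, 0) - φ 0 (x, 0))| = δ := by
    rw [h.flow.zero, h.flow.zero, hsub, h.saddle.fst_horizontal (a - x), abs_neg, abs_of_pos hδ0]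
  have hgrow : ∀ t, 0 ≤ t →
      δ * Real.exp (lam / 2 * t) ≤ v (φ t (a, 0) - S) - v (φ t (x, 0) - S) := by
    intro t ht
    have h1 := (hd.cone_le ht (by rw [hg0]; exact hδ0) (by rw [hg0, hf0])).2
    rw [hg0, sub_zero] at h1
    rwa [← map_sub, sub_sub_sub_cancel_right]
  have hc : Continuous fun t => -v (φ t (x, 0) - S) := by
    have := h.flow.continuous_orbit (x, 0)
    fun_prop
  have hs := h.start_le hx
  obtain ⟨s, hs0, hvs, hvs'⟩ := exists_first_hit hc (r := r) (by
    simp only [h.flow.zero]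
    linarith [(abs_lt.1 hs.2).1]) (by
    have ht : 0 ≤ (r / 4 + r) * 2 / (lam * δ) := by positivity
    refine ⟨_, ht, ?_⟩
    have h1 := hgrow _ ht
    have h2 := mul_le_mul_of_nonneg_left (Real.add_one_le_exp
      (lam / 2 * ((r / 4 + r) * 2 / (lam * δ)))) hδ0.le
    have h3 : δ * (lam / 2 * ((r / 4 + r) * 2 / (lam * δ)) + 1) = r / 4 + r + δ := by
      field_simp
    linarith [(abs_le.1 (hv _ ht)).2])
  have hvb : ∀ t ∈ Icc 0 s, |v (φ t (x, 0) - S)| ≤ 4 * (r / 4) := by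
    intro t ht
    have h1 := hgrow t ht.1
    have h2 := mul_pos hδ0 (Real.exp_pos (lam / 2 * t))
    refine abs_le.2 ⟨?_, ?_⟩
    · linarith [hvs' t ht]
    · linarith [(abs_le.1 (hv t ht.1)).2]
  have hub : ∀ t ∈ Icc 0 s, |u (φ t (x, 0) - S)| ≤ r / 4 := fun t ht =>
    (h.saddle.conePair_zero h.flow h.zero (x, 0)).fst_le_of_snd_le ht.1
      (fun w hw => hvb w ⟨hw.1, hw.2.trans ht.2⟩) (by simpa only [h.flow.zero] using hs.1)
  have h1 : γ s = φ s (x, 0) := by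
    refine integralCurveOn_eqOn h.contDiff_fst (hγ.mono Icc_subset_Ici_self)
      (h.isIntegralCurveOn (q := (x, 0)) (s := Icc 0 s) fun t ht => h.box _ ?_ ?_) (by
        rw [hγ0, h.flow.zero]) (right_mem_Icc.2 hs0.le)
    · linarith [hub t ht]
    · linarith [hvb t ht]
  refine ⟨s, hs0, ?_⟩
  rw [h1]
  have h2 := h.saddle.add (φ s (x, 0) - S)
  rw [Prod.snd_sub] at h2
  have h3 := (abs_le.1 (hub s ⟨hs0.le, le_rfl⟩)).2
  have h4 := (abs_le.1 h.height).2
  linarith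

/-- The conclusion on the end point and on the first return map. -/
theorem exists_returnMap (h : IsReturnSetup X Y u v lam F φ S r T L C B N G Q)
    (hX : IsResonantLinearizableAt X S) :
    ∃ a : ℝ, (a, 0) ∈ B ∧ IsReturnEndpoint X S a ∧
      (∀ a' : ℝ, (a', 0) ∈ B → IsReturnEndpoint X S a' → a' = a) ∧
      (∃ (δ : ℝ) (π : ℝ → ℝ), IsFirstReturnMap X Y a δ π) ∧
      ∀ (δ : ℝ) (π : ℝ → ℝ), IsFirstReturnMap X Y a δ π →
        ∃ k₁ k₂ : ℝ,
          ((fun x : ℝ => (π (a + x) - a) - ((π a - a) + k₁ * x + k₂ * x ^ 2))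
            =o[𝓝[≥] 0] fun x : ℝ => x ^ 2) ∧
          (0 < S.2 → 0 < |k₁| ∧ |k₁| < 1) ∧ (S.2 ≤ 0 → k₁ = 0 ∧ 0 < k₂) := by
  have hr := h.pos
  have hSG : S ∈ G := h.box S (by simpa using hr.le) (by simpa using hr.le)
  have hdiv : planeDiv F S = 0 := by
    rw [← planeDiv_congr (F := X) (by
      filter_upwards [h.isOpen_G.mem_nhds hSG] with p hp using h.eqOn hp)]
    exact hX.planeDiv_eq_zero (h.contDiff_fst.differentiable one_ne_zero S)
  obtain ⟨a, m, ha, hpos, hzero, hS0, hst, hm, hmN, hev⟩ := h.exists_endpoint hX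
  refine ⟨a, ha.mem, ⟨fun hS => ?_, hS0, fun hS => ⟨fun t => φ t (a, 0), ?_, h.flow.zero _,
    fun t ht => (hst hS).1 t ht, (hst hS).2.1⟩⟩, fun a' ha' hend => ?_,
    h.exists_firstReturnMap ha hdiv hm hmN hev hpos hzero⟩
  · rw [h.eqOn (h.mem_G_of_mem_B ha.mem)]
    exact hzero hS.le
  · refine h.isIntegralCurveOn fun t ht => ?_
    obtain ⟨h1, h2⟩ := (hst hS).2.2 t ht
    exact h.box _ (by linarith) (by linarith)
  · rcases lt_trichotomy S.2 0 with hS | hS | hS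
    · have h1 := hend.1 hS
      rw [h.eqOn (h.mem_G_of_mem_B ha')] at h1
      have h2 := hzero hS.le
      have hk : 0 < 7 / 4 * lam * v (1, 0) := by
        have := h.saddle.pos
        have := h.saddle.dir_pos
        positivity
      rcases lt_trichotomy a' a with h3 | h3 | h3
      · have h4 := h.saddle.horizontal_le h3.le
        have := mul_pos hk (sub_pos.2 h3)
        linarith
      · exact h3
      · have h4 := h.saddle.horizontal_le h3.le
        have := mul_pos hk (sub_pos.2 h3)
        linarith
    · exact congrArg Prod.fst ((hend.2.1 hS).trans (hS0 hS).symm)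
    · obtain ⟨γ, hγ, hγ0, hγu, -⟩ := hend.2.2 hS
      rcases lt_trichotomy a' a with h3 | h3 | h3
      · obtain ⟨t, ht, h4⟩ := h.not_stable_left (fun t ht => ((hst hS).2.2 t ht).2) h3 ha' hγ hγ0
        have h5 : 0 < (γ t).2 := hγu t ht
        linarith
      · exact h3
      · obtain ⟨t, ht, h4⟩ := h.not_stable_right ha h3 ha' hγ hγ0
        have h5 : 0 < (γ t).2 := hγu t ht
        linarith

end IsReturnSetup

/-! ### Construction of a return setup for all fields near the degenerate cycle. -/

theorem div_mem_of_mem {x y K : ℝ} (hK : 0 < K) (hx : K⁻¹ ≤ x) (hx' : x ≤ K) (hy : K⁻¹ ≤ y)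
    (hy' : y ≤ K) : (K ^ 2)⁻¹ ≤ x / y ∧ x / y ≤ K ^ 2 := by
  have hK' : 0 < K⁻¹ := inv_pos.2 hK
  have hy0 : 0 < y := hK'.trans_le hy
  rw [le_div_iff₀ hy0, div_le_iff₀ hy0]
  constructor
  · calc (K ^ 2)⁻¹ * y ≤ (K ^ 2)⁻¹ * K := by gcongr
      _ = K⁻¹ := by field_simp
      _ ≤ x := hx
  · calc x ≤ K := hx'
      _ = K ^ 2 * K⁻¹ := by field_simp
      _ ≤ K ^ 2 * y := by gcongr

theorem exists_height_bounds {Y₀ : Plane → Plane} (hY₀ : Continuous Y₀) {P : Plane}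
    (hP : (Y₀ P).2 < 0) : ∃ δ > 0, ∃ R > 0, ∃ ε > 0, ∃ K > 0, ∀ Y, IsJetClose R ε Y Y₀ →
      ∀ q ∈ Metric.ball P δ, K⁻¹ ≤ -(Y q).2 ∧ -(Y q).2 ≤ K := by
  set m := -(Y₀ P).2 with hm
  have hm0 : 0 < m := by linarith
  have hc : Continuous fun q => -(Y₀ q).2 := by fun_prop
  obtain ⟨δ, hδ, h1⟩ := Metric.eventually_nhds_iff_ball.1
    ((hc.continuousAt.eventually (lt_mem_nhds (show m / 2 < -(Y₀ P).2 by linarith))).and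
      (hc.continuousAt.eventually (gt_mem_nhds (show -(Y₀ P).2 < 2 * m by linarith))))
  refine ⟨δ, hδ, ‖P‖ + δ, by positivity, m / 4, by positivity, max (4 / m) (3 * m), by positivity,
    fun Y hY q hq => ?_⟩
  have h2 := hY.dist_le q (by
    rw [mem_closedBall_zero_iff]
    have h3 := norm_le_norm_add_norm_sub' q P
    rw [Metric.mem_ball, dist_eq_norm] at hq
    linarith)
  have h3 : |(Y q).2 - (Y₀ q).2| ≤ m / 4 := by
    refine le_trans ?_ h2
    exact le_max_right (dist (Y q).1 (Y₀ q).1) (dist (Y q).2 (Y₀ q).2)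
  have h4 := abs_le.1 h3
  have h5 := h1 q hq
  have h6 : (max (4 / m) (3 * m))⁻¹ ≤ m / 4 := by
    refine (inv_anti₀ (show 0 < 4 / m by positivity) (le_max_left _ _)).trans_eq (inv_div _ _)
  exact ⟨by linarith [h4.2, h5.1], by linarith [h4.1, h5.2, le_max_right (4 / m) (3 * m)]⟩

/-- Near a point `E` of a trajectory that returns to `Σ`, the return to `Σ` is a `C²` map, with a
differential that is controlled uniformly in `(X, Y)`. -/
theorem exists_return_family {X₀ Y₀ : Plane → Plane} (hX₀ : ContDiff ℝ 2 X₀)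
    (hY₀ : ContDiff ℝ 2 Y₀) {E : Plane} (hE : 0 < E.2) {p x₀ : ℝ}
    (hX : HasArc X₀ upperSide E (p, 0)) (hXp : (X₀ (p, 0)).2 < 0) (hYp : (Y₀ (p, 0)).2 < 0)
    (hY : HasArc Y₀ lowerSide (p, 0) (x₀, 0)) (hY0 : 0 < (Y₀ (x₀, 0)).2) :
    ∃ R > 0, ∃ ε > 0, ∃ ρ > 0, ∃ C > 0, ∀ X Y, ContDiff ℝ 2 X → ContDiff ℝ 2 Y →
      IsJetClose R ε X X₀ → IsJetClose R ε Y Y₀ → ∃ Q : Plane → ℝ, ∀ q ∈ Metric.ball E ρ,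
        0 < q.2 ∧ (∃ p : ℝ, HasArc X upperSide q (p, 0) ∧ (p, 0) ∈ crossingRegion X Y ∧
          HasArc Y lowerSide (p, 0) (Q q, 0)) ∧ ContDiffAt ℝ 2 Q q ∧
        ∃ k, C⁻¹ ≤ k ∧ k ≤ C ∧ ∀ w, fderiv ℝ Q q w = k * areaForm w (X q) := by
  have hup : {q : Plane | 0 < 1 * q.2} = upperSide := by ext; simp [upperSide]
  have hlow : {q : Plane | 0 < -1 * q.2} = lowerSide := by ext; simp [lowerSide]
  obtain ⟨T₂, γ₂, hT₂, hγ₂, hγ₂0, hγ₂T, hγ₂D⟩ := hY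
  obtain ⟨R₂, -, ε₂, hε₂, ρ₂, hρ₂, K₂, hK₂, hfam₂⟩ :=
    exists_arc_family hY₀ (σ := -1) hT₂ (by simp) hγ₂
    (fun t ht => hlow.ge (hγ₂D t ht)) (by rw [hγ₂T]) (by rw [hγ₂T]; linarith)
    (Or.inr (by rw [hγ₂0]; linarith)) one_pos
  rw [hγ₂0] at hfam₂
  obtain ⟨δ, hδ, R₃, -, ε₃, hε₃, K₃, hK₃, hbd⟩ := exists_height_bounds hY₀.continuous hYp
  obtain ⟨T₁, γ₁, hT₁, hγ₁, hγ₁0, hγ₁T, hγ₁D⟩ := hX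
  obtain ⟨R₁, hR₁, ε₁, hε₁, ρ₁, hρ₁, K₁, hK₁, hfam₁⟩ := exists_arc_family hX₀ (σ := 1) hT₁ (by simp)
    hγ₁ (fun t ht => hup.ge (hγ₁D t ht)) (by rw [hγ₁T]) (by rw [hγ₁T]; linarith)
    (Or.inl (by rw [hγ₁0]; linarith)) (show 0 < min ρ₂ δ by positivity)
  rw [hγ₁0, hγ₁T] at hfam₁
  refine ⟨max R₁ (max R₂ R₃), lt_max_of_lt_left hR₁, min ε₁ (min ε₂ ε₃), by positivity,
    min ρ₁ E.2, by positivity, K₁ ^ 2 * K₂ ^ 2 * K₃, by positivity, fun X Y hX hY hXX hYY => ?_⟩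
  obtain ⟨Q₁, hQ₁⟩ := hfam₁ X hX (hXX.mono (le_max_left _ _) (min_le_left _ _))
  obtain ⟨Q₂, hQ₂⟩ := hfam₂ Y hY (hYY.mono ((le_max_left _ _).trans (le_max_right _ _))
    ((min_le_right _ _).trans (min_le_left _ _)))
  have hY' := hbd Y (hYY.mono ((le_max_right _ _).trans (le_max_right _ _))
    ((min_le_right _ _).trans (min_le_right _ _)))
  refine ⟨fun q => Q₂ (Q₁ q, 0), fun q hq => ?_⟩
  have hqE : 0 < q.2 := by
    have h1 : dist q.2 E.2 ≤ dist q E := le_max_right _ _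
    have h2 := (Metric.mem_ball.1 hq).trans_le (min_le_right _ _)
    rw [Real.dist_eq] at h1
    linarith [(abs_le.1 h1).1]
  obtain ⟨harc₁, hd, hc₁, hx1, hx2, J₁, hJ₁, hJ₁', hder₁⟩ :=
    hQ₁ q (Metric.ball_subset_ball (min_le_left _ _) hq)
  have hp₂ : ((Q₁ q, 0) : Plane) ∈ Metric.ball ((p, 0) : Plane) ρ₂ :=
    hd.trans_le (min_le_left _ _)
  obtain ⟨hy1, hy2⟩ := hY' (Q₁ q, 0) (hd.trans_le (min_le_right _ _))
  obtain ⟨harc₂, -, hc₂, hz1, hz2, J₂, hJ₂, hJ₂', hder₂⟩ := hQ₂ _ hp₂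
  rw [one_mul] at hx1 hx2
  rw [neg_one_mul, neg_neg] at hz1 hz2
  have hx0 : 0 < -(X (Q₁ q, 0)).2 := (inv_pos.2 hK₁).trans_le hx1
  have hy0 : 0 < -(Y (Q₁ q, 0)).2 := (inv_pos.2 hK₃).trans_le hy1
  have hz0 : 0 < (Y (Q₂ (Q₁ q, 0), 0)).2 := (inv_pos.2 hK₂).trans_le hz1
  refine ⟨hqE, ⟨Q₁ q, hup ▸ harc₁ (by linarith), ⟨rfl, mul_pos_of_neg_of_neg (by linarith)
    (by linarith)⟩, hlow ▸ harc₂ (by simp)⟩, ?_, ?_⟩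
  · exact ContDiffAt.comp q (g := Q₂) hc₂ (hc₁.prodMk contDiffAt_const)
  obtain ⟨h1, h1'⟩ := div_mem_of_mem hK₁ hJ₁ hJ₁' hx1 hx2
  obtain ⟨h2, h2'⟩ := div_mem_of_mem hK₂ hJ₂ hJ₂' hz1 hz2
  -- Each arc contributes its Jacobian over the normal speed at arrival. The last factor is the area
  -- of (1, 0) and Y where the second arc starts; the two minus signs cancel.
  refine ⟨J₁ / (-(X (Q₁ q, 0)).2) * (J₂ / (Y (Q₂ (Q₁ q, 0), 0)).2) * (-(Y (Q₁ q, 0)).2), ?_, ?_,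
    fun w => ?_⟩
  · rw [mul_inv, mul_inv]
    have := (inv_pos.2 (pow_pos hK₁ 2)).le.trans h1
    have := (inv_pos.2 (pow_pos hK₂ 2)).le.trans h2
    gcongr
  · have := (inv_pos.2 (pow_pos hK₂ 2)).le.trans h2
    gcongr
  · have h3 : HasFDerivAt (fun q => ((Q₁ q, 0) : Plane))
        ((fderiv ℝ Q₁ q).prod (0 : Plane →L[ℝ] ℝ)) q :=
      (hc₁.differentiableAt two_ne_zero).hasFDerivAt.prodMk (hasFDerivAt_const 0 q)
    have h4 : HasFDerivAt (fun q => Q₂ (Q₁ q, 0))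
        (fderiv ℝ Q₂ (Q₁ q, 0) ∘L (fderiv ℝ Q₁ q).prod (0 : Plane →L[ℝ] ℝ)) q :=
      HasFDerivAt.comp q (g := Q₂) (hc₂.differentiableAt two_ne_zero).hasFDerivAt h3
    have h5 : (((fderiv ℝ Q₁ q w, 0) : Plane)) = fderiv ℝ Q₁ q w • ((1, 0) : Plane) := by simp
    have h6 : fderiv ℝ (fun q => Q₂ (Q₁ q, 0)) q w =
        fderiv ℝ Q₁ q w * fderiv ℝ Q₂ (Q₁ q, 0) (1, 0) := by
      rw [h4.fderiv, ContinuousLinearMap.comp_apply, ContinuousLinearMap.prod_apply,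
        zero_apply, h5, map_smul, smul_eq_mul]
    have h7 := hder₁ w
    have h8 := hder₂ (1, 0)
    have h9 : areaForm (1, 0) (Y (Q₁ q, 0)) = (Y (Q₁ q, 0)).2 := by simp [areaForm]
    rw [h9] at h8
    have hx0' : (X (Q₁ q, 0)).2 ≠ 0 := by linarith
    rw [h6, eq_div_of_mul_eq hx0' h7, eq_div_of_mul_eq hz0.ne' h8]
    field_simp

theorem isJetClose_self {R ε : ℝ} (hε : 0 < ε) {X : Plane → Plane} (hX : ContDiff ℝ 2 X) :
    IsJetClose R ε X X :=
  (SmoothField.eventually_isJetClose le_rfl (⟨X, hX⟩ : SmoothField 2) R hε).self_of_nhds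

theorem isSaddleField_cutoffField {u v : Plane →L[ℝ] ℝ} {lam : ℝ} {D : Plane →L[ℝ] Plane}
    (hD : IsSaddleField u v lam D) (hu : ∀ q, u (D q) = -(lam * u q))
    (hv : ∀ q, v (D q) = lam * v q) {C : ℝ} (hC : ∀ q, ‖q‖ ≤ C * (|u q| + |v q|))
    {κ : NNReal} (hκu : ‖u‖ * (κ * C) ≤ lam / 16) (hκv : ‖v‖ * (κ * C) ≤ lam / 16)
    {χ : Plane → ℝ} {X : Plane → Plane} (hg : LipschitzWith κ fun q => χ q • (X q - D q)) :
    IsSaddleField u v lam (cutoffField χ D X) := by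
  have key : ∀ (w : Plane →L[ℝ] ℝ), ‖w‖ * (κ * C) ≤ lam / 16 → ∀ p q : Plane,
      |w (χ p • (X p - D p) - χ q • (X q - D q))| ≤ lam / 16 * (|u (p - q)| + |v (p - q)|) := by
    intro w hw p q
    have h1 := w.le_opNorm (χ p • (X p - D p) - χ q • (X q - D q))
    have h2 := hg.dist_le_mul p q
    rw [dist_eq_norm, dist_eq_norm] at h2
    have h3 := hC (p - q)
    calc |w (χ p • (X p - D p) - χ q • (X q - D q))|
        ≤ ‖w‖ * (κ * (C * (|u (p - q)| + |v (p - q)|))) := by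
          refine h1.trans ?_
          gcongr
          exact h2.trans (by gcongr)
      _ = ‖w‖ * (κ * C) * (|u (p - q)| + |v (p - q)|) := by ring
      _ ≤ _ := by gcongr
  have hsplit : ∀ p q, cutoffField χ D X p - cutoffField χ D X q =
      D (p - q) + (χ p • (X p - D p) - χ q • (X q - D q)) := fun p q => by
    simp only [cutoffField, map_sub]; abel
  refine ⟨hD.pos, hD.add, hD.dir_pos, fun p q => ?_, fun p q => ?_⟩
  · rw [hsplit, map_add, hu]
    convert key u hκu p q using 2
    ring
  · rw [hsplit, map_add, hv]
    convert key v hκv p q using 2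
    ring

/-- The crossing direction at the end of an arc that ends transversally on `Σ`. -/
theorem snd_neg_of_arc {F : Plane → Plane} {γ : ℝ → Plane}
    (hγ : IsIntegralCurveOn γ (fun _ => F) (Iic 0)) (h0 : (γ 0).2 = 0)
    (hpos : ∀ t < 0, 0 < (γ t).2) (hne : (F (γ 0)).2 ≠ 0) : (F (γ 0)).2 < 0 := by
  refine lt_of_le_of_ne ?_ hne
  have h1 : HasDerivWithinAt (fun t => (γ t).2) (F (γ 0)).2 (Iic 0) 0 := (hγ 0 self_mem_Iic).snd
  have h2 := hasDerivWithinAt_iff_tendsto_slope.1 h1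
  rw [show Iic (0 : ℝ) \ {0} = Iio 0 from Iic_sdiff_right] at h2
  refine le_of_tendsto h2 ?_
  filter_upwards [self_mem_nhdsWithin] with t ht
  have ht' : t < 0 := ht
  rw [slope_def_field, h0, sub_zero, sub_zero]
  exact div_nonpos_of_nonneg_of_nonpos (hpos t ht).le ht'.le

theorem HasArc.snd_neg {F : Plane → Plane} {p q : Plane}
    (h : HasArc F lowerSide p q) (hp : p.2 = 0) (hne : (F p).2 ≠ 0) : (F p).2 < 0 := by
  obtain ⟨T, γ, hT, hγ, hγ0, -, hD⟩ := h
  refine lt_of_le_of_ne ?_ hne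
  have h1 : HasDerivWithinAt (fun t => (γ t).2) (F p).2 (Ioi 0) 0 := by
    have h2 : HasDerivWithinAt (fun t => (γ t).2) (F (γ 0)).2 (Icc 0 T) 0 :=
      (hγ 0 ⟨le_rfl, hT.le⟩).snd
    rw [hγ0] at h2
    refine h2.mono_of_mem_nhdsWithin ?_
    exact mem_of_superset (Ioo_mem_nhdsGT hT) Ioo_subset_Icc_self
  have h2 := hasDerivWithinAt_iff_tendsto_slope.1 h1
  rw [show Ioi (0 : ℝ) \ {0} = Ioi 0 from sdiff_singleton_eq_self (by simp)] at h2
  refine le_of_tendsto h2 ?_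
  filter_upwards [Ioo_mem_nhdsGT hT] with t ht
  rw [slope_def_field, hγ0, hp, sub_zero, sub_zero]
  have h3 : (γ t).2 < 0 := hD t ht
  exact div_nonpos_of_nonpos_of_nonneg h3.le ht.1.le

/-- A degenerate cycle whose saddle has trace `0`: nearby fields admit a return setup. -/
theorem HasDegenerateCycle.exists_isReturnSetup {X₀ Y₀ : Plane → Plane} (hX₀ : ContDiff ℝ 2 X₀)
    (hY₀ : ContDiff ℝ 2 Y₀) (hc : HasDegenerateCycle X₀ Y₀) (hs : SlidingLeftCrossingRight X₀ Y₀)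
    (htr : planeDiv X₀ 0 = 0) : ∃ b > 0, ∃ R > 0, ∃ ε > 0, ∀ X Y, ContDiff ℝ 2 X → ContDiff ℝ 2 Y →
      IsJetClose R ε X X₀ → IsJetClose R ε Y Y₀ → ∃ S ∈ Metric.ball (0 : Plane) b,
        IsHyperbolicSaddle X S ∧ (∀ q ∈ Metric.ball (0 : Plane) b, X q = 0 → q = S) ∧
        ∃ u v lam F φ r T L C N G Q,
          IsReturnSetup X Y u v lam F φ S r T L C (Metric.ball 0 b) N G Q := by
  obtain ⟨hY0, hcpos⟩ := hc.deriv_height_pos hs (hX₀.differentiable two_ne_zero 0) hY₀.continuous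
  obtain ⟨u, v, lam, hlam, hadd, hdir, hu, hv⟩ :=
    exists_saddle_coordinates hc.saddle.planeDet_neg htr hcpos
  set D := fderiv ℝ X₀ 0 with hD
  have hDs : IsSaddleField u v lam D := by
    refine ⟨hlam, hadd, hdir, fun p q => ?_, fun p q => ?_⟩ <;> rw [← map_sub]
    · rw [hu, neg_add_cancel, abs_zero]; positivity
    · rw [hv, sub_self, abs_zero]; positivity
  obtain ⟨C₀, hC₀, hnorm⟩ := hDs.exists_norm_le
  obtain ⟨κ, hκ, hκu, hκv⟩ : ∃ κ : NNReal, 0 < κ ∧ ‖u‖ * (κ * C₀) ≤ lam / 16 ∧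
      ‖v‖ * (κ * C₀) ≤ lam / 16 := by
    have h1 : 0 < lam / 16 / (C₀ * (‖u‖ + ‖v‖ + 1)) := by positivity
    refine ⟨_, Real.toNNReal_pos.2 h1, ?_, ?_⟩ <;> rw [Real.coe_toNNReal _ h1.le,
      div_mul_eq_mul_div, mul_div_assoc', div_le_iff₀ (by positivity)]
    · have : 0 ≤ lam / 16 * C₀ * (‖v‖ + 1) := by positivity
      linarith
    · have : 0 ≤ lam / 16 * C₀ * (‖u‖ + 1) := by positivity
      linarith
  obtain ⟨r₀, hr₀, χ, hχ, ε₁, hε₁, hlip⟩ := exists_cutoffField hX₀ hc.saddle.1 hκ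
  have hM : ∀ X, ContDiff ℝ 2 X → IsJetClose (2 * r₀) ε₁ X X₀ →
      IsSaddleField u v lam (cutoffField χ D X) ∧
      LipschitzWith (‖D‖₊ + κ) (cutoffField χ D X) := fun X hX hXX =>
    ⟨isSaddleField_cutoffField hDs hu hv hnorm hκu hκv (hlip X hX hXX),
      D.lipschitz.add (hlip X hX hXX)⟩
  set M := ‖D‖₊ + κ
  obtain ⟨hF₀, hF₀M⟩ := hM X₀ hX₀ (isJetClose_self hε₁ hX₀)
  obtain ⟨φ₀, hφ₀⟩ := exists_isFlow (hχ.contDiff_cutoffField hX₀) hF₀M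
  obtain ⟨p, -, ⟨γ, hγ, hγ0, hγlim, hγpos⟩, hXp, hYp, harcY⟩ := hc.connection
  have hXp' : (X₀ (p, 0)).2 < 0 := by
    have := snd_neg_of_arc hγ (by rw [hγ0]) hγpos (by rwa [hγ0])
    rwa [hγ0] at this
  have hYp' := harcY.snd_neg rfl hYp
  -- E = γ(t₀) is taken so far back that the whole earlier orbit lies where the cutoff is inactive.
  -- The bound on r = v E gives 4 C₀ r < r₀/4, so the box of size 2r around a nearby saddle stays in
  -- that region.
  obtain ⟨t₀, ht₀, hnear, hvsmall⟩ : ∃ t₀ < 0, (∀ t ≤ t₀, ‖γ t‖ < r₀) ∧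
      v (γ t₀) < r₀ / (16 * C₀) := by
    have h1 : ∀ᶠ t in atBot, ‖γ t‖ < r₀ :=
      hγlim.norm.eventually (gt_mem_nhds (by simpa using hr₀))
    have h2 : Tendsto (fun t => v (γ t)) atBot (𝓝 0) := by
      have := (v.continuous.tendsto 0).comp hγlim
      rwa [map_zero] at this
    have h3 := h2.eventually (gt_mem_nhds (show 0 < r₀ / (16 * C₀) by positivity))
    obtain ⟨t₁, ht₁⟩ := eventually_atBot.1 (h1.and h3)
    refine ⟨min t₁ (-1), (min_le_right _ _).trans_lt (by norm_num), fun t ht =>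
      (ht₁ t (ht.trans (min_le_left _ _))).1, (ht₁ _ (min_le_left _ _)).2⟩
  set E := γ t₀ with hE
  have hEorb : ∀ t ≤ 0, φ₀ t E = γ (t + t₀) := by
    intro t ht
    have h1 : IsIntegralCurveOn γ (fun _ => cutoffField χ D X₀) (Icc (t + t₀) t₀) := fun w hw => by
      have h2 := (hγ w (hw.2.trans ht₀.le)).mono (fun z hz => hz.2.trans ht₀.le :
        Icc (t + t₀) t₀ ⊆ Iic 0)
      simp only at h2 ⊢
      rwa [hχ.cutoffField_eq (by simpa using (hnear w hw.2).le)]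
    have h2 := hφ₀.eq_of_isIntegralCurveOn h1 (right_mem_Icc.2 (by linarith : t + t₀ ≤ t₀))
    rw [hE, h2, ← hφ₀.add, show t + (t₀ - (t + t₀)) = 0 by ring, hφ₀.zero]
  have hElim : Tendsto (fun t => φ₀ t E) atBot (𝓝 0) := by
    have h1 : Tendsto (fun t => γ (t + t₀)) atBot (𝓝 0) :=
      hγlim.comp (tendsto_atBot_add_const_right _ t₀ tendsto_id)
    refine h1.congr' ?_
    filter_upwards [eventually_le_atBot 0] with t ht using (hEorb t ht).symm
  have hF₀0 : cutoffField χ D X₀ 0 = 0 := by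
    rw [hχ.cutoffField_eq (Metric.mem_closedBall_self hr₀.le), hc.saddle.1]
  have hE2 : 0 < E.2 := hγpos t₀ ht₀
  -- E is above Σ and |u E| ≤ |v E|/2, so u + v > 0 forces v > 0.
  have hvE : 0 < v E := by
    have h1 := hF₀.unstable_cone hφ₀ hF₀0 hElim 0
    rw [hφ₀.zero, sub_zero] at h1
    have h2 := hadd E
    by_contra h3
    rw [abs_of_nonpos (not_lt.1 h3)] at h1
    linarith [le_abs_self (u E)]
  have harcX : HasArc X₀ upperSide E (p, 0) := by
    refine ⟨-t₀, fun t => γ (t + t₀), by linarith, ?_, by simp [hE], by simp [hγ0],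
      fun t ht => hγpos _ (by linarith [ht.2])⟩
    refine (hγ.comp_add t₀).mono fun w hw => ?_
    rw [mem_vadd_set_iff_neg_vadd_mem, neg_neg, vadd_eq_add, mem_Iic]
    linarith [hw.2]
  obtain ⟨R₂, hR₂, ε₂, hε₂, ρ₂, hρ₂, C, hC, hfam⟩ :=
    exists_return_family hX₀ hY₀ hE2 harcX hXp' hYp' (x₀ := 0) harcY hY0
  set r := v E with hr
  set ρ := min ρ₂ (r / (2 * (‖v‖ + 1))) with hρ
  have hρ0 : 0 < ρ := by positivity
  obtain ⟨T, hT, ε₃, hε₃, hpass⟩ := hF₀.exists_passage hφ₀ hElim hρ0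
  obtain ⟨K₂, hK₂0, hK₂⟩ : ∃ K₂ ≥ 0, ∀ q ∈ Metric.closedBall (0 : Plane) (2 * r₀),
      ‖fderiv ℝ (fderiv ℝ X₀) q‖ ≤ K₂ := by
    have h1 : ContDiff ℝ 1 (fderiv ℝ X₀) := hX₀.fderiv_right (by norm_num)
    obtain ⟨K, hK⟩ := (isCompact_closedBall (0 : Plane) (2 * r₀)).exists_bound_of_continuousOn
      (h1.continuous_fderiv one_ne_zero).continuousOn
    exact ⟨K, (norm_nonneg _).trans (hK 0 (Metric.mem_closedBall_self (by positivity))), hK⟩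
  set L := 2 * (K₂ + ε₁) * C₀ with hL
  have hL0 : 0 ≤ L := by positivity
  set C' := C * Real.exp (16 * L * (2 * r) / lam) with hC'
  have hC'0 : 0 < C' := by positivity
  obtain ⟨b₀, hb₀, hsad⟩ := exists_saddle hX₀ hc.saddle
  set A := ‖u‖ + ‖v‖ + 1 with hA
  have hA0 : 0 < A := by positivity
  -- b is chosen after T. Points within 2b of the saddle stay deep inside the box up to time T, and
  -- on B the normal speed is at most 2Mb, which makes the slope k₁ less than 1.
  obtain ⟨b, hb, hbb₀, hbr₀, hbsmall, hbslope⟩ : ∃ b > 0, b ≤ b₀ ∧ b ≤ r₀ ∧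
      A * (2 * b * Real.exp (M * T)) ≤ r / 8 ∧ C' * (M * (2 * b)) < 1 := by
    refine ⟨min b₀ (min r₀ (min (r / 8 / (A * (2 * Real.exp (M * T))))
      (1 / 2 / (C' * ((M + 1) * 2))))), by positivity, min_le_left _ _,
      (min_le_right _ _).trans (min_le_left _ _), ?_, ?_⟩
    · have h1 : min b₀ (min r₀ (min (r / 8 / (A * (2 * Real.exp (M * T))))
        (1 / 2 / (C' * ((M + 1) * 2))))) ≤ r / 8 / (A * (2 * Real.exp (M * T))) :=
        (min_le_right _ _).trans ((min_le_right _ _).trans (min_le_left _ _))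
      rw [le_div_iff₀ (by positivity)] at h1
      linarith
    · have h1 : min b₀ (min r₀ (min (r / 8 / (A * (2 * Real.exp (M * T))))
        (1 / 2 / (C' * ((M + 1) * 2))))) ≤ 1 / 2 / (C' * ((M + 1) * 2)) :=
        (min_le_right _ _).trans ((min_le_right _ _).trans (min_le_right _ _))
      have h0 : 0 < min b₀ (min r₀ (min (r / 8 / (A * (2 * Real.exp (M * T))))
        (1 / 2 / (C' * ((M + 1) * 2))))) := by positivity
      rw [le_div_iff₀ (by positivity)] at h1
      have := mul_pos hC'0 h0
      linarith
  -- s bounds ‖S‖. The end point has |u| and |v| at most 2s relative to S, hence lies within 4 C₀ s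
  -- of S and inside B.
  set s := min (b / (4 * C₀ + 2)) (min (r / 4) (min ε₃ (min (r₀ / 2) (r / (2 * (‖v‖ + 1))))))
    with hs
  have hs0 : 0 < s := by positivity
  have hsb : (4 * C₀ + 2) * s ≤ b := by
    rw [← le_div_iff₀' (by positivity)]; exact min_le_left _ _
  have hsr : s ≤ r / 4 := (min_le_right _ _).trans (min_le_left _ _)
  have hsε : s ≤ ε₃ := (min_le_right _ _).trans ((min_le_right _ _).trans (min_le_left _ _))
  have hsr₀ : s ≤ r₀ / 2 := (min_le_right _ _).trans ((min_le_right _ _).trans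
    ((min_le_right _ _).trans (min_le_left _ _)))
  have hsv : s ≤ r / (2 * (‖v‖ + 1)) := (min_le_right _ _).trans ((min_le_right _ _).trans
    ((min_le_right _ _).trans (min_le_right _ _)))
  obtain ⟨R₃, hR₃, ε₄, hε₄, hsad⟩ := hsad s hs0
  refine ⟨b, hb, max (2 * r₀) (max R₂ R₃), lt_max_of_lt_left (by positivity),
    min (min ε₁ ε₂) (min ε₃ ε₄), by positivity, fun X Y hX hY hXX hYY => ?_⟩
  have hX1 : IsJetClose (2 * r₀) ε₁ X X₀ :=
    hXX.mono (le_max_left _ _) ((min_le_left _ _).trans (min_le_left _ _))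
  have hX3 : IsJetClose (2 * r₀) ε₃ X X₀ :=
    hXX.mono (le_max_left _ _) ((min_le_right _ _).trans (min_le_left _ _))
  obtain ⟨S, hSs, hSsad, hSuniq⟩ := hsad X hX (hXX.mono ((le_max_right _ _).trans (le_max_right _ _))
    ((min_le_right _ _).trans (min_le_right _ _)))
  obtain ⟨Q, hQ⟩ := hfam X Y hX hY
    (hXX.mono ((le_max_left _ _).trans (le_max_right _ _))
      ((min_le_left _ _).trans (min_le_right _ _)))
    (hYY.mono ((le_max_left _ _).trans (le_max_right _ _))
      ((min_le_left _ _).trans (min_le_right _ _)))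
  have hSb : ‖S‖ < b := by
    have : 0 ≤ C₀ * s := by positivity
    linarith
  obtain ⟨hF, hFM⟩ := hM X hX hX1
  obtain ⟨φ, hφ⟩ := exists_isFlow (hχ.contDiff_cutoffField hX) hFM
  set F := cutoffField χ D X with hFdef
  have hFX : ∀ q ∈ Metric.ball (0 : Plane) r₀, X q = F q := fun q hq =>
    (hχ.cutoffField_eq (Metric.ball_subset_closedBall hq)).symm
  have hSr₀ : S ∈ Metric.ball (0 : Plane) r₀ := by
    rw [mem_ball_zero_iff]; linarith
  have hFS : F S = 0 := by rw [← hFX S hSr₀]; exact hSsad.1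
  have hbox : ∀ q, |u (q - S)| ≤ 2 * r → |v (q - S)| ≤ 2 * r → q ∈ Metric.ball (0 : Plane) r₀ := by
    intro q h1 h2
    rw [mem_ball_zero_iff]
    have h3 := hnorm (q - S)
    have h4 := norm_le_norm_add_norm_sub' q S
    have h5 : C₀ * (|u (q - S)| + |v (q - S)|) ≤ C₀ * (2 * r + 2 * r) := by gcongr
    have h6 : C₀ * (2 * r + 2 * r) < r₀ / 4 := by
      rw [lt_div_iff₀ (by positivity)] at hvsmall
      linarith
    linarith
  have hSheight : |S.2| < s := (norm_snd_le S).trans_lt hSs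
  refine ⟨S, by rwa [mem_ball_zero_iff], hSsad, fun q hq => hSuniq q
    (Metric.ball_subset_ball hbb₀ hq), u, v, lam, F, φ, r, T, L, C, Metric.ball E ρ,
    Metric.ball 0 r₀, Q, ?_⟩
  have hQ' : ∀ q ∈ Metric.ball E ρ, _ := fun q hq =>
    hQ q (Metric.ball_subset_ball (min_le_left _ _) hq)
  exact {
    contDiff_fst := hX.of_le (by norm_num)
    contDiff_snd := hY.of_le (by norm_num)
    saddle := hF
    flow := hφ
    zero := hFS
    pos := hvE
    eqOn := hFX
    isOpen_G := Metric.isOpen_ball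
    box := hbox
    time_nonneg := hT.le
    passage := fun q h1 h2 => hpass F φ S hφ
      (fun x => hχ.dist_cutoffField_le hε₃.le hX3 x) (hSs.le.trans hsε) q h1 h2
    isOpen_N := Metric.isOpen_ball
    upper := fun q hq => (hQ' q hq).1
    mem_N_le := fun q hq => by
      have h1 : v (q - S) = r + v (q - E) - v S := by simp only [map_sub, hr]; ring
      have h2 : v (q - E) ≤ ‖v‖ * ρ := (le_abs_self _).trans ((v.le_opNorm _).trans (by
        gcongr
        rw [← dist_eq_norm]
        exact (Metric.mem_ball.1 hq).le))
      have h3 : -v S ≤ ‖v‖ * s := (neg_le_abs _).trans ((v.le_opNorm _).trans (by gcongr))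
      have h4 : ‖v‖ * (r / (2 * (‖v‖ + 1))) ≤ r / 2 := by
        rw [mul_div_assoc', div_le_div_iff₀ (by positivity) two_pos]
        linarith
      have h5 : ‖v‖ * ρ ≤ ‖v‖ * (r / (2 * (‖v‖ + 1))) := by
        gcongr; exact min_le_right _ _
      have h6 : ‖v‖ * s ≤ ‖v‖ * (r / (2 * (‖v‖ + 1))) := by gcongr
      linarith
    arc := fun q hq => (hQ' q hq).2.1
    contDiffAt := fun q hq => (hQ' q hq).2.2.1
    C_pos := hC
    fderiv_eq := fun q hq => (hQ' q hq).2.2.2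
    L_nonneg := hL0
    div := fun q h1 h2 => by
      have hq := hbox q h1 h2
      have hcongr : ∀ z ∈ Metric.ball (0 : Plane) r₀, planeDiv F z = planeDiv X z := fun z hz =>
        planeDiv_congr (by
          filter_upwards [Metric.isOpen_ball.mem_nhds hz] with w hw using (hFX w hw).symm)
      rw [hcongr q hq, hcongr S hSr₀]
      refine (planeDiv_sub_le X X q S).trans ?_
      have hX' : ContDiff ℝ 1 (fderiv ℝ X) := hX.fderiv_right (by norm_num)
      have h3 := (convex_ball (0 : Plane) r₀).norm_image_sub_le_of_norm_fderiv_le (𝕜 := ℝ)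
        (f := fderiv ℝ X) (C := K₂ + ε₁) (fun z _ => hX'.differentiable one_ne_zero z)
        (fun z hz => by
          have hz' : z ∈ Metric.closedBall (0 : Plane) (2 * r₀) := by
            rw [mem_ball_zero_iff] at hz
            rw [mem_closedBall_zero_iff]
            linarith
          have h4 := norm_le_norm_add_norm_sub' (fderiv ℝ (fderiv ℝ X) z) (fderiv ℝ (fderiv ℝ X₀) z)
          linarith [hK₂ z hz', hX1.fderiv_fderiv_le z hz']) hSr₀ hq
      have h4 : (K₂ + ε₁) * ‖q - S‖ ≤ (K₂ + ε₁) * (C₀ * (|u (q - S)| + |v (q - S)|)) := by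
        gcongr
        exact hnorm _
      rw [hL]
      linarith
    isOpen_B := Metric.isOpen_ball
    small := fun q hq t ht => by
      have h1 := hφ.dist_zero_le hFM hFS ht.1 (q := q)
      have h2 : dist q S ≤ 2 * b := by
        rw [dist_eq_norm]
        have := norm_sub_le q S
        rw [mem_ball_zero_iff] at hq
        linarith
      have h3 : dist (φ t q) S ≤ 2 * b * Real.exp (M * T) := by
        refine h1.trans ?_
        gcongr
        exact ht.2
      rw [dist_eq_norm] at h3
      have h4 : ∀ w : Plane →L[ℝ] ℝ, ‖w‖ ≤ A → |w (φ t q - S)| ≤ r / 8 := fun w hw =>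
        (w.le_opNorm _).trans (le_trans (by gcongr) hbsmall)
      have h5 := h4 u (by rw [hA]; linarith [norm_nonneg v])
      have h6 := h4 v (by rw [hA]; linarith [norm_nonneg u])
      exact ⟨by linarith, by linarith⟩
    mem_B := fun q h1 h2 => by
      rw [mem_ball_zero_iff]
      have h3 := hnorm (q - S)
      have h4 := norm_le_norm_add_norm_sub' q S
      have h5 : C₀ * (|u (q - S)| + |v (q - S)|) ≤ C₀ * (2 * s + 2 * s) := by
        gcongr <;> linarith
      linarith
    height := hSheight.le.trans hsr
    slope := fun x hx => by
      have h1 := hFM.dist_le_mul (x, 0) S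
      rw [hFS, dist_zero_right, dist_eq_norm] at h1
      have h2 := norm_sub_le ((x, 0) : Plane) S
      rw [mem_ball_zero_iff] at hx
      have h3 : (F (x, 0)).2 ≤ M * (2 * b) := by
        refine (le_abs_self _).trans ((norm_snd_le (F (x, 0))).trans (h1.trans ?_))
        gcongr
        linarith
      refine lt_of_le_of_lt ?_ hbslope
      gcongr }

/-! ### The case of nonzero trace, and the conclusion. -/

/-- A degenerate cycle whose saddle has nonzero trace: the nearby saddles have nonzero trace. -/
theorem exists_saddle_of_planeDiv_ne_zero {X₀ : Plane → Plane} (hX₀ : ContDiff ℝ 2 X₀)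
    (h0 : IsHyperbolicSaddle X₀ 0) (htr : planeDiv X₀ 0 ≠ 0) : ∃ b > 0, ∃ R > 0, ∃ ε > 0,
      ∀ X, ContDiff ℝ 2 X → IsJetClose R ε X X₀ → ∃ S ∈ Metric.ball (0 : Plane) b,
        IsHyperbolicSaddle X S ∧ (∀ q ∈ Metric.ball (0 : Plane) b, X q = 0 → q = S) ∧
        ¬ IsResonantLinearizableAt X S := by
  obtain ⟨b, hb, hsad⟩ := exists_saddle hX₀ h0
  set η := |planeDiv X₀ 0| / 4 with hη
  have hη0 : 0 < η := by positivity
  obtain ⟨s, hs, hsη⟩ : ∃ s > 0, ∀ q, ‖q‖ < s → ‖fderiv ℝ X₀ q - fderiv ℝ X₀ 0‖ < η := by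
    have h1 : Continuous fun q => ‖fderiv ℝ X₀ q - fderiv ℝ X₀ 0‖ :=
      ((hX₀.continuous_fderiv two_ne_zero).sub continuous_const).norm
    obtain ⟨s, hs, h2⟩ := Metric.eventually_nhds_iff.1
      (h1.continuousAt.eventually (gt_mem_nhds (show ‖fderiv ℝ X₀ 0 - fderiv ℝ X₀ 0‖ < η by
        simpa using hη0)))
    exact ⟨s, hs, fun q hq => h2 (by rwa [dist_zero_right])⟩
  obtain ⟨R, hR, ε, hε, hsad⟩ := hsad (min s b) (by positivity)
  refine ⟨b, hb, max R b, lt_max_of_lt_left hR, min ε (η / 2), by positivity, fun X hX hXX => ?_⟩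
  obtain ⟨S, hSs, hS, huniq⟩ := hsad X hX (hXX.mono (le_max_left _ _) (min_le_left _ _))
  have hSb : ‖S‖ < b := hSs.trans_le (min_le_right _ _)
  refine ⟨S, by rwa [mem_ball_zero_iff], hS, huniq, fun hres => ?_⟩
  have h1 := hres.planeDiv_eq_zero (hX.differentiable two_ne_zero S)
  have h2 := planeDiv_sub_le X X₀ S S
  have h3 := planeDiv_sub_le X₀ X₀ S 0
  have h4 := (hXX.fderiv_le S (by simpa using Or.inr hSb.le)).trans (min_le_right _ _)
  have h5 := hsη S (hSs.trans_le (min_le_left _ _))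
  rw [h1, zero_sub, abs_neg] at h2
  have h6 := abs_sub_abs_le_abs_sub (planeDiv X₀ 0) (planeDiv X₀ S)
  rw [abs_sub_comm] at h6
  linarith

theorem mainTheorem12 (l : ℕ∞) (hl : 2 ≤ l) (Z₀ : NonsmoothField l)
    (hcycle : HasDegenerateCycle Z₀.1.1 Z₀.2.1)
    (hchart : SlidingLeftCrossingRight Z₀.1.1 Z₀.2.1) :
    ∃ B ∈ 𝓝 (0 : Plane), ∃ V ∈ 𝓝 Z₀, ∀ Z ∈ V,
      ∃ S ∈ B, IsHyperbolicSaddle Z.1.1 S ∧ (∀ q ∈ B, Z.1.1 q = 0 → q = S) ∧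
        (IsResonantLinearizableAt Z.1.1 S →
          ∃ a : ℝ, (a, 0) ∈ B ∧ IsReturnEndpoint Z.1.1 S a ∧
            (∀ a' : ℝ, (a', 0) ∈ B → IsReturnEndpoint Z.1.1 S a' → a' = a) ∧
            (∃ (δ : ℝ) (π : ℝ → ℝ), IsFirstReturnMap Z.1.1 Z.2.1 a δ π) ∧
            ∀ (δ : ℝ) (π : ℝ → ℝ), IsFirstReturnMap Z.1.1 Z.2.1 a δ π →
              ∃ k₁ k₂ : ℝ,
                ((fun x : ℝ => (π (a + x) - a) - ((π a - a) + k₁ * x + k₂ * x ^ 2))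
                  =o[𝓝[≥] 0] fun x : ℝ => x ^ 2) ∧
                (0 < S.2 → 0 < |k₁| ∧ |k₁| < 1) ∧
                (S.2 ≤ 0 → k₁ = 0 ∧ 0 < k₂)) := by
  have hlw : ((2 : ℕ∞) : WithTop ℕ∞) ≤ (l : WithTop ℕ∞) := WithTop.coe_le_coe.2 hl
  have hC : ∀ X : SmoothField l, ContDiff ℝ 2 X.1 := fun X => X.2.of_le hlw
  have hclose : ∀ R ε : ℝ, 0 < ε → ∀ᶠ Z : NonsmoothField l in 𝓝 Z₀,
      IsJetClose R ε Z.1.1 Z₀.1.1 ∧ IsJetClose R ε Z.2.1 Z₀.2.1 := fun R ε hε =>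
    (continuous_fst.continuousAt.eventually (Z₀.1.eventually_isJetClose hl R hε)).and
      (continuous_snd.continuousAt.eventually (Z₀.2.eventually_isJetClose hl R hε))
  -- Ratio one for nearby fields is compatible only with zero trace at Z₀. In the other case the
  -- trace stays nonzero on a neighborhood and the linearizability hypothesis fails there.
  by_cases htr : planeDiv Z₀.1.1 0 = 0
  · obtain ⟨b, hb, R, -, ε, hε, h⟩ :=
      hcycle.exists_isReturnSetup (hC Z₀.1) (hC Z₀.2) hchart htr
    refine ⟨Metric.ball 0 b, Metric.ball_mem_nhds _ hb, _, hclose R ε hε, fun Z hZ => ?_⟩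
    obtain ⟨S, hS, hsad, huniq, u, v, lam, F, φ, r, T, L, C, N, G, Q, hset⟩ :=
      h Z.1.1 Z.2.1 (hC Z.1) (hC Z.2) hZ.1 hZ.2
    exact ⟨S, hS, hsad, huniq, hset.exists_returnMap⟩
  · obtain ⟨b, hb, R, -, ε, hε, h⟩ :=
      exists_saddle_of_planeDiv_ne_zero (hC Z₀.1) hcycle.saddle htr
    refine ⟨Metric.ball 0 b, Metric.ball_mem_nhds _ hb, _, hclose R ε hε, fun Z hZ => ?_⟩
    obtain ⟨S, hS, hsad, huniq, hres⟩ := h Z.1.1 (hC Z.1) hZ.1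
    exact ⟨S, hS, hsad, huniq, fun h => absurd h hres⟩
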